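/- Let $n\ge 1$, write points of $\mathbb{R}^{n+1}=\mathbb{R}^n\times\mathbb{R}$ as $(x,t)$, let $o$ be the origin and $Q=n+2$. Put $$\varrho(x,t)=(|x|^4+4t^2)^{1/4},\qquad \nabla_G=(\nabla_x,|x|\partial_t),\qquad \mathcal{L}_G=\Delta_x+|x|^2\partial_t^2 ,$$ and for a real-valued function $u$ and $s\in\mathbb{R}$ $$A(u)=\int_{\mathbb{R}^{n+1}}\frac{|\mathcal{L}_G u|^2}{|\nabla_G\varrho|^2}\,dx\,dt,\qquad D_s(u)=\int_{\mathbb{R}^{n+1}}\varrho^{s}|\nabla_G u|^2\,dx\,dt .$$ Assume $Q\ge 5$. For all $u\in C_c^\infty(\mathbb{R}^{n+1}\setminus\{o\})$ the integrals below are finite and (a) (second order Heisenberg uncertainty principle) $A(u)^{1/2}D_2(u)^{1/2}\ge \frac{Q+2}{2}D_0(u)$; (b) (second order Hydrogen uncertainty principle) $A(u)^{1/2}D_0(u)^{1/2}\ge \frac{Q+1}{2}D_{-1}(u)$; (c) for $b<1$: $A(u)^{1/2}D_{-2b}(u)^{1/2}\ge \frac{Q+1-b}{2}D_{-b-1}(u)$;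 (d) for $b>1$: $A(u)^{1/2}D_{-2b}(u)^{1/2}\ge \frac{Q+b-1}{2}D_{-b-1}(u)$. Sharpness. In (a), (b), (c) the constant cannot be replaced by a larger one for $u\in C_c^\infty(\mathbb{R}^{n+1}\setminus\{o\})$. The inequality (d) holds, with finite integrals, for all $u\in C_c^\infty(\mathbb{R}^{n+1})$ that are constant near $o$, and its constant cannot be replaced by a larger one in this class; if moreover $b\le\frac{Q-2}{2}$, it cannot be replaced by a larger one for $u\in C_c^\infty(\mathbb{R}^{n+1}\setminus\{o\})$ either. Equality. For all $\alpha\in\mathbb{R}$, $\beta>0$ the following functions are smooth on $\mathbb{R}^{n+1}\setminus\{o\}$, make the three integrals finite (with $A$ and $D_s$ computed from the derivatives off $o$), and give equality, with a positive right-hand side if $\alpha\ne0$: in (a) $u=\alpha e^{-\beta\varrho^2}$; in (b) $u=\alpha(1+\beta\varrho)e^{-\beta\varrho}$; in (c) $u=\alpha\int_{\varrho}^\infty s\exp\left(-\beta\frac{s^{1-b}}{1-b}\right)ds$; in (d) $u=\alpha\int_{\varrho}^\infty s^{1-Q}\exp\left(-\beta\frac{s^{1-b}}{b-1}\right)ds$.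 -/

import Mathlib

open MeasureTheory Set Filter Topology
open scoped ContDiff

noncomputable section

namespace Grushin

/-- The space `ℝⁿ × ℝ` with points `(x, t)`; its volume is the Lebesgue measure `dx dt`, and
`0` is the origin `o`. -/
abbrev Space (n : ℕ) : Type := EuclideanSpace ℝ (Fin n) × ℝ

/-- The homogeneous dimension `Q = n + 2`. -/
def homDim (n : ℕ) : ℝ := (n : ℝ) + 2

/-- The partial derivative `∂u/∂xᵢ`. -/
def dX {n : ℕ} (i : Fin n) (u : Space n → ℝ) (p : Space n) : ℝ :=
  fderiv ℝ u p (EuclideanSpace.single i 1, 0)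

/-- The partial derivative `∂u/∂t`. -/
def dT {n : ℕ} (u : Space n → ℝ) (p : Space n) : ℝ :=
  fderiv ℝ u p (0, 1)

/-- `|∇_G u|²` for the Grushin gradient `∇_G u = (∂u/∂x₁, …, ∂u/∂xₙ, |x| ∂u/∂t)`. -/
def gradSq {n : ℕ} (u : Space n → ℝ) (p : Space n) : ℝ :=
  (∑ i : Fin n, (dX i u p) ^ 2) + (‖p.1‖ * dT u p) ^ 2

/-- The Grushin operator `L_G u = Δₓ u + |x|² ∂²u/∂t²`. -/
def lap {n : ℕ} (u : Space n → ℝ) (p : Space n) : ℝ :=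
  (∑ i : Fin n, dX i (dX i u) p) + ‖p.1‖ ^ 2 * dT (dT u) p

/-- The homogeneous norm `ϱ(x,t) = (|x|⁴ + 4t²)^{1/4}`. -/
def rho {n : ℕ} (p : Space n) : ℝ := (‖p.1‖ ^ 4 + 4 * p.2 ^ 2) ^ ((1 : ℝ) / 4)

/-- The integrand `|L_G u|² / |∇_G ϱ|²`. -/
def lapDensity {n : ℕ} (u : Space n → ℝ) (p : Space n) : ℝ :=
  (lap u p) ^ 2 / gradSq (rho : Space n → ℝ) p

/-- The integrand `ϱ^s |∇_G u|²`. -/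
def gradDensity {n : ℕ} (s : ℝ) (u : Space n → ℝ) (p : Space n) : ℝ :=
  (rho p) ^ s * gradSq u p

/-- `∫ |L_G u|² / |∇_G ϱ|² dx dt`. -/
def lapEnergy {n : ℕ} (u : Space n → ℝ) : ℝ := ∫ p, lapDensity u p

/-- `∫ ϱ^s |∇_G u|² dx dt`. -/
def gradEnergy {n : ℕ} (s : ℝ) (u : Space n → ℝ) : ℝ := ∫ p, gradDensity s u p

/-- All three integrals of the uncertainty inequality with weights `ϱ^s` and `ϱ^r` converge. -/
def FiniteEnergies {n : ℕ} (s r : ℝ) (u : Space n → ℝ) : Prop :=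
  Integrable (lapDensity u) ∧ Integrable (gradDensity s u) ∧ Integrable (gradDensity r u)

/-- The inequality
`(∫ |L_G u|²/|∇_G ϱ|²)^{1/2} (∫ ϱ^s |∇_G u|²)^{1/2} ≥ c ∫ ϱ^r |∇_G u|²`. -/
def Uncertainty {n : ℕ} (s r c : ℝ) (u : Space n → ℝ) : Prop :=
  √(lapEnergy u) * √(gradEnergy s u) ≥ c * gradEnergy r u

/-- `C_c^∞(ℝ^{n+1} ∖ {o})`. -/
def testFunctions (n : ℕ) : Set (Space n → ℝ) :=
  {u | ContDiff ℝ ∞ u ∧ HasCompactSupport u ∧ tsupport u ⊆ {0}ᶜ}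

/-- The functions in `C_c^∞(ℝ^{n+1})` that are constant near the origin. -/
def testFunctionsConst (n : ℕ) : Set (Space n → ℝ) :=
  {u | ContDiff ℝ ∞ u ∧ HasCompactSupport u ∧ ∀ᶠ p in 𝓝 (0 : Space n), u p = u 0}

/-- On the class `F` the inequality with weights `ϱ^s`, `ϱ^r` holds with the constant `K`, and
with no larger constant. -/
def SharpOn {n : ℕ} (F : Set (Space n → ℝ)) (s r K : ℝ) : Prop :=
  IsGreatest {c : ℝ | ∀ u ∈ F, Uncertainty s r c u} K

/-- `u` is smooth off the origin, all three integrals are finite, and equality holds. -/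
def IsEqualityCase {n : ℕ} (s r K : ℝ) (u : Space n → ℝ) : Prop :=
  ContDiffOn ℝ ∞ u {0}ᶜ ∧ FiniteEnergies s r u ∧
    √(lapEnergy u) * √(gradEnergy s u) = K * gradEnergy r u

/-- For all real `α` and `β > 0` the function `α U_β` is an equality case, and it is not a
degenerate one if `α ≠ 0`. -/
def AttainedBy {n : ℕ} (s r K : ℝ) (U : ℝ → Space n → ℝ) : Prop :=
  ∀ α β : ℝ, 0 < β →
    IsEqualityCase s r K (fun p => α * U β p) ∧
      (α ≠ 0 → 0 < gradEnergy r (fun p => α * U β p))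

end Grushin

end

noncomputable section

namespace Grushin

variable {n : ℕ}

/-! Let `Z = x·∇ₓ + 2t∂ₜ` generate the dilations and put `a = |x|²ϱ⁻⁶`, `D = D₋₂(u)`. Everything
rests on one lower bound for `A(u)`, `lapEnergy_ge`: `A(u) ≥ D₋₂(Zu) + 2(Q-2) D₋₂(u)`.

Given this bound, let `λ` be a root of `λ² - (Q-4)λ = 2(Q-2)`, that is `λ = -2` or `λ = Q-2`. Since
`∫ϱ⁻²⟨∇Zu,∇u⟩ = -(Q-4)/2 · D`, the right side equals `∫ϱ⁻²|∇Zu + λ∇u|²`. Cauchy–Schwarz against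
`ϱ⁻ᵇ∇u` and a second integration by parts along `Z` give the constant `|λ - (Q-b-3)/2|`
(`uncertainty`). The root `-2` yields (c), hence (a) with `b = -1` and (b) with `b = 0`; the root
`Q-2` yields (d).

For the lower bound put `B = Z²u + (Q-2)Zu`, which is `ϱ²Lu/|∇ϱ|²` for radial `u`. Then `B -
ϱ²Lu/|∇ϱ|²` is purely angular, and its pairing with `F = u - (a radial function)` is the angular
Dirichlet integral `E = D - ∫a(Zu)²` (`integral_deviation`). With the Poincaré inequality `4∫aF² ≤
E` (`bulk_poincare`), the arithmetic-geometric mean inequality gives `4E ≤ ∫a(B - ϱ²Lu/|∇ϱ|²)²`.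
Expanding the square and integrating by parts along `Z` finishes the bound.

The Poincaré inequality is proved on the unit `ϱ`-sphere, with coordinates the slope `y = 2t/|x|²`
and the direction `ξ = x/|x|`. For fixed slope the sharp inequality on the Euclidean sphere applies;
it is deduced from the Gaussian Poincaré inequality through homogeneous extensions of degree
slightly above one. In the slope variable there are two Hardy-type inequalities, one for the
oscillation in `ξ` with constant `n+1 = Q-1`, one for the `ξ`-average. The functions `xᵢ` show that
the constant 4 requires `Q - 1 ≥ 4`.

For radial functions all integrals become one-dimensional. Equality in Cauchy–Schwarz means `tV' +
(1+λ)V = ∓βt^{1-b}V` for the radial derivative `V`; this gives the extremal profiles, and the Gamma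
recursion verifies equality (`isExtremal_profileLT`, `isExtremal_profileGT`). Sharpness follows by
truncating the extremals with logarithmic cutoffs, either `u` itself
(`IsExtremal.le_of_testFunctions`) or its gradient, which leaves a function constant near the origin
(`IsExtremal.le_of_testFunctionsConst`). -/

instance isAddHaarMeasure_volume : (volume : Measure (Space n)).IsAddHaarMeasure :=
  inferInstanceAs (((volume : Measure (EuclideanSpace ℝ (Fin n))).prod
    (volume : Measure ℝ)).IsAddHaarMeasure)

/-- The generator `Z = x · ∇ₓ + 2 t ∂ₜ` of the anisotropic dilations. -/
def euler (u : Space n → ℝ) (p : Space n) : ℝ := fderiv ℝ u p (p.1, 2 * p.2)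

/-- The polarization of `|∇_G u|²`. -/
def gradInner (u v : Space n → ℝ) (p : Space n) : ℝ :=
  (∑ i : Fin n, dX i u p * dX i v p) + ‖p.1‖ ^ 2 * (dT u p * dT v p)

lemma gradInner_self (u : Space n → ℝ) (p : Space n) : gradInner u u p = gradSq u p := by
  simp only [gradInner, gradSq, pow_two]
  ring

lemma gradInner_comm (u v : Space n → ℝ) (p : Space n) : gradInner u v p = gradInner v u p := by
  simp only [gradInner, mul_comm]

/-! ### Derivatives in coordinates -/

lemma sum_single (v : EuclideanSpace ℝ (Fin n)) :
    ∑ i, v i • (EuclideanSpace.single i (1 : ℝ)) = v := by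
  ext j
  simp [Finset.sum_apply, Pi.single_apply]

lemma fderiv_apply_eq (u : Space n → ℝ) (p v : Space n) :
    fderiv ℝ u p v = (∑ i, v.1 i * dX i u p) + v.2 * dT u p := by
  have h : v = (∑ i, v.1 i • ((EuclideanSpace.single i (1 : ℝ), 0) : Space n)) +
      v.2 • ((0, 1) : Space n) := by
    refine Prod.ext ?_ ?_
    · simp only [Prod.fst_add, Prod.fst_sum, Prod.smul_fst, smul_zero, add_zero]
      exact (sum_single v.1).symm
    · simp [Prod.snd_sum]
  conv_lhs => rw [h]
  simp only [map_add, map_sum, map_smul, smul_eq_mul, dX, dT]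

lemma euler_eq (u : Space n → ℝ) (p : Space n) :
    euler u p = (∑ i, p.1 i * dX i u p) + 2 * p.2 * dT u p :=
  fderiv_apply_eq u p _

/-! ### The homogeneous norm -/

lemma quartic_nonneg (p : Space n) : 0 ≤ ‖p.1‖ ^ 4 + 4 * p.2 ^ 2 := by positivity

lemma quartic_pos {p : Space n} (hp : p ≠ 0) : 0 < ‖p.1‖ ^ 4 + 4 * p.2 ^ 2 := by
  by_cases h : p.1 = 0
  · have h2 : p.2 ≠ 0 := fun h2 => hp (Prod.ext h h2)
    positivity
  · have := norm_pos_iff.2 h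
    positivity

lemma rho_nonneg (p : Space n) : 0 ≤ rho p := Real.rpow_nonneg (quartic_nonneg p) _

lemma rho_pos {p : Space n} (hp : p ≠ 0) : 0 < rho p := Real.rpow_pos_of_pos (quartic_pos hp) _

@[simp] lemma rho_zero : rho (0 : Space n) = 0 := by simp [rho]

lemma rho_pow_four (p : Space n) : rho p ^ 4 = ‖p.1‖ ^ 4 + 4 * p.2 ^ 2 := by
  rw [rho, ← Real.rpow_natCast, ← Real.rpow_mul (quartic_nonneg p)]
  norm_num

lemma rho_rpow (s : ℝ) (p : Space n) : rho p ^ s = (‖p.1‖ ^ 4 + 4 * p.2 ^ 2) ^ (s / 4) := by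
  rw [rho, ← Real.rpow_mul (quartic_nonneg p)]
  congr 1
  ring

lemma norm_le_rho (p : Space n) : ‖p.1‖ ≤ rho p := by
  refine le_of_pow_le_pow_left₀ (n := 4) (by norm_num) (rho_nonneg p) ?_
  rw [rho_pow_four]
  nlinarith [sq_nonneg p.2]

lemma abs_le_rho_sq (p : Space n) : 2 * |p.2| ≤ rho p ^ 2 := by
  refine le_of_pow_le_pow_left₀ (n := 2) (by norm_num) (by positivity) ?_
  rw [← pow_mul, rho_pow_four, mul_pow, sq_abs]
  nlinarith [sq_nonneg (‖p.1‖ ^ 2)]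

lemma contDiff_quartic : ContDiff ℝ ∞ (fun p : Space n => ‖p.1‖ ^ 4 + 4 * p.2 ^ 2) := by
  have h : (fun p : Space n => ‖p.1‖ ^ 4 + 4 * p.2 ^ 2) =
      fun p : Space n => (‖p.1‖ ^ 2) ^ 2 + 4 * p.2 ^ 2 := by
    ext p; ring
  rw [h]
  exact (((contDiff_fst.norm_sq ℝ)).pow 2).add (contDiff_const.mul (contDiff_snd.pow 2))

lemma continuous_rho : Continuous (rho : Space n → ℝ) :=
  contDiff_quartic.continuous.rpow_const fun _ => Or.inr (by norm_num)

lemma measurable_rho : Measurable (rho : Space n → ℝ) := continuous_rho.measurable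

lemma contDiffOn_rho_rpow (s : ℝ) : ContDiffOn ℝ ∞ (fun p : Space n => rho p ^ s) {0}ᶜ := by
  simp only [rho_rpow]
  exact contDiff_quartic.contDiffOn.rpow_const_of_ne fun p hp => (quartic_pos hp).ne'

lemma contDiffOn_rho : ContDiffOn ℝ ∞ (rho : Space n → ℝ) {0}ᶜ := by
  simpa using contDiffOn_rho_rpow (n := n) 1

lemma hasFDerivAt_quartic (p : Space n) :
    HasFDerivAt (fun p : Space n => ‖p.1‖ ^ 4 + 4 * p.2 ^ 2)
      ((4 * ‖p.1‖ ^ 2) • (innerSL ℝ p.1).comp (ContinuousLinearMap.fst ℝ _ _) +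
        (8 * p.2) • ContinuousLinearMap.snd ℝ _ _) p := by
  have h1 : HasFDerivAt (fun p : Space n => ‖p.1‖ ^ 2) _ p :=
    (hasFDerivAt_fst (𝕜 := ℝ) (p := p)).norm_sq
  have h2 := (h1.pow 2).add (((hasFDerivAt_snd (𝕜 := ℝ) (p := p)).pow 2).const_mul 4)
  have h3 : (fun p : Space n => ‖p.1‖ ^ 4 + 4 * p.2 ^ 2) =
      fun p : Space n => (‖p.1‖ ^ 2) ^ 2 + 4 * p.2 ^ 2 := by
    ext p; ring
  rw [h3]
  refine h2.congr_fderiv ?_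
  ext v <;> simp <;> ring

lemma hasFDerivAt_rho_rpow (s : ℝ) {p : Space n} (hp : p ≠ 0) :
    HasFDerivAt (fun p : Space n => rho p ^ s)
      ((s * rho p ^ (s - 4)) • (‖p.1‖ ^ 2 • (innerSL ℝ p.1).comp (ContinuousLinearMap.fst ℝ _ _) +
        (2 * p.2) • ContinuousLinearMap.snd ℝ _ _)) p := by
  simp only [rho_rpow]
  refine ((hasFDerivAt_quartic p).rpow_const (p := s / 4)
    (Or.inl (quartic_pos hp).ne')).congr_fderiv ?_
  have : (s - 4) / 4 = s / 4 - 1 := by ring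
  rw [this]
  ext v <;> simp <;> ring

lemma fderiv_rho_rpow (s : ℝ) {p : Space n} (hp : p ≠ 0) (v : Space n) :
    fderiv ℝ (fun p : Space n => rho p ^ s) p v =
      s * rho p ^ (s - 4) * (‖p.1‖ ^ 2 * inner ℝ p.1 v.1 + 2 * p.2 * v.2) := by
  rw [(hasFDerivAt_rho_rpow s hp).fderiv]
  simp [mul_add]

lemma rho_rpow_mul {p : Space n} (hp : p ≠ 0) (s r : ℝ) :
    rho p ^ s * rho p ^ r = rho p ^ (s + r) := (Real.rpow_add (rho_pos hp) s r).symm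

lemma euler_rho_rpow (s : ℝ) {p : Space n} (hp : p ≠ 0) :
    euler (fun p : Space n => rho p ^ s) p = s * rho p ^ s := by
  rw [euler, fderiv_rho_rpow s hp]
  simp only [real_inner_self_eq_norm_sq]
  have h : rho p ^ s = rho p ^ (s - 4) * rho p ^ 4 := by
    rw [← Real.rpow_natCast, ← Real.rpow_add (rho_pos hp)]
    norm_num
  rw [h, rho_pow_four]
  ring

lemma sum_coord_sq (x : EuclideanSpace ℝ (Fin n)) : ∑ i, x i ^ 2 = ‖x‖ ^ 2 := by
  rw [EuclideanSpace.real_norm_sq_eq]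

lemma inner_single_right (x : EuclideanSpace ℝ (Fin n)) (i : Fin n) :
    inner ℝ x (EuclideanSpace.single i (1 : ℝ)) = x i := by
  rw [EuclideanSpace.inner_single_right]; simp

/-- The Euclidean gradient of `ϱˢ` is `sϱ^{s-4}(|x|²x, 2t)`. The weight `|x|²` on the `t`-component
of the pairing turns it into `|x|²(x, 2t)`, so pairing with `∇_G ϱˢ` sees only the dilation
derivative. -/
lemma gradInner_rho_rpow (s : ℝ) {p : Space n} (hp : p ≠ 0) (u : Space n → ℝ) :
    gradInner (fun p : Space n => rho p ^ s) u p =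
      s * rho p ^ (s - 4) * ‖p.1‖ ^ 2 * euler u p := by
  have h1 : ∀ i, dX i (fun p : Space n => rho p ^ s) p =
      s * rho p ^ (s - 4) * ‖p.1‖ ^ 2 * p.1 i := fun i => by
    rw [dX, fderiv_rho_rpow s hp]
    simp only [inner_single_right]
    ring
  have h2 : dT (fun p : Space n => rho p ^ s) p = s * rho p ^ (s - 4) * (2 * p.2) := by
    rw [dT, fderiv_rho_rpow s hp]
    simp
  simp only [gradInner, h1, h2, euler_eq, mul_add, Finset.mul_sum]
  congr 1
  · exact Finset.sum_congr rfl fun i _ => by ring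
  · ring

lemma gradSq_rho {p : Space n} (hp : p ≠ 0) :
    gradSq (rho : Space n → ℝ) p = ‖p.1‖ ^ 2 / rho p ^ 2 := by
  have h0 : (rho : Space n → ℝ) = fun p => rho p ^ (1 : ℝ) := by simp
  have hr := rho_pos hp
  rw [← gradInner_self]
  conv_lhs => rw [h0]
  rw [gradInner_rho_rpow 1 hp, euler_rho_rpow 1 hp]
  have h3 : rho p ^ ((1 : ℝ) - 4) = (rho p ^ 3)⁻¹ := by
    rw [show ((1 : ℝ) - 4) = -((3 : ℕ) : ℝ) by norm_num, Real.rpow_neg hr.le, Real.rpow_natCast]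
  rw [h3, Real.rpow_one]
  field_simp

/-! ### Smoothness and supports of derivatives -/

lemma contDiff_fderiv_apply {k m : WithTop ℕ∞} {u : Space n → ℝ} {e : Space n → Space n}
    (hu : ContDiff ℝ m u) (he : ContDiff ℝ k e) (hk : k + 1 ≤ m) :
    ContDiff ℝ k (fun p => fderiv ℝ u p (e p)) :=
  (hu.fderiv_right hk).clm_apply he

lemma contDiff_dX {u : Space n → ℝ} (hu : ContDiff ℝ ∞ u) (i : Fin n) :
    ContDiff ℝ ∞ (dX i u) := contDiff_fderiv_apply hu contDiff_const le_rfl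

lemma contDiff_dT {u : Space n → ℝ} (hu : ContDiff ℝ ∞ u) :
    ContDiff ℝ ∞ (dT u) := contDiff_fderiv_apply hu contDiff_const le_rfl

lemma contDiff_scaling : ContDiff ℝ ∞ (fun p : Space n => ((p.1, 2 * p.2) : Space n)) :=
  contDiff_fst.prodMk (contDiff_const.mul contDiff_snd)

lemma contDiff_euler {u : Space n → ℝ} (hu : ContDiff ℝ ∞ u) : ContDiff ℝ ∞ (euler u) :=
  contDiff_fderiv_apply hu contDiff_scaling le_rfl

lemma contDiff_normSq : ContDiff ℝ ∞ (fun p : Space n => ‖p.1‖ ^ 2) := contDiff_fst.norm_sq ℝ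

lemma contDiff_gradInner {u v : Space n → ℝ} (hu : ContDiff ℝ ∞ u) (hv : ContDiff ℝ ∞ v) :
    ContDiff ℝ ∞ (gradInner u v) :=
  (ContDiff.sum fun i _ => (contDiff_dX hu i).mul (contDiff_dX hv i)).add
    (contDiff_normSq.mul ((contDiff_dT hu).mul (contDiff_dT hv)))

lemma contDiff_lap {u : Space n → ℝ} (hu : ContDiff ℝ ∞ u) : ContDiff ℝ ∞ (lap u) :=
  (ContDiff.sum fun i _ => contDiff_dX (contDiff_dX hu i) i).add
    (contDiff_normSq.mul (contDiff_dT (contDiff_dT hu)))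

/-- The function `F` has compact support off the origin. -/
def SuppOff {α : Type*} [Zero α] (F : Space n → α) : Prop :=
  HasCompactSupport F ∧ (0 : Space n) ∉ tsupport F

lemma SuppOff.mono {α β : Type*} [Zero α] [Zero β] {F : Space n → α} {G : Space n → β}
    (hF : SuppOff F) (h : tsupport G ⊆ tsupport F) : SuppOff G :=
  ⟨HasCompactSupport.intro' hF.1 (isClosed_tsupport F)
    fun _ hx => image_eq_zero_of_notMem_tsupport fun h' => hx (h h'), fun h' => hF.2 (h h')⟩

lemma SuppOff.mono_zero {α β : Type*} [Zero α] [Zero β] {F : Space n → α} {G : Space n → β}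
    (hF : SuppOff F) (h : ∀ p, F p = 0 → G p = 0) : SuppOff G :=
  hF.mono (closure_mono fun p hp hp' => hp (h p hp'))

lemma SuppOff.mul_left {F : Space n → ℝ} (hF : SuppOff F) (G : Space n → ℝ) :
    SuppOff (fun p => G p * F p) := hF.mono_zero fun p hp => by simp [hp]

lemma SuppOff.mul_right {F : Space n → ℝ} (hF : SuppOff F) (G : Space n → ℝ) :
    SuppOff (fun p => F p * G p) := hF.mono_zero fun p hp => by simp [hp]

lemma SuppOff.fderiv {F : Space n → ℝ} (hF : SuppOff F) : SuppOff (fderiv ℝ F) :=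
  hF.mono (tsupport_fderiv_subset ℝ)

lemma SuppOff.add {F G : Space n → ℝ} (hF : SuppOff F) (hG : SuppOff G) :
    SuppOff (fun p => F p + G p) := by
  refine ⟨hF.1.add hG.1, fun h => ?_⟩
  rcases (tsupport_add F G) h with h | h
  exacts [hF.2 h, hG.2 h]

lemma SuppOff.eventually_zero {α : Type*} [Zero α] {F : Space n → α} (hF : SuppOff F) :
    ∀ᶠ p in 𝓝 (0 : Space n), F p = 0 :=
  notMem_tsupport_iff_eventuallyEq.1 hF.2

/-- The product vanishes near the origin, so singular weights such as negative powers of `ϱ` cost no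
regularity. -/
lemma SuppOff.contDiff_mul {F h : Space n → ℝ} {k : WithTop ℕ∞} (hF : SuppOff F)
    (hFc : ContDiff ℝ k F) (hh : ContDiffOn ℝ k h {0}ᶜ) : ContDiff ℝ k (fun p => h p * F p) := by
  refine contDiff_iff_contDiffAt.2 fun p => ?_
  by_cases hp : p = 0
  · subst hp
    refine (contDiffAt_const (c := (0 : ℝ))).congr_of_eventuallyEq ?_
    filter_upwards [hF.eventually_zero] with q hq
    simp [hq]
  · exact (hh.contDiffAt (isOpen_compl_singleton.mem_nhds hp)).mul hFc.contDiffAt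

lemma SuppOff.continuous_mul {F h : Space n → ℝ} (hF : SuppOff F)
    (hFc : Continuous F) (hh : ContinuousOn h {0}ᶜ) : Continuous (fun p => h p * F p) :=
  contDiff_zero.1 (hF.contDiff_mul (k := 0) (contDiff_zero.2 hFc) (contDiffOn_zero.2 hh))

lemma SuppOff.integrable {F : Space n → ℝ} (hF : SuppOff F) (hFc : Continuous F) :
    Integrable F := hFc.integrable_of_hasCompactSupport hF.1

lemma SuppOff.integrable_rho_rpow_mul {F : Space n → ℝ} (hF : SuppOff F) (hFc : Continuous F)
    (s : ℝ) : Integrable (fun p => rho p ^ s * F p) :=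
  (hF.mul_left _).integrable (hF.continuous_mul hFc (contDiffOn_rho_rpow s).continuousOn)

/-! ### Integration by parts -/

/-- Integration by parts against the constant 1. -/
lemma integral_fderiv_apply_eq_zero {F : Space n → ℝ} (hF : ContDiff ℝ 1 F)
    (hs : HasCompactSupport F) (e : Space n) : ∫ p, fderiv ℝ F p e = 0 := by
  have hd : Continuous (fun p => fderiv ℝ F p e) :=
    (hF.continuous_fderiv one_ne_zero).clm_apply continuous_const
  have hi : Integrable (fun p => fderiv ℝ F p e) :=
    hd.integrable_of_hasCompactSupport (hs.fderiv_apply (𝕜 := ℝ) e)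
  have h := integral_mul_fderiv_eq_neg_fderiv_mul_of_integrable (μ := (volume : Measure (Space n)))
    (f := fun _ => (1 : ℝ)) (g := F) (v := e) (by simp) (by simpa using hi)
    (by simpa using hF.continuous.integrable_of_hasCompactSupport hs)
    (fun _ _ => differentiableAt_const _) (fun _ _ => hF.differentiable one_ne_zero _)
  simpa using h

/-- The divergence of `(x, 2t)` is `n + 2 = Q`. -/
lemma integral_euler {F : Space n → ℝ} (hF : ContDiff ℝ 1 F) (hs : HasCompactSupport F) :
    ∫ p, euler F p = -homDim n * ∫ p, F p := by
  have hFi := hF.continuous.integrable_of_hasCompactSupport (μ := volume) hs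
  have hFd := hF.differentiable one_ne_zero
  -- Each term of `Z` is a linear coefficient `c` times a derivative along a fixed `e`; integration
  -- by parts produces `-c(e)`. These sum to `n · 1 + 2`.
  have key : ∀ (e : Space n) (c : Space n →L[ℝ] ℝ), ∫ p, c p * fderiv ℝ F p e =
      -(c e) * ∫ p, F p := by
    intro e c
    have hc : ContDiff ℝ 1 (fun p => c p * F p) := c.contDiff.mul hF
    have h0 := integral_fderiv_apply_eq_zero hc (hs.mul_left) e
    have h1 : ∀ p, fderiv ℝ (fun p => c p * F p) p e = c p * fderiv ℝ F p e + c e * F p := by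
      intro p
      rw [fderiv_fun_mul c.differentiableAt (hFd p)]
      simp [mul_comm]
    simp only [h1] at h0
    rw [integral_add, integral_const_mul] at h0
    · linarith
    · have hd : Continuous (fun p => c p * fderiv ℝ F p e) :=
        c.continuous.mul ((hF.continuous_fderiv one_ne_zero).clm_apply continuous_const)
      exact hd.integrable_of_hasCompactSupport ((hs.fderiv_apply (𝕜 := ℝ) e).mul_left)
    · exact hFi.const_mul _
  have hint : ∀ (e : Space n) (c : Space n →L[ℝ] ℝ),
      Integrable (fun p => c p * fderiv ℝ F p e) := fun e c => by
    have hd : Continuous (fun p => c p * fderiv ℝ F p e) :=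
      c.continuous.mul ((hF.continuous_fderiv one_ne_zero).clm_apply continuous_const)
    exact hd.integrable_of_hasCompactSupport ((hs.fderiv_apply (𝕜 := ℝ) e).mul_left)
  let cX : Fin n → Space n →L[ℝ] ℝ := fun i =>
    (EuclideanSpace.proj i).comp (ContinuousLinearMap.fst ℝ _ _)
  let cT : Space n →L[ℝ] ℝ := (2 : ℝ) • ContinuousLinearMap.snd ℝ _ _
  have he : ∀ p, euler F p = (∑ i, cX i p * fderiv ℝ F p (EuclideanSpace.single i 1, 0)) +
      cT p * fderiv ℝ F p (0, 1) := fun p => by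
    rw [euler_eq]; rfl
  simp only [he]
  rw [integral_add (integrable_finsetSum _ fun i _ => hint _ _) (hint _ _),
    integral_finsetSum _ fun i _ => hint _ _]
  simp only [key]
  simp [cX, cT, homDim]
  ring

lemma euler_rho_rpow_mul (s : ℝ) {F : Space n → ℝ} (hF : Differentiable ℝ F) {p : Space n}
    (hp : p ≠ 0) :
    euler (fun p => rho p ^ s * F p) p = rho p ^ s * (s * F p + euler F p) := by
  have h := euler_rho_rpow s hp
  simp only [euler] at h ⊢
  rw [fderiv_fun_mul (hasFDerivAt_rho_rpow s hp).differentiableAt (hF p)]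
  simp only [add_apply, smul_apply, smul_eq_mul, h]
  ring

lemma ae_ne_zero : ∀ᵐ p : Space n, p ≠ 0 := by
  have : Nontrivial (Space n) := inferInstance
  exact compl_mem_ae_iff.2 (measure_singleton _)

lemma SuppOff.euler {F : Space n → ℝ} (hF : SuppOff F) : SuppOff (euler F) :=
  hF.fderiv.mono_zero fun p hp => by simp [Grushin.euler, hp]

lemma continuous_euler {F : Space n → ℝ} (hF : ContDiff ℝ 1 F) : Continuous (euler F) :=
  (hF.continuous_fderiv one_ne_zero).clm_apply contDiff_scaling.continuous

/-- Apply `integral_euler` to `ϱˢF`, using that `ϱˢ` is homogeneous of degree `s` under the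
dilations. -/
lemma integral_rho_rpow_mul_euler (s : ℝ) {F : Space n → ℝ} (hF : ContDiff ℝ 1 F)
    (hs : SuppOff F) :
    ∫ p, rho p ^ s * euler F p = -(homDim n + s) * ∫ p, rho p ^ s * F p := by
  have h := integral_euler (hs.contDiff_mul hF ((contDiffOn_rho_rpow s).of_le (by simp)))
    (hs.mul_left _).1
  have h1 : ∫ p, Grushin.euler (fun p => rho p ^ s * F p) p =
      ∫ p, (s * (rho p ^ s * F p) + rho p ^ s * euler F p) := by
    refine integral_congr_ae ?_
    filter_upwards [ae_ne_zero] with p hp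
    rw [euler_rho_rpow_mul s (hF.differentiable one_ne_zero) hp]
    ring
  rw [h1, integral_add, integral_const_mul] at h
  · linarith
  · exact (hs.integrable_rho_rpow_mul hF.continuous s).const_mul _
  · exact hs.euler.integrable_rho_rpow_mul (continuous_euler hF) s

lemma euler_mul {F G : Space n → ℝ} {p : Space n} (hF : DifferentiableAt ℝ F p)
    (hG : DifferentiableAt ℝ G p) :
    euler (fun p => F p * G p) p = euler F p * G p + F p * euler G p := by
  simp only [euler]
  rw [fderiv_fun_mul hF hG]
  simp only [add_apply, smul_apply, smul_eq_mul]
  ring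

lemma fderiv_normSq (p v : Space n) :
    fderiv ℝ (fun p : Space n => ‖p.1‖ ^ 2) p v = 2 * inner ℝ p.1 v.1 := by
  rw [((hasFDerivAt_fst (𝕜 := ℝ) (p := p)).norm_sq).fderiv]
  simp

lemma euler_normSq (p : Space n) : euler (fun p : Space n => ‖p.1‖ ^ 2) p = 2 * ‖p.1‖ ^ 2 := by
  rw [euler, fderiv_normSq, real_inner_self_eq_norm_sq]

/-- The extra 2 is the degree of homogeneity of `|x|²`. -/
lemma integral_normSq_rho_rpow_mul_euler (s : ℝ) {F : Space n → ℝ} (hF : ContDiff ℝ 1 F)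
    (hs : SuppOff F) :
    ∫ p, rho p ^ s * (‖p.1‖ ^ 2 * euler F p) =
      -(homDim n + s + 2) * ∫ p, rho p ^ s * (‖p.1‖ ^ 2 * F p) := by
  have hN : ContDiff ℝ 1 (fun p : Space n => ‖p.1‖ ^ 2) := contDiff_normSq.of_le (by simp)
  have hNF := hN.mul hF
  have h := integral_rho_rpow_mul_euler s hNF (hs.mul_left _)
  have h1 : ∀ p, rho p ^ s * Grushin.euler (fun p => ‖p.1‖ ^ 2 * F p) p =
      2 * (rho p ^ s * (‖p.1‖ ^ 2 * F p)) + rho p ^ s * (‖p.1‖ ^ 2 * euler F p) := fun p => by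
    rw [euler_mul (hN.differentiable one_ne_zero p) (hF.differentiable one_ne_zero p),
      euler_normSq]
    ring
  simp only [h1] at h
  rw [integral_add, integral_const_mul] at h
  · linarith
  · exact ((hs.mul_left _).integrable_rho_rpow_mul hNF.continuous s).const_mul _
  · exact (hs.euler.mul_left _).integrable_rho_rpow_mul
      (hN.continuous.mul (continuous_euler hF)) s

lemma integral_mul_fderiv_apply {F G : Space n → ℝ} (hF : ContDiff ℝ 1 F) (hs : HasCompactSupport F)
    (hG : ContDiff ℝ 1 G) (e : Space n) :
    ∫ p, F p * fderiv ℝ G p e = -∫ p, fderiv ℝ F p e * G p := by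
  have hF' : Continuous (fun p => fderiv ℝ F p e) :=
    (hF.continuous_fderiv one_ne_zero).clm_apply continuous_const
  have hG' : Continuous (fun p => fderiv ℝ G p e) :=
    (hG.continuous_fderiv one_ne_zero).clm_apply continuous_const
  exact integral_mul_fderiv_eq_neg_fderiv_mul_of_integrable
    ((hF'.mul hG.continuous).integrable_of_hasCompactSupport
      ((hs.fderiv_apply (𝕜 := ℝ) e).mul_right))
    ((hF.continuous.mul hG').integrable_of_hasCompactSupport hs.mul_right)
    ((hF.continuous.mul hG.continuous).integrable_of_hasCompactSupport hs.mul_right)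
    (fun _ _ => hF.differentiable one_ne_zero _) (fun _ _ => hG.differentiable one_ne_zero _)

/-- The operator is in divergence form because the coefficient `|x|²` does not depend on `t`. -/
lemma integral_mul_lap {F u : Space n → ℝ} (hF : ContDiff ℝ 1 F) (hs : HasCompactSupport F)
    (hu : ContDiff ℝ ∞ u) :
    ∫ p, F p * lap u p = -∫ p, gradInner F u p := by
  have hN : ContDiff ℝ 1 (fun p : Space n => ‖p.1‖ ^ 2) := contDiff_normSq.of_le (by simp)
  have hX : ∀ i, ContDiff ℝ 1 (dX i u) := fun i => (contDiff_dX hu i).of_le (by simp)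
  have hT : ContDiff ℝ 1 (dT u) := (contDiff_dT hu).of_le (by simp)
  have cd : ∀ {G : Space n → ℝ} (e : Space n), ContDiff ℝ 1 G →
      Continuous (fun p => fderiv ℝ G p e) := fun e hG =>
    (hG.continuous_fderiv one_ne_zero).clm_apply continuous_const
  have ix : ∀ i, Integrable (fun p => F p * dX i (dX i u) p) := fun i =>
    (hF.continuous.mul (cd _ (hX i))).integrable_of_hasCompactSupport hs.mul_right
  have it : Integrable (fun p => (‖p.1‖ ^ 2 * F p) * dT (dT u) p) :=
    ((hN.mul hF).continuous.mul (cd _ hT)).integrable_of_hasCompactSupport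
      ((hs.mul_left).mul_right)
  have jx : ∀ i, Integrable (fun p => dX i F p * dX i u p) := fun i =>
    ((cd _ hF).mul (hX i).continuous).integrable_of_hasCompactSupport
      (((hs.fderiv_apply (𝕜 := ℝ) _)).mul_right)
  have jt : Integrable (fun p => ‖p.1‖ ^ 2 * (dT F p * dT u p)) :=
    (hN.continuous.mul ((cd _ hF).mul hT.continuous)).integrable_of_hasCompactSupport
      ((((hs.fderiv_apply (𝕜 := ℝ) _)).mul_right).mul_left)
  have h1 : ∀ p, F p * lap u p = (∑ i, F p * dX i (dX i u) p) +
      (‖p.1‖ ^ 2 * F p) * dT (dT u) p := fun p => by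
    rw [lap, mul_add, Finset.mul_sum]; ring
  simp only [h1, gradInner]
  rw [integral_add (integrable_finsetSum _ fun i _ => ix i) it,
    integral_add (integrable_finsetSum _ fun i _ => jx i) jt,
    integral_finsetSum _ fun i _ => ix i, integral_finsetSum _ fun i _ => jx i, neg_add,
    ← Finset.sum_neg_distrib]
  congr 1
  · exact Finset.sum_congr rfl fun i _ => integral_mul_fderiv_apply hF hs (hX i) _
  · refine (integral_mul_fderiv_apply (hN.mul hF) hs.mul_left hT _).trans ?_
    congr 1
    refine integral_congr_ae (ae_of_all _ fun p => ?_)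
    have : fderiv ℝ (fun p : Space n => ‖p.1‖ ^ 2 * F p) p (0, 1) = ‖p.1‖ ^ 2 * dT F p := by
      rw [fderiv_fun_mul (hN.differentiable one_ne_zero p) (hF.differentiable one_ne_zero p)]
      simp only [add_apply, smul_apply, smul_eq_mul,
        fderiv_normSq, inner_zero_right, dT]
      ring
    simp only [this]
    ring

/-! ### The commutation of the Grushin gradient with the dilations -/

/-- Symmetry of the second derivative lets `Z` pass through a derivative along `e`; the remaining
term differentiates the coefficients of `Z`. -/
lemma fderiv_euler {u : Space n → ℝ} (hu : ContDiff ℝ ∞ u) (p e : Space n) :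
    fderiv ℝ (euler u) p e =
      euler (fun q => fderiv ℝ u q e) p + fderiv ℝ u p (e.1, 2 * e.2) := by
  have hd : DifferentiableAt ℝ (fderiv ℝ u) p :=
    ((hu.fderiv_right (m := ∞) le_rfl).differentiable (by simp)) p
  have hsc : HasFDerivAt (fun p : Space n => ((p.1, 2 * p.2) : Space n))
      ((ContinuousLinearMap.fst ℝ _ _).prod ((2 : ℝ) • ContinuousLinearMap.snd ℝ _ _)) p :=
    hasFDerivAt_fst.prodMk (hasFDerivAt_snd.const_mul 2)
  have hsym : IsSymmSndFDerivAt ℝ u p :=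
    (hu.contDiffAt).isSymmSndFDerivAt (by
      rw [minSmoothness_of_isRCLikeNormedField]; exact WithTop.coe_le_coe.2 (le_top : (2 : ℕ∞) ≤ ⊤))
  have h1 : fderiv ℝ (euler u) p e =
      fderiv ℝ (fderiv ℝ u) p e (p.1, 2 * p.2) + fderiv ℝ u p (e.1, 2 * e.2) := by
    have := (hd.hasFDerivAt.clm_apply hsc).fderiv
    unfold euler
    rw [this]
    simp [add_comm]
  have h2 : euler (fun q => fderiv ℝ u q e) p = fderiv ℝ (fderiv ℝ u) p (p.1, 2 * p.2) e := by
    unfold euler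
    rw [(hd.hasFDerivAt.clm_apply (hasFDerivAt_const e p)).fderiv]
    simp
  rw [h1, h2, hsym.eq]

lemma dX_euler {u : Space n → ℝ} (hu : ContDiff ℝ ∞ u) (i : Fin n) (p : Space n) :
    dX i (euler u) p = euler (dX i u) p + dX i u p := by
  have h := fderiv_euler hu p (EuclideanSpace.single i 1, 0)
  simp only [mul_zero] at h
  exact h

lemma dT_euler {u : Space n → ℝ} (hu : ContDiff ℝ ∞ u) (p : Space n) :
    dT (euler u) p = euler (dT u) p + 2 * dT u p := by
  have h := fderiv_euler hu p (0, 1)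
  have h2 : fderiv ℝ u p ((0, 2 * 1) : Space n) = 2 * fderiv ℝ u p (0, 1) := by
    rw [← smul_eq_mul (2 : ℝ) (fderiv ℝ u p (0, 1)), ← map_smul]; simp
  simp only [h2] at h
  exact h

/-- Derivatives in `x` lower the degree by 1 and those in `t` by 2, but the latter carry `|x|`.
Hence `∇_G` lowers the degree by 1 throughout, and the pairing of two gradients by 2. -/
lemma euler_gradInner {u v : Space n → ℝ} (hu : ContDiff ℝ ∞ u) (hv : ContDiff ℝ ∞ v)
    (p : Space n) :
    euler (gradInner u v) p =
      gradInner (euler u) v p + gradInner u (euler v) p - 2 * gradInner u v p := by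
  have dX' : ∀ {w : Space n → ℝ} (_ : ContDiff ℝ ∞ w) (i : Fin n), DifferentiableAt ℝ (dX i w) p :=
    fun hw i => (contDiff_dX hw i).differentiable (by simp) p
  have dT' : ∀ {w : Space n → ℝ} (_ : ContDiff ℝ ∞ w), DifferentiableAt ℝ (dT w) p :=
    fun hw => (contDiff_dT hw).differentiable (by simp) p
  have hN : DifferentiableAt ℝ (fun p : Space n => ‖p.1‖ ^ 2) p :=
    contDiff_normSq.differentiable (by simp) p
  have h1 : euler (gradInner u v) p =
      (∑ i, euler (fun p => dX i u p * dX i v p) p) +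
        euler (fun p => ‖p.1‖ ^ 2 * (dT u p * dT v p)) p := by
    unfold gradInner
    simp only [euler]
    rw [fderiv_fun_add (DifferentiableAt.fun_sum fun i _ => (dX' hu i).fun_mul (dX' hv i))
      (hN.fun_mul ((dT' hu).fun_mul (dT' hv))), fderiv_fun_sum fun i _ => (dX' hu i).fun_mul (dX' hv i)]
    simp
  rw [h1, euler_mul hN ((dT' hu).fun_mul (dT' hv)), euler_mul (dT' hu) (dT' hv), euler_normSq]
  simp only [euler_mul (dX' hu _) (dX' hv _), gradInner, dX_euler hu, dX_euler hv, dT_euler hu,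
    dT_euler hv, add_mul, mul_add, Finset.sum_add_distrib]
  ring

/-! ### Polar coordinates -/

/-- The anisotropic dilation by the factor `a`. -/
def dil (a : ℝ) (p : Space n) : Space n := (a • p.1, a ^ 2 * p.2)

/-- The distance to the `t`-axis of the point with slope `y` on the unit `ϱ`-sphere. -/
def slopeRadius (y : ℝ) : ℝ := (1 + y ^ 2) ^ (-(1 / 4) : ℝ)

/-- The unit sphere of `ℝⁿ`. -/
abbrev Sph (n : ℕ) : Type := Metric.sphere (0 : EuclideanSpace ℝ (Fin n)) 1

/-- The surface measure of the unit sphere of `ℝⁿ`. -/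
def surf (n : ℕ) : Measure (Sph n) := (volume : Measure (EuclideanSpace ℝ (Fin n))).toSphere

/-- The point of the unit `ϱ`-sphere with slope `2t/|x|² = y` and direction `x/|x| = ξ`. -/
def unitPoint (θ : ℝ × Sph n) : Space n :=
  (slopeRadius θ.1 • (θ.2 : EuclideanSpace ℝ (Fin n)), slopeRadius θ.1 ^ 2 * θ.1 / 2)

instance isFiniteMeasure_surf : IsFiniteMeasure (surf n) := by unfold surf; infer_instance

lemma slopeRadius_pos (y : ℝ) : 0 < slopeRadius y := Real.rpow_pos_of_pos (by positivity) _

lemma slopeRadius_pow_four (y : ℝ) : slopeRadius y ^ 4 * (1 + y ^ 2) = 1 := by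
  rw [slopeRadius, ← Real.rpow_natCast, ← Real.rpow_mul (by positivity)]
  have h : (-(1 / 4) : ℝ) * ((4 : ℕ) : ℝ) = -1 := by norm_num
  rw [h, Real.rpow_neg_one]
  field_simp

lemma contDiff_slopeRadius : ContDiff ℝ ∞ slopeRadius :=
  (contDiff_const.add (contDiff_id.pow 2)).rpow_const_of_ne fun y => by positivity

lemma continuous_slopeRadius : Continuous slopeRadius := contDiff_slopeRadius.continuous

lemma continuous_unitPoint : Continuous (unitPoint : ℝ × Sph n → Space n) := by
  have h : Continuous fun θ : ℝ × Sph n => slopeRadius θ.1 :=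
    continuous_slopeRadius.comp continuous_fst
  exact (h.smul (continuous_subtype_val.comp continuous_snd)).prodMk
    (((h.pow 2).mul continuous_fst).div_const 2)

lemma norm_sph (ξ : Sph n) : ‖(ξ : EuclideanSpace ℝ (Fin n))‖ = 1 := by simp

lemma norm_unitPoint_fst (θ : ℝ × Sph n) : ‖(unitPoint θ).1‖ = slopeRadius θ.1 := by
  simp [unitPoint, norm_smul, abs_of_pos (slopeRadius_pos _)]

lemma rho_unitPoint (θ : ℝ × Sph n) : rho (unitPoint θ) = 1 := by
  have h : rho (unitPoint θ) ^ 4 = 1 := by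
    rw [rho_pow_four, norm_unitPoint_fst]
    simp only [unitPoint]
    have := slopeRadius_pow_four θ.1
    linear_combination this
  exact (pow_eq_one_iff_of_nonneg (rho_nonneg _) (by norm_num)).1 h

lemma rho_dil {a : ℝ} (ha : 0 ≤ a) (p : Space n) : rho (dil a p) = a * rho p := by
  have h : rho (dil a p) ^ 4 = (a * rho p) ^ 4 := by
    rw [mul_pow, rho_pow_four, rho_pow_four]
    simp only [dil, norm_smul, Real.norm_eq_abs, mul_pow, abs_of_nonneg ha]
    ring
  exact (pow_left_inj₀ (rho_nonneg _) (mul_nonneg ha (rho_nonneg _)) (by norm_num)).1 h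

lemma continuous_dil : Continuous fun z : ℝ × Space n => dil z.1 z.2 := by
  unfold dil; fun_prop

lemma lintegral_comp_mul_left_of_pos {a : ℝ} (ha : 0 < a) {f : ℝ → ENNReal} (hf : Measurable f) :
    ∫⁻ x, f x = ENNReal.ofReal a * ∫⁻ x, f (a * x) := by
  have h := Real.smul_map_volume_mul_left ha.ne'
  conv_lhs => rw [← h]
  rw [lintegral_smul_measure, lintegral_map hf (by fun_prop), abs_of_pos ha, smul_eq_mul]

lemma setLIntegral_Ioi_comp_mul_left {a : ℝ} (ha : 0 < a) {f : ℝ → ENNReal} (hf : Measurable f) :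
    ∫⁻ x in Ioi 0, f x = ENNReal.ofReal a * ∫⁻ x in Ioi 0, f (a * x) := by
  rw [← lintegral_indicator measurableSet_Ioi, ← lintegral_indicator measurableSet_Ioi,
    lintegral_comp_mul_left_of_pos ha (hf.indicator measurableSet_Ioi)]
  congr 2
  ext x
  simp only [indicator, mem_Ioi, mul_pos_iff_of_pos_left ha]

lemma lintegral_polar (hn : 1 ≤ n) {f : EuclideanSpace ℝ (Fin n) → ENNReal} (hf : Measurable f) :
    ∫⁻ x, f x = ∫⁻ ξ, ∫⁻ r in Ioi (0 : ℝ),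
      f (r • (ξ : EuclideanSpace ℝ (Fin n))) * ENNReal.ofReal (r ^ (n - 1)) ∂volume ∂surf n := by
  have : Nonempty (Fin n) := ⟨⟨0, hn⟩⟩
  let e := homeomorphUnitSphereProd (EuclideanSpace ℝ (Fin n))
  have hmp := (volume : Measure (EuclideanSpace ℝ (Fin n))).measurePreserving_homeomorphUnitSphereProd
  have hd : Module.finrank ℝ (EuclideanSpace ℝ (Fin n)) - 1 = n - 1 := by simp
  rw [hd] at hmp
  have h1 : ∫⁻ x, f x = ∫⁻ x : ({0}ᶜ : Set (EuclideanSpace ℝ (Fin n))), f x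
      ∂(Measure.comap Subtype.val volume) := by
    rw [lintegral_subtype_comap (measurableSet_singleton _).compl, restrict_compl_singleton]
  have h2 : ∫⁻ x : ({0}ᶜ : Set (EuclideanSpace ℝ (Fin n))), f x
      ∂(Measure.comap Subtype.val volume) =
      ∫⁻ z, f (z.2.1 • (z.1 : EuclideanSpace ℝ (Fin n)))
        ∂((surf n).prod (Measure.volumeIoiPow (n - 1))) := by
    rw [surf, ← hmp.map_eq]
    have he : Measurable (fun z : Sph n × Ioi (0 : ℝ) =>
        f (z.2.1 • (z.1 : EuclideanSpace ℝ (Fin n)))) := by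
      refine hf.comp ?_
      fun_prop
    refine Eq.trans ?_ (lintegral_map he e.measurable).symm
    refine lintegral_congr fun x => ?_
    congr 1
    have := congrArg Subtype.val (e.symm_apply_apply x)
    exact this.symm
  rw [h1, h2, lintegral_prod _ (by fun_prop)]
  refine lintegral_congr fun ξ => ?_
  have hm : Measurable fun r : ℝ => f (r • (ξ : EuclideanSpace ℝ (Fin n))) := by fun_prop
  rw [Measure.volumeIoiPow, lintegral_withDensity_eq_lintegral_mul _ (by fun_prop) (by fun_prop)]
  simp only [Pi.mul_apply]
  rw [lintegral_subtype_comap measurableSet_Ioi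
    (fun r : ℝ => ENNReal.ofReal (r ^ (n - 1)) * f (r • (ξ : EuclideanSpace ℝ (Fin n))))]
  simp only [mul_comm]

/-- The density of the radial variable. -/
def radialMeasure (k : ℕ) : Measure ℝ :=
  (volume.restrict (Ioi 0)).withDensity fun r => ENNReal.ofReal (r ^ k)

/-- The density of the slope variable. -/
def slopeMeasure (k : ℕ) : Measure ℝ :=
  volume.withDensity fun y => ENNReal.ofReal (slopeRadius y ^ k / 2)

instance sFinite_radialMeasure (k : ℕ) : SFinite (radialMeasure k) := by
  unfold radialMeasure; infer_instance

instance sFinite_slopeMeasure (k : ℕ) : SFinite (slopeMeasure k) := by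
  unfold slopeMeasure; infer_instance

/-- Polar coordinates in `x`, then `t = r²y/2`, then the rescaling `r ↦ c(y)r` with `c =
slopeRadius`, which turns the cylindrical radius into `ϱ`. -/
lemma lintegral_eq_polar (hn : 1 ≤ n) {F : Space n → ENNReal} (hF : Measurable F) :
    ∫⁻ p, F p = ∫⁻ r, ∫⁻ y, ∫⁻ ξ, F (dil r (unitPoint (y, ξ))) ∂surf n ∂slopeMeasure (n + 2)
      ∂radialMeasure (n + 1) := by
  have hsl : Measurable slopeRadius := continuous_slopeRadius.measurable
  have hcont : Continuous fun z : ℝ × ℝ × Sph n => dil z.1 (unitPoint z.2) :=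
    continuous_dil.comp (continuous_fst.prodMk (continuous_unitPoint.comp continuous_snd))
  have hFm : Measurable fun z : ℝ × ℝ × Sph n => F (dil z.1 (unitPoint z.2)) :=
    hF.comp hcont.measurable
  -- the left side in cylindrical coordinates
  have h1 : ∫⁻ p, F p = ∫⁻ ξ, ∫⁻ r in Ioi (0 : ℝ), (∫⁻ t, F (r • (ξ : EuclideanSpace ℝ (Fin n)), t))
      * ENNReal.ofReal (r ^ (n - 1)) ∂volume ∂surf n := by
    rw [← lintegral_polar hn (f := fun x => ∫⁻ t, F (x, t)) hF.lintegral_prod_right']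
    exact lintegral_prod _ hF.aemeasurable
  have h2 : ∀ ξ : Sph n, ∫⁻ r in Ioi (0 : ℝ), (∫⁻ t, F (r • (ξ : EuclideanSpace ℝ (Fin n)), t))
      * ENNReal.ofReal (r ^ (n - 1)) = ∫⁻ y, ∫⁻ r in Ioi (0 : ℝ),
        F (dil r (unitPoint (y, ξ))) * ENNReal.ofReal (r ^ (n + 1)) *
          ENNReal.ofReal (slopeRadius y ^ (n + 2) / 2) := by
    intro ξ
    have hA : ∫⁻ r in Ioi (0 : ℝ), (∫⁻ t, F (r • (ξ : EuclideanSpace ℝ (Fin n)), t))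
        * ENNReal.ofReal (r ^ (n - 1)) = ∫⁻ r in Ioi (0 : ℝ), ∫⁻ y,
          F (r • (ξ : EuclideanSpace ℝ (Fin n)), r ^ 2 / 2 * y) * ENNReal.ofReal (r ^ (n + 1) / 2) := by
      refine setLIntegral_congr_fun measurableSet_Ioi fun r hr => ?_
      have hr : (0 : ℝ) < r := hr
      -- The Jacobian `r²/2` raises the radial weight from `r^{n-1}` to `r^{n+1}/2`.
      rw [lintegral_comp_mul_left_of_pos (a := r ^ 2 / 2) (by positivity) (by fun_prop),
        mul_assoc, mul_comm, mul_assoc, ← lintegral_mul_const _ (by fun_prop)]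
      refine lintegral_congr fun y => ?_
      have h : ENNReal.ofReal (r ^ (n + 1) / 2) =
          ENNReal.ofReal (r ^ 2 / 2) * ENNReal.ofReal (r ^ (n - 1)) := by
        rw [← ENNReal.ofReal_mul (by positivity)]
        congr 1
        -- This removes the truncated subtraction in the exponent `n - 1`.
        obtain ⟨m, rfl⟩ : ∃ m, n = m + 1 := ⟨n - 1, by omega⟩
        simp only [Nat.add_sub_cancel]
        ring
      rw [h]
      ring
    rw [hA, lintegral_lintegral_swap]
    · refine lintegral_congr fun y => ?_
      have hc := slopeRadius_pos y
      -- The Jacobian `c` together with `(cr)^{n+1}` produces the slope weight `c^{n+2}`.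
      rw [setLIntegral_Ioi_comp_mul_left hc (by fun_prop),
        ← lintegral_const_mul _ (by fun_prop)]
      refine setLIntegral_congr_fun measurableSet_Ioi fun r hr => ?_
      have hr : (0 : ℝ) < r := hr
      have hp : (((slopeRadius y * r) • (ξ : EuclideanSpace ℝ (Fin n)),
          (slopeRadius y * r) ^ 2 / 2 * y) : Space n) = dil r (unitPoint (y, ξ)) := by
        refine Prod.ext ?_ ?_
        · simp [dil, unitPoint, smul_smul, mul_comm]
        · simp only [dil, unitPoint]; ring
      simp only [hp]
      rw [mul_comm, mul_assoc, mul_assoc, ← ENNReal.ofReal_mul (by positivity),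
        ← ENNReal.ofReal_mul (by positivity)]
      congr 2
      ring
    · fun_prop
  have h3 : ∫⁻ p, F p = ∫⁻ ξ, ∫⁻ y, ∫⁻ r in Ioi (0 : ℝ),
        F (dil r (unitPoint (y, ξ))) * ENNReal.ofReal (r ^ (n + 1)) *
          ENNReal.ofReal (slopeRadius y ^ (n + 2) / 2) ∂volume ∂volume ∂surf n := by
    rw [h1]; exact lintegral_congr h2
  have hG : Measurable fun z : ℝ × ℝ × Sph n => F (dil z.1 (unitPoint z.2)) *
      ENNReal.ofReal (z.1 ^ (n + 1)) * ENNReal.ofReal (slopeRadius z.2.1 ^ (n + 2) / 2) :=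
    (hFm.mul (by fun_prop)).mul (by fun_prop)
  rw [h3, lintegral_lintegral_swap]
  · rw [radialMeasure, lintegral_withDensity_eq_lintegral_mul _ (by fun_prop)]
    · simp only [Pi.mul_apply]
      have h5 : ∀ y, ∫⁻ ξ, ∫⁻ r in Ioi (0 : ℝ), F (dil r (unitPoint (y, ξ))) *
          ENNReal.ofReal (r ^ (n + 1)) * ENNReal.ofReal (slopeRadius y ^ (n + 2) / 2)
            ∂volume ∂surf n =
          ∫⁻ r in Ioi (0 : ℝ), ∫⁻ ξ, F (dil r (unitPoint (y, ξ))) *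
          ENNReal.ofReal (r ^ (n + 1)) * ENNReal.ofReal (slopeRadius y ^ (n + 2) / 2)
            ∂surf n ∂volume := fun y => by
        refine lintegral_lintegral_swap (Measurable.aemeasurable ?_)
        exact hG.comp (f := fun z : Sph n × ℝ => (z.2, y, z.1)) (by fun_prop)
      simp only [h5]
      rw [lintegral_lintegral_swap]
      · refine lintegral_congr fun r => ?_
        rw [slopeMeasure, lintegral_withDensity_eq_lintegral_mul _ (by fun_prop),
          ← lintegral_const_mul]
        · refine lintegral_congr fun y => ?_
          simp only [Pi.mul_apply]
          rw [lintegral_mul_const, lintegral_mul_const]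
          · ring
          · exact hFm.comp (f := fun ξ : Sph n => (r, y, ξ)) (by fun_prop)
          · exact (hFm.comp (f := fun ξ : Sph n => (r, y, ξ)) (by fun_prop)).mul_const _
        · refine Measurable.mul (by fun_prop) ?_
          exact Measurable.lintegral_prod_right' (f := fun z : ℝ × Sph n =>
            F (dil r (unitPoint z))) (hFm.comp (f := fun z : ℝ × Sph n => (r, z)) (by fun_prop))
        · exact Measurable.lintegral_prod_right' (f := fun z : ℝ × Sph n =>
            F (dil r (unitPoint z))) (hFm.comp (f := fun z : ℝ × Sph n => (r, z)) (by fun_prop))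
      · refine Measurable.aemeasurable ?_
        exact Measurable.lintegral_prod_right' (hG.comp
          (f := fun z : (ℝ × ℝ) × Sph n => (z.1.2, z.1.1, z.2)) (by fun_prop))
    · refine Measurable.lintegral_prod_right' (f := fun z : ℝ × ℝ =>
        ∫⁻ ξ, F (dil z.1 (unitPoint (z.2, ξ))) ∂surf n) ?_
      exact Measurable.lintegral_prod_right' (hFm.comp
          (f := fun z : (ℝ × ℝ) × Sph n => (z.1.1, z.1.2, z.2)) (by fun_prop))
  · refine Measurable.aemeasurable ?_
    exact Measurable.lintegral_prod_right' (hG.comp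
      (f := fun z : (Sph n × ℝ) × ℝ => (z.2, z.1.2, z.1.1)) (by fun_prop))

/-- The measure on the parameters of the unit `ϱ`-sphere. -/
def angular (n : ℕ) : Measure (ℝ × Sph n) := (slopeMeasure (n + 2)).prod (surf n)

instance sFinite_angular : SFinite (angular n) := by unfold angular; infer_instance

lemma measurable_dil_unitPoint :
    Measurable fun z : ℝ × ℝ × Sph n => dil z.1 (unitPoint z.2) :=
  (continuous_dil.comp (continuous_fst.prodMk
    (continuous_unitPoint.comp continuous_snd))).measurable

lemma measurePreserving_polar (hn : 1 ≤ n) :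
    MeasurePreserving (fun z : ℝ × ℝ × Sph n => dil z.1 (unitPoint z.2))
      ((radialMeasure (n + 1)).prod (angular n)) (volume : Measure (Space n)) := by
  refine ⟨measurable_dil_unitPoint, Measure.ext_of_lintegral _ fun F hF => ?_⟩
  have hFm : Measurable fun z : ℝ × ℝ × Sph n => F (dil z.1 (unitPoint z.2)) :=
    hF.comp (measurable_dil_unitPoint (n := n))
  rw [lintegral_map hF measurable_dil_unitPoint, lintegral_eq_polar hn hF,
    lintegral_prod _ hFm.aemeasurable]
  refine lintegral_congr fun r => ?_
  rw [angular, lintegral_prod _]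
  · exact (hFm.comp (f := fun z : ℝ × Sph n => (r, z)) (by fun_prop)).aemeasurable

lemma integrable_polar (hn : 1 ≤ n) {F : Space n → ℝ} (hF : AEStronglyMeasurable F) :
    Integrable F ↔ Integrable (fun z : ℝ × ℝ × Sph n => F (dil z.1 (unitPoint z.2)))
      ((radialMeasure (n + 1)).prod (angular n)) := by
  have h := measurePreserving_polar hn
  rw [← h.map_eq] at hF ⊢
  exact integrable_map_measure hF h.aemeasurable

lemma integral_polar (hn : 1 ≤ n) {F : Space n → ℝ} (hF : Integrable F) :
    ∫ p, F p = ∫ r, ∫ θ, F (dil r (unitPoint θ)) ∂angular n ∂radialMeasure (n + 1) := by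
  have h := measurePreserving_polar hn
  have hi := (integrable_polar hn hF.1).1 hF
  rw [← integral_prod _ hi, ← integral_map h.aemeasurable (by rw [h.map_eq]; exact hF.1),
    h.map_eq]

/-! ### The Gaussian Poincaré inequality -/

/-- The Euclidean space `ℝⁿ`. -/
abbrev Euc (n : ℕ) : Type := EuclideanSpace ℝ (Fin n)

/-- The unnormalized Gaussian density. -/
def gauss (x : Euc n) : ℝ := Real.exp (-(1 / 2) * ‖x‖ ^ 2)

lemma gauss_pos (x : Euc n) : 0 < gauss x := Real.exp_pos _

lemma contDiff_gauss : ContDiff ℝ ∞ (gauss : Euc n → ℝ) :=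
  (contDiff_const.mul (contDiff_norm_sq ℝ)).exp

lemma continuous_gauss : Continuous (gauss : Euc n → ℝ) := contDiff_gauss.continuous

lemma fderiv_gauss (x v : Euc n) : fderiv ℝ gauss x v = -inner ℝ x v * gauss x := by
  have h : HasFDerivAt (fun x : Euc n => Real.exp (-(1 / 2) * ‖x‖ ^ 2)) _ x :=
    (((hasStrictFDerivAt_norm_sq x).hasFDerivAt).const_mul (-(1 / 2) : ℝ)).exp
  change fderiv ℝ (fun x : Euc n => Real.exp (-(1 / 2) * ‖x‖ ^ 2)) x v = _
  rw [h.fderiv]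
  simp [gauss]
  ring

lemma integrable_pow_mul_gauss (k : ℕ) :
    Integrable (fun x : Euc n => (1 + ‖x‖) ^ k * gauss x) := by
  have h := (GaussianFourier.integrable_cexp_neg_mul_sq_norm_add (b := (1 / 4 : ℂ))
    (V := Euc n) (by norm_num) 0 0).norm
  -- The dominating function comes from `(1+|x|)ᵏ ≤ e^{k(1+|x|)}` and `k|x| ≤ |x|²/4 + k²`.
  have h1 : Integrable (fun x : Euc n => Real.exp ((k : ℝ) + k ^ 2) * Real.exp (-(1 / 4) * ‖x‖ ^ 2)) := by
    refine (h.congr (ae_of_all _ fun x => ?_)).const_mul _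
    simp only [Complex.norm_exp]
    congr 1
    have : (-(1 / 4 : ℂ) * (‖x‖ : ℂ) ^ 2 + 0 * ((inner ℝ (0 : Euc n) x : ℝ) : ℂ)) =
        ((-(1 / 4) * ‖x‖ ^ 2 : ℝ) : ℂ) := by push_cast; ring
    rw [this, Complex.ofReal_re]
  refine h1.mono' (((continuous_const.add continuous_norm).pow k).mul
    continuous_gauss).aestronglyMeasurable (ae_of_all _ fun x => ?_)
  have hx := norm_nonneg x
  rw [Real.norm_of_nonneg (mul_nonneg (by positivity) (gauss_pos x).le), gauss]
  calc (1 + ‖x‖) ^ k * Real.exp (-(1 / 2) * ‖x‖ ^ 2)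
      ≤ Real.exp (k * (1 + ‖x‖)) * Real.exp (-(1 / 2) * ‖x‖ ^ 2) := by
        gcongr
        rw [Real.exp_nat_mul]
        gcongr
        linarith [Real.add_one_le_exp (1 + ‖x‖)]
    _ ≤ _ := by
        rw [← Real.exp_add, ← Real.exp_add]
        refine Real.exp_le_exp.2 ?_
        nlinarith [sq_nonneg (‖x‖ / 2 - k)]

lemma integrable_mul_gauss_of_le {H : Euc n → ℝ} {C : ℝ} {k : ℕ} (hm : AEStronglyMeasurable H)
    (hC : ∀ x, |H x| ≤ C * (1 + ‖x‖) ^ k) : Integrable (fun x => H x * gauss x) := by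
  refine ((integrable_pow_mul_gauss k).const_mul C).mono'
    (hm.mul continuous_gauss.aestronglyMeasurable) (ae_of_all _ fun x => ?_)
  rw [norm_mul, Real.norm_eq_abs, Real.norm_of_nonneg (gauss_pos x).le, ← mul_assoc]
  exact mul_le_mul_of_nonneg_right (hC x) (gauss_pos x).le

lemma integrable_prod_gauss_of_le {H : Euc n × Euc n → ℝ} {C : ℝ} {k : ℕ}
    (hm : AEStronglyMeasurable H)
    (hC : ∀ z, |H z| ≤ C * ((1 + ‖z.1‖) * (1 + ‖z.2‖)) ^ k) :
    Integrable (fun z => H z * (gauss z.1 * gauss z.2)) := by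
  have h := ((integrable_pow_mul_gauss (n := n) k).mul_prod
    (integrable_pow_mul_gauss (n := n) k)).const_mul C
  refine h.mono' (hm.mul ((continuous_gauss.comp continuous_fst).mul
    (continuous_gauss.comp continuous_snd)).aestronglyMeasurable) (ae_of_all _ fun z => ?_)
  have hg : 0 ≤ gauss z.1 * gauss z.2 := (mul_pos (gauss_pos _) (gauss_pos _)).le
  rw [norm_mul, Real.norm_eq_abs, Real.norm_of_nonneg hg]
  refine (mul_le_mul_of_nonneg_right (hC z) hg).trans (le_of_eq ?_)
  rw [mul_pow]
  ring

/-- The rotation `(x, y) ↦ (cx + sy, -sx + cy)`. -/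
def pairRotation (c s : ℝ) : Euc n × Euc n →ₗ[ℝ] Euc n × Euc n :=
  LinearMap.prod (c • LinearMap.fst ℝ _ _ + s • LinearMap.snd ℝ _ _)
    ((-s) • LinearMap.fst ℝ _ _ + c • LinearMap.snd ℝ _ _)

lemma pairRotation_apply (c s : ℝ) (z : Euc n × Euc n) :
    pairRotation c s z = (c • z.1 + s • z.2, (-s) • z.1 + c • z.2) := rfl

lemma continuous_pairRotation (c s : ℝ) :
    Continuous (pairRotation c s : Euc n × Euc n → Euc n × Euc n) :=
  (pairRotation c s).continuous_of_finiteDimensional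

/-- Composing the rotation with the reflection `J` of the second factor gives an involution, and `J`
is one itself, so the determinant is read off without a matrix. -/
lemma det_pairRotation_sq {c s : ℝ} (h : c ^ 2 + s ^ 2 = 1) :
    LinearMap.det (pairRotation c s : Euc n × Euc n →ₗ[ℝ] Euc n × Euc n) ^ 2 = 1 := by
  let J : Euc n × Euc n →ₗ[ℝ] Euc n × Euc n := 
    LinearMap.prod (LinearMap.fst ℝ _ _) (-LinearMap.snd ℝ _ _)
  have h1 : (pairRotation c s ∘ₗ J) ∘ₗ (pairRotation c s ∘ₗ J) =
      (LinearMap.id : Euc n × Euc n →ₗ[ℝ] Euc n × Euc n) := by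
    refine LinearMap.ext fun z => Prod.ext ?_ ?_
    · change c • (c • z.1 + s • -z.2) + s • -((-s) • z.1 + c • -z.2) = z.1
      have : c • (c • z.1 + s • -z.2) + s • -((-s) • z.1 + c • -z.2) = (c ^ 2 + s ^ 2) • z.1 := by
        module
      rw [this, h, one_smul]
    · change (-s) • (c • z.1 + s • -z.2) + c • -((-s) • z.1 + c • -z.2) = z.2
      have : (-s) • (c • z.1 + s • -z.2) + c • -((-s) • z.1 + c • -z.2) =
          (c ^ 2 + s ^ 2) • z.2 := by
        module
      rw [this, h, one_smul]
  have hJ : J ∘ₗ J = LinearMap.id :=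
    LinearMap.ext fun z => Prod.ext rfl (neg_neg z.2)
  have d1 := congrArg LinearMap.det h1
  have d2 := congrArg LinearMap.det hJ
  simp only [LinearMap.det_comp, LinearMap.det_id] at d1 d2
  calc LinearMap.det (pairRotation c s : Euc n × Euc n →ₗ[ℝ] Euc n × Euc n) ^ 2
      = LinearMap.det (pairRotation c s) ^ 2 * (LinearMap.det J * LinearMap.det J) := by
        rw [d2, mul_one]
    _ = 1 := by rw [← d1]; ring

instance isAddHaarMeasure_volume_pair : (volume : Measure (Euc n × Euc n)).IsAddHaarMeasure :=
  inferInstanceAs (((volume : Measure (Euc n)).prod (volume : Measure (Euc n))).IsAddHaarMeasure)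

lemma measurePreserving_pairRotation {c s : ℝ} (h : c ^ 2 + s ^ 2 = 1) :
    MeasurePreserving (pairRotation c s : Euc n × Euc n → Euc n × Euc n) := by
  refine ⟨(continuous_pairRotation c s).measurable, ?_⟩
  have hd := det_pairRotation_sq (n := n) h
  have h0 : LinearMap.det (pairRotation c s : Euc n × Euc n →ₗ[ℝ] Euc n × Euc n) ≠ 0 := by
    intro h0; rw [h0] at hd; norm_num at hd
  have h1 : |LinearMap.det (pairRotation c s : Euc n × Euc n →ₗ[ℝ] Euc n × Euc n)| = 1 := by
    rw [← sq_eq_sq₀ (abs_nonneg _) zero_le_one, sq_abs, hd, one_pow]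
  rw [Measure.map_linearMap_addHaar_eq_smul_addHaar _ h0, abs_inv, h1]
  simp

lemma gauss_pairRotation {c s : ℝ} (h : c ^ 2 + s ^ 2 = 1) (z : Euc n × Euc n) :
    gauss (pairRotation c s z).1 * gauss (pairRotation c s z).2 = gauss z.1 * gauss z.2 := by
  simp only [gauss, ← Real.exp_add, pairRotation_apply]
  congr 1
  rw [norm_add_sq_real, norm_add_sq_real]
  simp only [norm_smul, Real.norm_eq_abs, mul_pow, sq_abs, inner_smul_left, inner_smul_right,
    conj_trivial]
  linear_combination (-(1 / 2) * (‖z.1‖ ^ 2 + ‖z.2‖ ^ 2)) * h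

lemma integral_pairRotation {c s : ℝ} (h : c ^ 2 + s ^ 2 = 1) {H : Euc n × Euc n → ℝ}
    (hH : AEStronglyMeasurable H) :
    ∫ z, H (pairRotation c s z) * (gauss z.1 * gauss z.2) = ∫ z, H z * (gauss z.1 * gauss z.2) := by
  have hm := measurePreserving_pairRotation (n := n) h
  have hA : AEStronglyMeasurable (fun z : Euc n × Euc n => H z * (gauss z.1 * gauss z.2)) :=
    hH.mul ((continuous_gauss.comp continuous_fst).mul
      (continuous_gauss.comp continuous_snd)).aestronglyMeasurable
  have := integral_map hm.aemeasurable (by rw [hm.map_eq]; exact hA)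
  rw [hm.map_eq] at this
  rw [this]
  simp only [gauss_pairRotation h]

lemma integrable_pairRotation {c s : ℝ} (h : c ^ 2 + s ^ 2 = 1) {H : Euc n × Euc n → ℝ}
    (hH : Integrable (fun z => H z * (gauss z.1 * gauss z.2))) :
    Integrable (fun z => H (pairRotation c s z) * (gauss z.1 * gauss z.2)) := by
  have hm := measurePreserving_pairRotation (n := n) h
  have := (integrable_map_measure (by rw [hm.map_eq]; exact hH.1) hm.aemeasurable).1
    (by rw [hm.map_eq]; exact hH)
  simpa only [Function.comp_def, gauss_pairRotation h] using this

/-- A differentiable function with gradient `G` and polynomial growth. -/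
structure PolyGrowth (F : Euc n → ℝ) (G : Euc n → Euc n) (C : ℝ) : Prop where
  measurable : Measurable G
  hasGradient : ∀ x, HasGradientAt F (G x) x
  le : ∀ x, |F x| ≤ C * (1 + ‖x‖) ^ 2
  grad_le : ∀ x, ‖G x‖ ≤ C * (1 + ‖x‖) ^ 2

namespace PolyGrowth

variable {F : Euc n → ℝ} {G : Euc n → Euc n} {C : ℝ}

lemma nonneg (h : PolyGrowth F G C) : 0 ≤ C := by
  have := (abs_nonneg _).trans (h.le 0)
  simpa using this

lemma continuous (h : PolyGrowth F G C) : Continuous F :=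
  continuous_iff_continuousAt.2 fun x => (h.hasGradient x).hasFDerivAt.continuousAt

end PolyGrowth

/-- Gaussian integration by parts. -/
lemma integral_inner_mul_gauss {F : Euc n → ℝ} {G : Euc n → Euc n} {C : ℝ}
    (h : PolyGrowth F G C) (v : Euc n) :
    ∫ x, (inner ℝ v x * F x) * gauss x = ∫ x, inner ℝ (G x) v * gauss x := by
  have hfd : ∀ x, fderiv ℝ F x v = inner ℝ (G x) v := fun x => by
    rw [(h.hasGradient x).hasFDerivAt.fderiv, InnerProductSpace.toDual_apply_apply]
  have hFm : AEStronglyMeasurable F := h.continuous.aestronglyMeasurable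
  have i1 : Integrable (fun x => fderiv ℝ F x v * gauss x) := by
    refine integrable_mul_gauss_of_le (C := C * ‖v‖) (k := 2) ?_ fun x => ?_
    · simp only [hfd]
      exact (h.measurable.inner measurable_const).aestronglyMeasurable
    · rw [hfd]
      refine (abs_real_inner_le_norm _ _).trans ?_
      nlinarith [mul_le_mul_of_nonneg_right (h.grad_le x) (norm_nonneg v)]
  have i2 : Integrable (fun x => F x * fderiv ℝ gauss x v) := by
    have : (fun x => F x * fderiv ℝ gauss x v) = fun x => (F x * -inner ℝ x v) * gauss x := by
      ext x; rw [fderiv_gauss]; ring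
    rw [this]
    refine integrable_mul_gauss_of_le (C := C * ‖v‖) (k := 3) ?_ fun x => ?_
    · exact hFm.mul (by fun_prop)
    · rw [abs_mul, abs_neg]
      calc |F x| * |inner ℝ x v| ≤ (C * (1 + ‖x‖) ^ 2) * ((1 + ‖x‖) * ‖v‖) := by
            refine mul_le_mul (h.le x) ((abs_real_inner_le_norm _ _).trans ?_) (abs_nonneg _)
              (mul_nonneg h.nonneg (by positivity))
            gcongr
            linarith
        _ = _ := by ring
  have i3 : Integrable (fun x => F x * gauss x) := integrable_mul_gauss_of_le hFm h.le
  have key := integral_mul_fderiv_eq_neg_fderiv_mul_of_integrable i1 i2 i3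
    (fun x _ => (h.hasGradient x).differentiableAt)
    (fun x _ => contDiff_gauss.differentiable (by simp) x)
  simp only [hfd, fderiv_gauss] at key
  rw [eq_neg_iff_add_eq_zero, add_comm, ← eq_neg_iff_add_eq_zero] at key
  rw [key, ← integral_neg]
  refine integral_congr_ae (ae_of_all _ fun x => ?_)
  simp only [real_inner_comm v x]
  ring

/-- The product bound dominates functions of a rotated point uniformly in the angle by something
integrable against the product Gaussian. -/
lemma one_add_norm_le (x y : Euc n) {c s : ℝ} (hc : |c| ≤ 1) (hs : |s| ≤ 1) :
    1 + ‖c • x + s • y‖ ≤ (1 + ‖x‖) * (1 + ‖y‖) := by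
  have h := norm_add_le (c • x) (s • y)
  rw [norm_smul, norm_smul, Real.norm_eq_abs, Real.norm_eq_abs] at h
  nlinarith [mul_le_mul_of_nonneg_right hc (norm_nonneg x),
    mul_le_mul_of_nonneg_right hs (norm_nonneg y), mul_nonneg (norm_nonneg x) (norm_nonneg y)]

section Interpolation

variable {F : Euc n → ℝ} {G : Euc n → Euc n} {C : ℝ}

lemma abs_cos_sin_le (θ : ℝ) : |Real.cos θ| ≤ 1 ∧ |Real.sin θ| ≤ 1 :=
  ⟨Real.abs_cos_le_one θ, Real.abs_sin_le_one θ⟩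

/-- The Gaussian correlation of `F` with itself at the angle `θ`. -/
def correlation (F : Euc n → ℝ) (θ : ℝ) : ℝ :=
  ∫ z : Euc n × Euc n, F z.1 * F (Real.cos θ • z.1 + Real.sin θ • z.2) * (gauss z.1 * gauss z.2)

lemma PolyGrowth.hasDerivAt_correlation (h : PolyGrowth F G C) (θ : ℝ) :
    HasDerivAt (correlation F) (∫ z : Euc n × Euc n,
      F z.1 * inner ℝ (G (Real.cos θ • z.1 + Real.sin θ • z.2))
        ((-Real.sin θ) • z.1 + Real.cos θ • z.2) * (gauss z.1 * gauss z.2)) θ := by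
  have hC := h.nonneg
  have hFc := h.continuous
  have cF : ∀ θ : ℝ, Continuous fun z : Euc n × Euc n =>
      F z.1 * F (Real.cos θ • z.1 + Real.sin θ • z.2) := fun θ => by fun_prop
  have cg : Continuous fun z : Euc n × Euc n => gauss z.1 * gauss z.2 :=
    (continuous_gauss.comp continuous_fst).mul (continuous_gauss.comp continuous_snd)
  have bF1 : ∀ z : Euc n × Euc n, |F z.1| ≤ C * ((1 + ‖z.1‖) * (1 + ‖z.2‖)) ^ 2 := fun z => by
    refine (h.le z.1).trans ?_
    gcongr
    nlinarith [norm_nonneg z.1, norm_nonneg z.2, mul_nonneg (norm_nonneg z.1) (norm_nonneg z.2)]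
  have bF2 : ∀ (z : Euc n × Euc n) θ, |F (Real.cos θ • z.1 + Real.sin θ • z.2)| ≤
      C * ((1 + ‖z.1‖) * (1 + ‖z.2‖)) ^ 2 := fun z θ => by
    refine (h.le _).trans ?_
    gcongr
    exact one_add_norm_le _ _ (abs_cos_sin_le θ).1 (abs_cos_sin_le θ).2
  have bG : ∀ (z : Euc n × Euc n) θ, ‖G (Real.cos θ • z.1 + Real.sin θ • z.2)‖ ≤
      C * ((1 + ‖z.1‖) * (1 + ‖z.2‖)) ^ 2 := fun z θ => by
    refine (h.grad_le _).trans ?_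
    gcongr
    exact one_add_norm_le _ _ (abs_cos_sin_le θ).1 (abs_cos_sin_le θ).2
  have mG : ∀ θ : ℝ, AEStronglyMeasurable fun z : Euc n × Euc n =>
      F z.1 * inner ℝ (G (Real.cos θ • z.1 + Real.sin θ • z.2))
        ((-Real.sin θ) • z.1 + Real.cos θ • z.2) := fun θ => by
    refine Measurable.aestronglyMeasurable ?_
    refine (hFc.measurable.comp measurable_fst).mul
      (Measurable.inner (h.measurable.comp (by fun_prop)) (by fun_prop))
  have bI : ∀ (z : Euc n × Euc n) θ, |F z.1 * inner ℝ (G (Real.cos θ • z.1 + Real.sin θ • z.2))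
        ((-Real.sin θ) • z.1 + Real.cos θ • z.2)| ≤
      (C * C) * ((1 + ‖z.1‖) * (1 + ‖z.2‖)) ^ 5 := fun z θ => by
    rw [abs_mul]
    have h1 : ‖(-Real.sin θ) • z.1 + Real.cos θ • z.2‖ ≤ (1 + ‖z.1‖) * (1 + ‖z.2‖) := by
      have := one_add_norm_le z.1 z.2 (c := -Real.sin θ) (s := Real.cos θ)
        (by rw [abs_neg]; exact (abs_cos_sin_le θ).2) (abs_cos_sin_le θ).1
      linarith
    calc _ ≤ (C * ((1 + ‖z.1‖) * (1 + ‖z.2‖)) ^ 2) *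
          ((C * ((1 + ‖z.1‖) * (1 + ‖z.2‖)) ^ 2) * ((1 + ‖z.1‖) * (1 + ‖z.2‖))) := by
          refine mul_le_mul (bF1 z) ((abs_real_inner_le_norm _ _).trans ?_) (abs_nonneg _)
            (by positivity)
          exact mul_le_mul (bG z θ) h1 (norm_nonneg _) (by positivity)
      _ = _ := by ring
  refine (hasDerivAt_integral_of_dominated_loc_of_deriv_le (μ := volume) (x₀ := θ)
    (F := fun (θ : ℝ) (z : Euc n × Euc n) =>
      F z.1 * F (Real.cos θ • z.1 + Real.sin θ • z.2) * (gauss z.1 * gauss z.2))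
    (F' := fun (θ : ℝ) (z : Euc n × Euc n) =>
      F z.1 * inner ℝ (G (Real.cos θ • z.1 + Real.sin θ • z.2))
        ((-Real.sin θ) • z.1 + Real.cos θ • z.2) * (gauss z.1 * gauss z.2))
    (bound := fun z : Euc n × Euc n => ((C * C) * ((1 + ‖z.1‖) * (1 + ‖z.2‖)) ^ 5) *
      (gauss z.1 * gauss z.2)) (s := univ) univ_mem ?_ ?_ ?_ ?_ ?_ ?_).2
  · exact Eventually.of_forall fun θ => ((cF θ).mul cg).aestronglyMeasurable
  · refine integrable_prod_gauss_of_le (C := C * C) (k := 4) (cF θ).aestronglyMeasurable fun z => ?_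
    rw [abs_mul]
    calc _ ≤ (C * ((1 + ‖z.1‖) * (1 + ‖z.2‖)) ^ 2) * (C * ((1 + ‖z.1‖) * (1 + ‖z.2‖)) ^ 2) :=
          mul_le_mul (bF1 z) (bF2 z θ) (abs_nonneg _) (by positivity)
      _ = _ := by ring
  · exact (mG θ).mul cg.aestronglyMeasurable
  · refine ae_of_all _ fun z θ _ => ?_
    have hg : 0 ≤ gauss z.1 * gauss z.2 := (mul_pos (gauss_pos _) (gauss_pos _)).le
    rw [norm_mul, Real.norm_eq_abs, Real.norm_of_nonneg hg]
    exact mul_le_mul_of_nonneg_right (bI z θ) hg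
  · refine integrable_prod_gauss_of_le (k := 5) ?_ fun z => (abs_of_nonneg (by positivity)).le
    exact Continuous.aestronglyMeasurable (by fun_prop)
  · refine ae_of_all _ fun z θ _ => ?_
    have hin : HasDerivAt (fun θ : ℝ => Real.cos θ • z.1 + Real.sin θ • z.2)
        ((-Real.sin θ) • z.1 + Real.cos θ • z.2) θ :=
      ((Real.hasDerivAt_cos θ).smul_const _).add ((Real.hasDerivAt_sin θ).smul_const _)
    have := HasFDerivAt.comp_hasDerivAt θ
      (h.hasGradient (Real.cos θ • z.1 + Real.sin θ • z.2)).hasFDerivAt hin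
    rw [InnerProductSpace.toDual_apply_apply] at this
    exact (this.const_mul (F z.1)).mul_const _

/-- The derivative of the correlation after a rotation and an integration by parts. -/
lemma PolyGrowth.integral_deriv_correlation (h : PolyGrowth F G C) (θ : ℝ) :
    ∫ z : Euc n × Euc n, F z.1 * inner ℝ (G (Real.cos θ • z.1 + Real.sin θ • z.2))
        ((-Real.sin θ) • z.1 + Real.cos θ • z.2) * (gauss z.1 * gauss z.2) =
      -Real.sin θ * ∫ z : Euc n × Euc n,
        inner ℝ (G z.1) (G (Real.cos θ • z.1 + (-Real.sin θ) • z.2)) *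
          (gauss z.1 * gauss z.2) := by
  have hC := h.nonneg
  have hFc := h.continuous
  have hcs : Real.cos θ ^ 2 + Real.sin θ ^ 2 = 1 := Real.cos_sq_add_sin_sq θ
  set c := Real.cos θ
  set s := Real.sin θ
  have hc1 : |c| ≤ 1 := (abs_cos_sin_le θ).1
  have hs1 : |s| ≤ 1 := (abs_cos_sin_le θ).2
  have hs1' : |-s| ≤ 1 := by rwa [abs_neg]
  -- `H` is the integrand in rotated coordinates, where the argument of `G` becomes the first
  -- variable. The second variable then occurs linearly in the inner product, ready for Gaussian
  -- integration by parts.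
  let H : Euc n × Euc n → ℝ := fun z => F (c • z.1 + (-s) • z.2) * inner ℝ (G z.1) z.2
  have hHm : AEStronglyMeasurable H :=
    ((hFc.measurable.comp (by fun_prop)).mul
      (Measurable.inner (h.measurable.comp measurable_fst) measurable_snd)).aestronglyMeasurable
  have hbF : ∀ z : Euc n × Euc n, |F (c • z.1 + (-s) • z.2)| ≤
      C * ((1 + ‖z.1‖) * (1 + ‖z.2‖)) ^ 2 := fun z => by
    refine (h.le _).trans ?_
    gcongr
    exact one_add_norm_le _ _ hc1 hs1'
  have hbG : ∀ z : Euc n × Euc n, ‖G (c • z.1 + (-s) • z.2)‖ ≤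
      C * ((1 + ‖z.1‖) * (1 + ‖z.2‖)) ^ 2 := fun z => by
    refine (h.grad_le _).trans ?_
    gcongr
    exact one_add_norm_le _ _ hc1 hs1'
  have hbG1 : ∀ z : Euc n × Euc n, ‖G z.1‖ ≤ C * ((1 + ‖z.1‖) * (1 + ‖z.2‖)) ^ 2 := fun z => by
    refine (h.grad_le z.1).trans ?_
    gcongr
    nlinarith [norm_nonneg z.1, norm_nonneg z.2, mul_nonneg (norm_nonneg z.1) (norm_nonneg z.2)]
  have hHi : Integrable (fun z => H z * (gauss z.1 * gauss z.2)) := by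
    refine integrable_prod_gauss_of_le (C := C * C) (k := 5) hHm fun z => ?_
    rw [abs_mul]
    calc _ ≤ (C * ((1 + ‖z.1‖) * (1 + ‖z.2‖)) ^ 2) *
          ((C * ((1 + ‖z.1‖) * (1 + ‖z.2‖)) ^ 2) * ((1 + ‖z.1‖) * (1 + ‖z.2‖))) := by
          refine mul_le_mul (hbF z) ((abs_real_inner_le_norm _ _).trans ?_) (abs_nonneg _)
            (by positivity)
          refine mul_le_mul (hbG1 z) ?_ (norm_nonneg _) (by positivity)
          nlinarith [norm_nonneg z.1, norm_nonneg z.2,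
            mul_nonneg (norm_nonneg z.1) (norm_nonneg z.2)]
      _ = _ := by ring
  have hKi : Integrable (fun z : Euc n × Euc n =>
      inner ℝ (G z.1) (G (c • z.1 + (-s) • z.2)) * (gauss z.1 * gauss z.2)) := by
    refine integrable_prod_gauss_of_le (C := C * C) (k := 4) (Measurable.inner
      (h.measurable.comp measurable_fst) (h.measurable.comp (by fun_prop))).aestronglyMeasurable
      fun z => (abs_real_inner_le_norm _ _).trans ?_
    calc _ ≤ (C * ((1 + ‖z.1‖) * (1 + ‖z.2‖)) ^ 2) * (C * ((1 + ‖z.1‖) * (1 + ‖z.2‖)) ^ 2) :=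
          mul_le_mul (hbG1 z) (hbG z) (norm_nonneg _) (by positivity)
      _ = _ := by ring
  have hrot : ∀ z : Euc n × Euc n, H (pairRotation c s z) =
      F z.1 * inner ℝ (G (c • z.1 + s • z.2)) ((-s) • z.1 + c • z.2) := fun z => by
    have : c • (c • z.1 + s • z.2) + (-s) • ((-s) • z.1 + c • z.2) = z.1 := by
      have : c • (c • z.1 + s • z.2) + (-s) • ((-s) • z.1 + c • z.2) = (c ^ 2 + s ^ 2) • z.1 := by
        module
      rw [this, hcs, one_smul]
    simp only [H, pairRotation_apply, this]
  have h1 : ∫ z : Euc n × Euc n, F z.1 * inner ℝ (G (c • z.1 + s • z.2))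
      ((-s) • z.1 + c • z.2) * (gauss z.1 * gauss z.2) =
      ∫ z, H z * (gauss z.1 * gauss z.2) := by
    rw [← integral_pairRotation hcs hHm]
    simp only [hrot]
  rw [h1, ← integral_const_mul]
  have hKi' := hKi.const_mul (-s)
  rw [Measure.volume_eq_prod] at hHi hKi' ⊢
  rw [integral_prod _ hHi, integral_prod _ hKi']
  refine integral_congr_ae (ae_of_all _ fun a => ?_)
  -- the inner integration by parts
  have hP : PolyGrowth (fun b => F (c • a + (-s) • b)) (fun b => (-s) • G (c • a + (-s) • b))
      (C * (1 + ‖a‖) ^ 2) := by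
    refine ⟨(h.measurable.comp (f := fun b : Euc n => c • a + (-s) • b) (by fun_prop)).const_smul
      (-s), fun b => ?_, fun b => ?_, fun b => ?_⟩
    · have hin : HasFDerivAt (fun b : Euc n => c • a + (-s) • b)
          ((-s) • ContinuousLinearMap.id ℝ (Euc n)) b :=
        ((hasFDerivAt_id b).const_smul (-s)).const_add _
      have := (h.hasGradient (c • a + (-s) • b)).hasFDerivAt.comp b hin
      rw [hasGradientAt_iff_hasFDerivAt]
      refine this.congr_fderiv ?_
      ext v
      simp
    · refine (h.le _).trans ?_
      have := one_add_norm_le a b hc1 hs1'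
      calc C * (1 + ‖c • a + (-s) • b‖) ^ 2 ≤ C * ((1 + ‖a‖) * (1 + ‖b‖)) ^ 2 := by gcongr
        _ = _ := by ring
    · rw [norm_smul]
      have := one_add_norm_le a b hc1 hs1'
      calc ‖-s‖ * ‖G (c • a + (-s) • b)‖ ≤ 1 * (C * (1 + ‖c • a + (-s) • b‖) ^ 2) :=
            mul_le_mul hs1' (h.grad_le _) (norm_nonneg _) zero_le_one
        _ ≤ C * ((1 + ‖a‖) * (1 + ‖b‖)) ^ 2 := by rw [one_mul]; gcongr
        _ = _ := by ring
  have key := integral_inner_mul_gauss hP (G a)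
  calc ∫ b, H (a, b) * (gauss a * gauss b)
      = gauss a * ∫ b, (inner ℝ (G a) b * F (c • a + (-s) • b)) * gauss b := by
        rw [← integral_const_mul]
        refine integral_congr_ae (ae_of_all _ fun b => ?_)
        simp only [H]; ring
    _ = gauss a * ∫ b, inner ℝ ((-s) • G (c • a + (-s) • b)) (G a) * gauss b := by rw [key]
    _ = _ := by
        rw [← integral_const_mul]
        refine integral_congr_ae (ae_of_all _ fun b => ?_)
        simp only [inner_smul_left, conj_trivial]
        rw [real_inner_comm]
        ring

/-- The **Gaussian Poincaré inequality** for centered functions. -/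
lemma PolyGrowth.gaussian_poincare (h : PolyGrowth F G C) (h0 : ∫ x, F x * gauss x = 0) :
    ∫ x, F x ^ 2 * gauss x ≤ ∫ x, ‖G x‖ ^ 2 * gauss x := by
  have hC := h.nonneg
  have hFc := h.continuous
  set Z := ∫ x : Euc n, gauss x
  have hZ : 0 < Z := by
    have hi : Integrable (gauss : Euc n → ℝ) := by simpa using integrable_pow_mul_gauss (n := n) 0
    exact (integral_pos_iff_support_of_nonneg (fun x => (gauss_pos x).le) hi).2 (by
      have : Function.support (gauss : Euc n → ℝ) = univ := by
        ext x; simp [(gauss_pos x).ne']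
      rw [this]
      exact Measure.measure_univ_pos.2 (NeZero.ne _))
  set K := (∫ x, ‖G x‖ ^ 2 * gauss x) * Z
  have hprod : ∀ f g : Euc n → ℝ, ∫ z : Euc n × Euc n, f z.1 * g z.2 * (gauss z.1 * gauss z.2) =
      (∫ x, f x * gauss x) * ∫ x, g x * gauss x := fun f g => by
    rw [Measure.volume_eq_prod, ← integral_prod_mul]
    refine integral_congr_ae (ae_of_all _ fun z => ?_)
    ring
  have hGi : Integrable (fun z : Euc n × Euc n => ‖G z.1‖ ^ 2 * (gauss z.1 * gauss z.2)) := by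
    refine integrable_prod_gauss_of_le (C := C ^ 2) (k := 4)
      ((h.measurable.norm.pow_const 2).comp measurable_fst).aestronglyMeasurable fun z => ?_
    rw [abs_of_nonneg (by positivity)]
    calc ‖G z.1‖ ^ 2 ≤ (C * ((1 + ‖z.1‖) * (1 + ‖z.2‖)) ^ 2) ^ 2 := by
          gcongr
          refine (h.grad_le z.1).trans ?_
          gcongr
          nlinarith [norm_nonneg z.1, norm_nonneg z.2,
            mul_nonneg (norm_nonneg z.1) (norm_nonneg z.2)]
      _ = _ := by ring
  have hGK : ∫ z : Euc n × Euc n, ‖G z.1‖ ^ 2 * (gauss z.1 * gauss z.2) = K := by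
    have := hprod (fun x => ‖G x‖ ^ 2) (fun _ => 1)
    simpa [K, Z] using this
  -- The two gradients in the derivative have the same Gaussian law by rotation invariance, so
  -- `2⟨a,b⟩ ≤ |a|² + |b|²` bounds their correlation by `K`.
  have hder : ∀ θ ∈ Icc 0 (Real.pi / 2), -(Real.sin θ * K) ≤ ∫ z : Euc n × Euc n,
      F z.1 * inner ℝ (G (Real.cos θ • z.1 + Real.sin θ • z.2))
        ((-Real.sin θ) • z.1 + Real.cos θ • z.2) * (gauss z.1 * gauss z.2) := by
    intro θ hθ
    have hs : 0 ≤ Real.sin θ := Real.sin_nonneg_of_nonneg_of_le_pi hθ.1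
      (hθ.2.trans (by linarith [Real.pi_pos]))
    have hcs : Real.cos θ ^ 2 + (-Real.sin θ) ^ 2 = 1 := by
      rw [neg_sq]; exact Real.cos_sq_add_sin_sq θ
    rw [h.integral_deriv_correlation θ, neg_mul, neg_le_neg_iff]
    refine mul_le_mul_of_nonneg_left ?_ hs
    have hrot := integral_pairRotation hcs (H := fun z : Euc n × Euc n => ‖G z.1‖ ^ 2)
      ((h.measurable.norm.pow_const 2).comp measurable_fst).aestronglyMeasurable
    have hroti := integrable_pairRotation hcs (H := fun z : Euc n × Euc n => ‖G z.1‖ ^ 2) hGi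
    simp only [pairRotation_apply] at hrot hroti
    have hb : ∀ z : Euc n × Euc n,
        |inner ℝ (G z.1) (G (Real.cos θ • z.1 + (-Real.sin θ) • z.2))| ≤
        (1 / 2) * ‖G z.1‖ ^ 2 + (1 / 2) * ‖G (Real.cos θ • z.1 + (-Real.sin θ) • z.2)‖ ^ 2 :=
      fun z => (abs_real_inner_le_norm _ _).trans (by
        nlinarith [sq_nonneg (‖G z.1‖ - ‖G (Real.cos θ • z.1 + (-Real.sin θ) • z.2)‖)])
    have hgz : ∀ z : Euc n × Euc n, 0 ≤ gauss z.1 * gauss z.2 := fun z =>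
      (mul_pos (gauss_pos _) (gauss_pos _)).le
    have hsum := (hGi.const_mul (1 / 2)).add (hroti.const_mul (1 / 2))
    calc _ ≤ ∫ z : Euc n × Euc n, ((1 / 2) * (‖G z.1‖ ^ 2 * (gauss z.1 * gauss z.2)) +
          (1 / 2) * (‖G (Real.cos θ • z.1 + (-Real.sin θ) • z.2)‖ ^ 2 *
            (gauss z.1 * gauss z.2))) := by
          have hle : ∀ z : Euc n × Euc n,
              ‖inner ℝ (G z.1) (G (Real.cos θ • z.1 + (-Real.sin θ) • z.2)) *
                (gauss z.1 * gauss z.2)‖ ≤ (1 / 2) * (‖G z.1‖ ^ 2 * (gauss z.1 * gauss z.2)) +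
              (1 / 2) * (‖G (Real.cos θ • z.1 + (-Real.sin θ) • z.2)‖ ^ 2 *
                (gauss z.1 * gauss z.2)) := fun z => by
            rw [norm_mul, Real.norm_eq_abs, Real.norm_of_nonneg (hgz z)]
            nlinarith [mul_le_mul_of_nonneg_right (hb z) (hgz z)]
          refine integral_mono (hsum.mono' ?_ (ae_of_all _ hle)) hsum
            fun z => (le_abs_self _).trans (hle z)
          exact (Measurable.inner (h.measurable.comp measurable_fst)
            (h.measurable.comp (by fun_prop))).aestronglyMeasurable.mul
            ((continuous_gauss.comp continuous_fst).mul
              (continuous_gauss.comp continuous_snd)).aestronglyMeasurable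
      _ = K := by
          rw [integral_add (hGi.const_mul _) (hroti.const_mul _), integral_const_mul,
            integral_const_mul, hrot, hGK]
          ring
  -- Compare the ends of the interval: at `θ = 0` the correlation is the second moment, at `π/2` it
  -- is the square of the mean, which vanishes.
  have hmono : MonotoneOn (fun θ => correlation F θ - K * Real.cos θ) (Icc 0 (Real.pi / 2)) := by
    have hd : ∀ θ, HasDerivAt (fun θ => correlation F θ - K * Real.cos θ) _ θ := fun θ =>
      (h.hasDerivAt_correlation θ).sub ((Real.hasDerivAt_cos θ).const_mul K)
    refine monotoneOn_of_deriv_nonneg (convex_Icc _ _)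
      (fun θ _ => (hd θ).continuousAt.continuousWithinAt)
      (fun θ _ => (hd θ).differentiableAt.differentiableWithinAt) fun θ hθ => ?_
    rw [(hd θ).deriv]
    have := hder θ (interior_subset hθ)
    linarith
  have hle := hmono (left_mem_Icc.2 (by positivity)) (right_mem_Icc.2 (by positivity))
    (by positivity : (0 : ℝ) ≤ Real.pi / 2)
  have e0 : correlation F 0 = (∫ x, F x ^ 2 * gauss x) * Z := by
    have := hprod (fun x => F x ^ 2) (fun _ => 1)
    simp only [correlation, Real.cos_zero, Real.sin_zero, one_smul, zero_smul, add_zero]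
    simpa [Z, pow_two] using this
  have e1 : correlation F (Real.pi / 2) = 0 := by
    have := hprod F F
    simp only [correlation, Real.cos_pi_div_two, Real.sin_pi_div_two, one_smul, zero_smul, zero_add]
    rw [this, h0, zero_mul]
  simp only [e0, e1, Real.cos_zero, Real.cos_pi_div_two] at hle
  have : (∫ x, F x ^ 2 * gauss x) * Z ≤ (∫ x, ‖G x‖ ^ 2 * gauss x) * Z := by linarith
  exact le_of_mul_le_mul_right this hZ

end Interpolation

/-! ### The Poincaré inequality on the sphere -/

lemma integral_polar_mul (hn : 1 ≤ n) (h : ℝ → ℝ) (g : Euc n → ℝ) :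
    ∫ x : Euc n, h ‖x‖ * g (‖x‖⁻¹ • x) =
      (∫ r in Ioi (0 : ℝ), r ^ (n - 1) * h r) * ∫ ξ, g ξ ∂surf n := by
  have : Nonempty (Fin n) := ⟨⟨0, hn⟩⟩
  have hmp := (volume : Measure (Euc n)).measurePreserving_homeomorphUnitSphereProd
  have hd : Module.finrank ℝ (Euc n) - 1 = n - 1 := by simp
  rw [hd] at hmp
  have h1 : ∫ x : Euc n, h ‖x‖ * g (‖x‖⁻¹ • x) =
      ∫ x : ({0}ᶜ : Set (Euc n)), h ‖x.1‖ * g (‖x.1‖⁻¹ • x.1) ∂(Measure.comap Subtype.val volume) := by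
    rw [integral_subtype_comap (measurableSet_singleton _).compl
      fun x : Euc n => h ‖x‖ * g (‖x‖⁻¹ • x), restrict_compl_singleton]
  have h2 := hmp.integral_comp (Homeomorph.measurableEmbedding _)
    (fun z : Sph n × Ioi (0 : ℝ) => g z.1 * h z.2)
  have h3 : ∫ z : Sph n × Ioi (0 : ℝ), g z.1 * h z.2
      ∂((volume : Measure (Euc n)).toSphere.prod (Measure.volumeIoiPow (n - 1))) =
      (∫ ξ, g ξ ∂surf n) * ∫ r : Ioi (0 : ℝ), h r ∂Measure.volumeIoiPow (n - 1) :=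
    integral_prod_mul (fun ξ : Sph n => g ξ) fun r : Ioi (0 : ℝ) => h r
  have h4 : ∫ r : Ioi (0 : ℝ), h r ∂Measure.volumeIoiPow (n - 1) =
      ∫ r in Ioi (0 : ℝ), r ^ (n - 1) * h r := by
    simp only [Measure.volumeIoiPow, ENNReal.ofReal]
    rw [integral_withDensity_eq_integral_smul (measurable_subtype_coe.pow_const _).real_toNNReal,
      integral_subtype_comap measurableSet_Ioi fun a ↦ Real.toNNReal (a ^ (n - 1)) • h a]
    refine setIntegral_congr_fun measurableSet_Ioi fun x hx => ?_
    simp only [NNReal.smul_def, Real.coe_toNNReal _ (pow_nonneg (le_of_lt hx) _), smul_eq_mul]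
  rw [h1, mul_comm, ← h4, ← h3, ← h2]
  refine integral_congr_ae (ae_of_all _ fun x => ?_)
  simp only [homeomorphUnitSphereProd_apply_fst_coe, homeomorphUnitSphereProd_apply_snd_coe]
  ring

/-- The radial moments of the Gaussian. -/
lemma gauss_moment (q : ℝ) (hq : -1 < q) :
    ∫ r in Ioi (0 : ℝ), r ^ (q + 2) * Real.exp (-(1 / 2) * r ^ (2 : ℝ)) =
      (q + 1) * ∫ r in Ioi (0 : ℝ), r ^ q * Real.exp (-(1 / 2) * r ^ (2 : ℝ)) := by
  rw [integral_rpow_mul_exp_neg_mul_rpow (by norm_num) (by linarith) (by norm_num),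
    integral_rpow_mul_exp_neg_mul_rpow (by norm_num) hq (by norm_num)]
  have h1 : (q + 2 + 1) / 2 = (q + 1) / 2 + 1 := by ring
  have h2 : -(q + 2 + 1) / 2 = -(q + 1) / 2 + (-1 : ℝ) := by ring
  rw [h1, h2, Real.Gamma_add_one (by linarith : (q + 1) / 2 ≠ 0),
    Real.rpow_add (by norm_num), Real.rpow_neg_one]
  ring

lemma gauss_moment_pos (q : ℝ) (hq : -1 < q) :
    0 < ∫ r in Ioi (0 : ℝ), r ^ q * Real.exp (-(1 / 2) * r ^ (2 : ℝ)) := by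
  rw [integral_rpow_mul_exp_neg_mul_rpow (by norm_num) hq (by norm_num)]
  have := Real.Gamma_pos_of_pos (s := (q + 1) / 2) (by linarith)
  positivity

lemma hasFDerivAt_norm_rpow' (a : ℝ) {x : Euc n} (hx : x ≠ 0) :
    HasFDerivAt (fun x : Euc n => ‖x‖ ^ a) ((a * ‖x‖ ^ (a - 2)) • innerSL ℝ x) x := by
  have hx' := norm_pos_iff.2 hx
  have h : ∀ x : Euc n, ∀ b : ℝ, ‖x‖ ^ b = (‖x‖ ^ 2) ^ (b / 2) := fun x b => by
    rw [← Real.rpow_natCast, ← Real.rpow_mul (norm_nonneg x)]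
    congr 1
    push_cast
    ring
  simp only [h]
  refine ((hasStrictFDerivAt_norm_sq x).hasFDerivAt.rpow_const (p := a / 2)
    (Or.inl (by positivity))).congr_fderiv ?_
  have : (a - 2) / 2 = a / 2 - 1 := by ring
  rw [this]
  ext v
  simp
  ring

/-- The homogeneous extension of degree `1 + ε` of a function on the sphere. -/
def homExt (ε : ℝ) (f : Euc n → ℝ) (x : Euc n) : ℝ := ‖x‖ ^ (1 + ε) * f (‖x‖⁻¹ • x)

/-- The gradient of the homogeneous extension in terms of the gradient `g` of the function. -/
def homExtGrad (ε : ℝ) (f : Euc n → ℝ) (g : Euc n → Euc n) (x : Euc n) : Euc n :=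
  ‖x‖ ^ ε • (((1 + ε) * f (‖x‖⁻¹ • x)) • (‖x‖⁻¹ • x) + (g (‖x‖⁻¹ • x) -
    inner ℝ (g (‖x‖⁻¹ • x)) (‖x‖⁻¹ • x) • (‖x‖⁻¹ • x)))

/-- The gradient splits into the radial part `(1+ε)fξ` and the tangential projection of `g`, both
scaled by `|x|^ε`. -/
lemma hasGradientAt_homExt {ε : ℝ} {f : Euc n → ℝ} {g : Euc n → Euc n}
    (hg : ∀ x, HasGradientAt f (g x) x) {x : Euc n} (hx : x ≠ 0) :
    HasGradientAt (homExt ε f) (homExtGrad ε f g x) x := by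
  have hr := norm_pos_iff.2 hx
  have h1 := hasFDerivAt_norm_rpow' (1 + ε) hx
  have h2 := hasFDerivAt_norm_rpow' (-1) hx
  have h2' : HasFDerivAt (fun x : Euc n => ‖x‖⁻¹) ((-1 * ‖x‖ ^ ((-1 : ℝ) - 2)) • innerSL ℝ x) x := by
    simpa only [Real.rpow_neg_one] using h2
  have h3 := h2'.fun_smul (hasFDerivAt_id (𝕜 := ℝ) x)
  have h4 := h1.mul (HasFDerivAt.comp (g := f) (f := fun x : Euc n => ‖x‖⁻¹ • x) x
    (hg (‖x‖⁻¹ • x)).hasFDerivAt h3)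
  rw [hasGradientAt_iff_hasFDerivAt]
  refine h4.congr_fderiv ?_
  ext v
  have e1 : ‖x‖ ^ (1 + ε - 2) = ‖x‖ ^ ε * ‖x‖⁻¹ := by
    rw [← Real.rpow_neg_one, ← Real.rpow_add hr]; ring_nf
  have e2 : ‖x‖ ^ (1 + ε) = ‖x‖ ^ ε * ‖x‖ := by
    rw [add_comm, Real.rpow_add_one hr.ne']
  have e3 : ‖x‖ ^ ((-1 : ℝ) - 2) = ‖x‖⁻¹ ^ 3 := by
    rw [show ((-1 : ℝ) - 2) = -((3 : ℕ) : ℝ) by norm_num, Real.rpow_neg hr.le, Real.rpow_natCast,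
      inv_pow]
  simp [homExtGrad, inner_smul_right, e1, e2, e3]
  field_simp
  ring

/-- The extension is `O(|x|^{1+ε})`. This is the purpose of `ε`: the natural degree 1 would in
general fail to be differentiable at the origin. -/
lemma homExt_hasGradientAt_zero {ε M : ℝ} (hε : 0 < ε) {f : Euc n → ℝ}
    (hM : ∀ x : Euc n, |f (‖x‖⁻¹ • x)| ≤ M) : HasGradientAt (homExt ε f) 0 0 := by
  rw [hasGradientAt_iff_hasFDerivAt, map_zero]
  refine .of_isLittleO ?_
  have h0 : homExt ε f 0 = 0 := by
    simp [homExt, Real.zero_rpow (by linarith : (1 + ε) ≠ 0)]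
  simp only [h0, sub_zero, zero_apply]
  rw [Asymptotics.isLittleO_iff]
  intro c hc
  have ht : Tendsto (fun x : Euc n => ‖x‖ ^ ε * M) (𝓝 0) (𝓝 0) := by
    have : Continuous (fun x : Euc n => ‖x‖ ^ ε * M) :=
      (continuous_norm.rpow_const fun _ => Or.inr hε.le).mul continuous_const
    have := this.tendsto 0
    simpa [Real.zero_rpow hε.ne'] using this
  filter_upwards [ht.eventually (gt_mem_nhds hc)] with x hx
  by_cases hx0 : x = 0
  · simp [hx0, h0]
  have hr := norm_pos_iff.2 hx0
  rw [homExt, norm_mul, Real.norm_eq_abs, Real.norm_eq_abs, abs_of_nonneg (by positivity),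
    add_comm, Real.rpow_add_one hr.ne']
  calc ‖x‖ ^ ε * ‖x‖ * |f (‖x‖⁻¹ • x)| ≤ ‖x‖ ^ ε * ‖x‖ * M := by gcongr; exact hM x
    _ = (‖x‖ ^ ε * M) * ‖x‖ := by ring
    _ ≤ c * ‖x‖ := by gcongr

/-- Pythagoras for the radial and tangential parts. -/
lemma norm_homExtGrad_sq (ε : ℝ) (f : Euc n → ℝ) (g : Euc n → Euc n) {x : Euc n} (hx : x ≠ 0) :
    ‖homExtGrad ε f g x‖ ^ 2 = ‖x‖ ^ (2 * ε) * ((1 + ε) ^ 2 * f (‖x‖⁻¹ • x) ^ 2 +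
      (‖g (‖x‖⁻¹ • x)‖ ^ 2 - inner ℝ (g (‖x‖⁻¹ • x)) (‖x‖⁻¹ • x) ^ 2)) := by
  have hr := norm_pos_iff.2 hx
  have h1 : ‖‖x‖⁻¹ • x‖ = 1 := by rw [norm_smul, norm_inv, norm_norm, inv_mul_cancel₀ hr.ne']
  have h2 : (‖x‖ ^ ε) ^ 2 = ‖x‖ ^ (2 * ε) := by
    rw [← Real.rpow_natCast, ← Real.rpow_mul hr.le]; ring_nf
  rw [homExtGrad, norm_smul, mul_pow, Real.norm_of_nonneg (by positivity), h2]
  generalize ‖x‖⁻¹ • x = ξ at h1 ⊢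
  have h3 : inner ℝ ξ ξ = (1 : ℝ) := by rw [real_inner_self_eq_norm_sq, h1, one_pow]
  congr 1
  rw [← real_inner_self_eq_norm_sq, ← real_inner_self_eq_norm_sq (g ξ)]
  simp only [inner_add_left, inner_add_right, inner_sub_left, inner_sub_right, inner_smul_left,
    inner_smul_right, h3, conj_trivial, real_inner_comm (g ξ) ξ]
  ring

lemma polyGrowth_homExt {ε : ℝ} (hε : 0 < ε) (hε1 : ε ≤ 1) {f : Euc n → ℝ}
    {g : Euc n → Euc n} (hg : ∀ x, HasGradientAt f (g x) x) (hgc : Continuous g) :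
    ∃ C, PolyGrowth (homExt ε f) (homExtGrad ε f g) C := by
  have hfc : Continuous f :=
    continuous_iff_continuousAt.2 fun x => (hg x).hasFDerivAt.continuousAt
  obtain ⟨M, hM⟩ : ∃ M : ℝ, ∀ x : Euc n, ‖x‖ ≤ 1 → |f x| ≤ M ∧ ‖g x‖ ≤ M := by
    obtain ⟨M1, h1⟩ := (isCompact_closedBall (0 : Euc n) 1).exists_bound_of_continuousOn
      hfc.continuousOn
    obtain ⟨M2, h2⟩ := (isCompact_closedBall (0 : Euc n) 1).exists_bound_of_continuousOn
      hgc.continuousOn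
    exact ⟨max M1 M2, fun x hx => ⟨(h1 x (by simpa using hx)).trans (le_max_left _ _),
      (h2 x (by simpa using hx)).trans (le_max_right _ _)⟩⟩
  -- Only an inequality, since the normalized vector is 0 at `x = 0`.
  have hξ : ∀ x : Euc n, ‖‖x‖⁻¹ • x‖ ≤ 1 := fun x => by
    rw [norm_smul, norm_inv, norm_norm]
    exact inv_mul_le_one
  have hM0 : 0 ≤ M := (abs_nonneg _).trans (hM 0 (by simp)).1
  have hp : ∀ (x : Euc n), ‖x‖ ^ ε ≤ 1 + ‖x‖ := fun x => by
    calc ‖x‖ ^ ε ≤ (1 + ‖x‖) ^ ε := Real.rpow_le_rpow (norm_nonneg x) (by linarith) hε.le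
      _ ≤ (1 + ‖x‖) ^ (1 : ℝ) :=
        Real.rpow_le_rpow_of_exponent_le (by linarith [norm_nonneg x]) hε1
      _ = _ := Real.rpow_one _
  refine ⟨4 * M, ⟨?_, fun x => ?_, fun x => ?_, fun x => ?_⟩⟩
  · unfold homExtGrad
    have h1 : Measurable fun x : Euc n => ‖x‖⁻¹ • x := by fun_prop
    have h2 : Measurable fun x : Euc n => f (‖x‖⁻¹ • x) := hfc.measurable.comp h1
    have h3 : Measurable fun x : Euc n => g (‖x‖⁻¹ • x) := hgc.measurable.comp h1
    have h4 : Measurable fun x : Euc n => inner ℝ (g (‖x‖⁻¹ • x)) (‖x‖⁻¹ • x) := h3.inner h1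
    exact ((measurable_norm.pow_const ε)).smul (((h2.const_mul _).smul h1).add
      (h3.sub (h4.smul h1)))
  · by_cases hx : x = 0
    · subst hx
      have : homExtGrad ε f g 0 = 0 := by simp [homExtGrad, Real.zero_rpow hε.ne']
      rw [this]
      exact homExt_hasGradientAt_zero hε fun x => (hM _ (hξ x)).1
    · exact hasGradientAt_homExt hg hx
  · have h0 := norm_nonneg x
    rw [homExt, abs_mul, abs_of_nonneg (by positivity)]
    have h1 : ‖x‖ ^ (1 + ε) ≤ (1 + ‖x‖) ^ 2 := by
      calc ‖x‖ ^ (1 + ε) ≤ (1 + ‖x‖) ^ (1 + ε) :=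
            Real.rpow_le_rpow h0 (by linarith) (by linarith)
        _ ≤ (1 + ‖x‖) ^ (2 : ℝ) :=
          Real.rpow_le_rpow_of_exponent_le (by linarith) (by linarith)
        _ = _ := by norm_cast
    calc _ ≤ (1 + ‖x‖) ^ 2 * M := mul_le_mul h1 (hM _ (hξ x)).1 (abs_nonneg _) (by positivity)
      _ ≤ _ := by nlinarith [mul_nonneg hM0 (sq_nonneg (1 + ‖x‖))]
  · have h0 := norm_nonneg x
    obtain ⟨hf1, hg1⟩ := hM _ (hξ x)
    have hx1 := hξ x
    rw [homExtGrad, norm_smul, Real.norm_of_nonneg (by positivity)]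
    set ξ := ‖x‖⁻¹ • x
    have hb : ‖((1 + ε) * f ξ) • ξ + (g ξ - inner ℝ (g ξ) ξ • ξ)‖ ≤ 4 * M := by
      have b1 : ‖((1 + ε) * f ξ) • ξ‖ ≤ 2 * M := by
        rw [norm_smul, norm_mul, Real.norm_eq_abs, Real.norm_eq_abs, abs_of_pos (by linarith)]
        calc (1 + ε) * |f ξ| * ‖ξ‖ ≤ 2 * M * 1 := by gcongr; linarith
          _ = _ := mul_one _
      have b2 : ‖inner ℝ (g ξ) ξ • ξ‖ ≤ M := by
        rw [norm_smul, Real.norm_eq_abs]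
        calc |inner ℝ (g ξ) ξ| * ‖ξ‖ ≤ (M * 1) * 1 := by
              gcongr
              exact (abs_real_inner_le_norm _ _).trans (by gcongr)
          _ = _ := by ring
      have := norm_add_le (((1 + ε) * f ξ) • ξ) (g ξ - inner ℝ (g ξ) ξ • ξ)
      have := norm_sub_le (g ξ) (inner ℝ (g ξ) ξ • ξ)
      linarith
    calc _ ≤ (1 + ‖x‖) * (4 * M) := mul_le_mul (hp x) hb (norm_nonneg _) (by positivity)
      _ ≤ _ := by nlinarith [mul_nonneg hM0 h0, mul_nonneg hM0 (sq_nonneg ‖x‖)]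

lemma continuous_integrable_surf {f : Euc n → ℝ} (hf : Continuous f) :
    Integrable (fun ξ : Sph n => f ξ) (surf n) := by
  have : CompactSpace (Sph n) := isCompact_iff_compactSpace.1 (isCompact_sphere _ _)
  exact (hf.comp continuous_subtype_val).integrable_of_hasCompactSupport
    (HasCompactSupport.of_compactSpace _)

/-- The sharp **Poincaré inequality on the sphere** for centered functions. -/
lemma sphere_poincare (hn : 1 ≤ n) {f : Euc n → ℝ} {g : Euc n → Euc n}
    (hg : ∀ x, HasGradientAt f (g x) x) (hgc : Continuous g) (h0 : ∫ ξ, f ξ ∂surf n = 0) :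
    ((n : ℝ) - 1) * ∫ ξ, f ξ ^ 2 ∂surf n ≤
      ∫ ξ, (‖g ξ‖ ^ 2 - inner ℝ (g ξ) (ξ : Euc n) ^ 2) ∂surf n := by
  have hfc : Continuous f :=
    continuous_iff_continuousAt.2 fun x => (hg x).hasFDerivAt.continuousAt
  set A := ∫ ξ, f ξ ^ 2 ∂surf n with hA
  set B := ∫ ξ, (‖g ξ‖ ^ 2 - inner ℝ (g ξ) (ξ : Euc n) ^ 2) ∂surf n with hB
  have hA0 : 0 ≤ A := integral_nonneg fun _ => sq_nonneg _
  have hae : ∀ᵐ x : Euc n, x ≠ 0 := by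
    have : Nonempty (Fin n) := ⟨⟨0, hn⟩⟩
    exact compl_mem_ae_iff.2 (measure_singleton _)
  have key : ∀ ε : ℝ, 0 < ε → ε ≤ 1 → ((n : ℝ) - 1) * A - B ≤ ε * A := by
    intro ε hε hε1
    obtain ⟨C, hC⟩ := polyGrowth_homExt hε hε1 hg hgc
    set q : ℝ := (n : ℝ) - 1 + 2 * ε
    have hn' : (1 : ℝ) ≤ n := by exact_mod_cast hn
    have hq : -1 < q := by simp only [q]; linarith
    have hnat : ∀ r ∈ Ioi (0 : ℝ), r ^ (n - 1) = r ^ ((n : ℝ) - 1) := fun r hr => by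
      rw [← Real.rpow_natCast, Nat.cast_sub hn]; simp
    have hm : ∀ a : ℝ, ∫ r in Ioi (0 : ℝ), r ^ (n - 1) * (r ^ a * Real.exp (-(1 / 2) * r ^ 2)) =
        ∫ r in Ioi (0 : ℝ), r ^ ((n : ℝ) - 1 + a) * Real.exp (-(1 / 2) * r ^ (2 : ℝ)) := fun a => by
      refine setIntegral_congr_fun measurableSet_Ioi fun r hr => ?_
      rw [hnat r hr, Real.rpow_add hr, Real.rpow_two]
      ring
    -- Integration factors into radius and direction, so zero mean on the sphere passes to the
    -- extension.
    have i0 : ∫ x, homExt ε f x * gauss x = 0 := by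
      have := integral_polar_mul hn (fun r => r ^ (1 + ε) * Real.exp (-(1 / 2) * r ^ 2)) f
      rw [h0, mul_zero] at this
      rw [← this]
      refine integral_congr_ae (ae_of_all _ fun x => ?_)
      simp only [homExt, gauss]; ring
    have i1 : ∫ x, homExt ε f x ^ 2 * gauss x =
        (∫ r in Ioi (0 : ℝ), r ^ (q + 2) * Real.exp (-(1 / 2) * r ^ (2 : ℝ))) * A := by
      have h := integral_polar_mul hn (fun r => r ^ (2 + 2 * ε) * Real.exp (-(1 / 2) * r ^ 2))
        (fun x => f x ^ 2)
      rw [hm] at h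
      have : (n : ℝ) - 1 + (2 + 2 * ε) = q + 2 := by simp only [q]; ring
      rw [this] at h
      rw [hA, ← h]
      refine integral_congr_ae (ae_of_all _ fun x => ?_)
      have : (‖x‖ ^ (1 + ε)) ^ 2 = ‖x‖ ^ (2 + 2 * ε) := by
        rw [← Real.rpow_natCast, ← Real.rpow_mul (norm_nonneg x)]; push_cast; ring_nf
      simp only [homExt, gauss, mul_pow, this]; ring
    have i2 : ∫ x, ‖homExtGrad ε f g x‖ ^ 2 * gauss x =
        (∫ r in Ioi (0 : ℝ), r ^ q * Real.exp (-(1 / 2) * r ^ (2 : ℝ))) *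
          ((1 + ε) ^ 2 * A + B) := by
      have h := integral_polar_mul hn (fun r => r ^ (2 * ε) * Real.exp (-(1 / 2) * r ^ 2))
        (fun x => (1 + ε) ^ 2 * f x ^ 2 + (‖g x‖ ^ 2 - inner ℝ (g x) x ^ 2))
      rw [hm] at h
      rw [integral_add, integral_const_mul] at h
      · rw [hA, hB, ← h]
        refine integral_congr_ae ?_
        filter_upwards [hae] with x hx
        rw [norm_homExtGrad_sq ε f g hx, gauss]
        ring
      · exact (continuous_integrable_surf (hfc.pow 2)).const_mul _
      · exact continuous_integrable_surf (f := fun x => ‖g x‖ ^ 2 - inner ℝ (g x) x ^ 2)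
          (by fun_prop)
    -- After the moment recursion this reads `(q+1)A ≤ (1+ε)²A + B` with `q = n-1+2ε`. The terms
    -- linear in `ε` cancel, leaving `(n-1)A - B ≤ ε²A`.
    have hP := hC.gaussian_poincare i0
    rw [i1, i2, gauss_moment q hq, mul_right_comm, mul_comm _ ((1 + ε) ^ 2 * A + B)] at hP
    have hP' := le_of_mul_le_mul_right hP (gauss_moment_pos q hq)
    simp only [q] at hP'
    nlinarith [mul_nonneg hA0 hε.le, mul_nonneg (mul_nonneg hA0 hε.le) (by linarith : 0 ≤ 1 - ε)]
  have : ((n : ℝ) - 1) * A - B ≤ 0 := by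
    refine le_of_forall_pos_le_add fun δ hδ => ?_
    have hpos : 0 < min 1 (δ / (A + 1)) := lt_min one_pos (by positivity)
    refine (key _ hpos (min_le_left _ _)).trans ?_
    have h1 : min 1 (δ / (A + 1)) * A ≤ δ / (A + 1) * A := by gcongr; exact min_le_right _ _
    have h2 : δ / (A + 1) * A ≤ δ := by
      rw [div_mul_eq_mul_div, div_le_iff₀ (by positivity)]
      nlinarith
    linarith
  linarith

/-! ### One-dimensional inequalities in the slope variable -/

lemma slopeRadius_le_one (y : ℝ) : slopeRadius y ≤ 1 := by
  have h := slopeRadius_pow_four y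
  have hc := slopeRadius_pos y
  by_contra! h1
  have : 1 < slopeRadius y ^ 4 := one_lt_pow₀ h1 (by norm_num)
  nlinarith [sq_nonneg y]

lemma slopeRadius_sq_mul_abs_le (y : ℝ) : slopeRadius y ^ 2 * |y| ≤ 1 := by
  have h := slopeRadius_pow_four y
  have h2 : (slopeRadius y ^ 2 * |y|) ^ 2 = slopeRadius y ^ 4 * y ^ 2 := by
    rw [mul_pow, sq_abs]; ring
  have h4 := pow_pos (slopeRadius_pos y) 4
  refine le_of_abs_le (abs_le_of_sq_le_sq ?_ zero_le_one) 
  rw [h2]; linarith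

lemma sq_le_sq_of_abs_le {a b : ℝ} (h : |a| ≤ b) : a ^ 2 ≤ b ^ 2 :=
  sq_le_sq' (abs_le.1 h).1 (abs_le.1 h).2

lemma hasDerivAt_slopeRadius (y : ℝ) :
    HasDerivAt slopeRadius (-(1 / 2) * y * slopeRadius y ^ 5) y := by
  have h0 : (0 : ℝ) < 1 + y ^ 2 := by positivity
  have h : HasDerivAt (fun y : ℝ => (1 + y ^ 2) ^ (-(1 / 4) : ℝ)) _ y :=
    (((hasDerivAt_id y).fun_pow 2).const_add 1).rpow_const (Or.inl h0.ne')
  refine h.congr_deriv ?_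
  have h5 : slopeRadius y ^ 5 = (1 + y ^ 2) ^ (-(1 / 4) - 1 : ℝ) := by
    rw [slopeRadius, ← Real.rpow_natCast, ← Real.rpow_mul h0.le]
    norm_num
  rw [h5]
  simp only [id]
  push_cast
  ring

lemma hasDerivAt_slopeRadius_pow (k : ℕ) (y : ℝ) :
    HasDerivAt (fun y => slopeRadius y ^ k) (-(k / 2) * y * slopeRadius y ^ (k + 4)) y := by
  refine ((hasDerivAt_slopeRadius y).fun_pow k).congr_deriv ?_
  rcases k with _ | k
  · simp
  · simp only [Nat.add_sub_cancel, Nat.cast_add, Nat.cast_one]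
    ring

lemma integrable_slopeRadius_pow {k : ℕ} (hk : 3 ≤ k) : Integrable fun y => slopeRadius y ^ k := by
  have h := integrable_rpow_neg_one_add_norm_sq (E := ℝ) (μ := volume) (r := (k : ℝ) / 2) (by
    have : (3 : ℝ) ≤ k := by exact_mod_cast hk
    simp; linarith)
  refine h.congr (ae_of_all _ fun y => ?_)
  simp only [slopeRadius, Real.norm_eq_abs, sq_abs]
  rw [← Real.rpow_mul_natCast (by positivity)]
  congr 1
  ring

lemma integrable_of_le_slopeRadius {H : ℝ → ℝ} {C : ℝ} (hm : AEStronglyMeasurable H)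
    (h : ∀ y, |H y| ≤ C * slopeRadius y ^ 3) : Integrable H :=
  ((integrable_slopeRadius_pow le_rfl).const_mul C).mono' hm (ae_of_all _ h)

lemma slopeRadius_pow_le {j k : ℕ} (h : k ≤ j) (y : ℝ) : slopeRadius y ^ j ≤ slopeRadius y ^ k :=
  pow_le_pow_of_le_one (slopeRadius_pos y).le (slopeRadius_le_one y) h

lemma tendsto_slopeRadius_atTop : Tendsto slopeRadius atTop (𝓝 0) := by
  have h1 : Tendsto (fun y : ℝ => 1 + y ^ 2) atTop atTop :=
    tendsto_atTop_add_const_left _ _ (tendsto_pow_atTop two_ne_zero)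
  exact (tendsto_rpow_neg_atTop (by norm_num : (0 : ℝ) < 1 / 4)).comp h1

lemma slopeRadius_neg (y : ℝ) : slopeRadius (-y) = slopeRadius y := by simp [slopeRadius]

lemma tendsto_slopeRadius_atBot : Tendsto slopeRadius atBot (𝓝 0) := by
  refine (tendsto_slopeRadius_atTop.comp tendsto_neg_atBot_atTop).congr fun y => ?_
  simp [slopeRadius_neg]

lemma abs_slope_pow_mul_sq_le {k : ℕ} (hk : 3 ≤ k) {a M : ℝ} (h : |a| ≤ M) (y : ℝ) :
    |slopeRadius y ^ k * a ^ 2| ≤ M ^ 2 * slopeRadius y ^ 3 := by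
  have := slopeRadius_pos y
  rw [abs_of_nonneg (by positivity), mul_comm]
  exact mul_le_mul (sq_le_sq_of_abs_le h) (slopeRadius_pow_le hk y) (by positivity) (by positivity)

/-- The growth `(1+y²)²` is `c⁻⁸`, compensated by `c^{n+4}` and the decay `c⁶` of the squared
derivative. -/
lemma abs_slope_pow_mul_deriv_sq_le (hn : 3 ≤ n) {a M y : ℝ} (h : |a| ≤ M * slopeRadius y ^ 3) :
    |slopeRadius y ^ (n + 4) * ((1 + y ^ 2) * a) ^ 2| ≤ M ^ 2 * slopeRadius y ^ 3 := by
  have hc := slopeRadius_pos y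
  have h4 := slopeRadius_pow_four y
  rw [abs_of_nonneg (by positivity)]
  have h5 : a ^ 2 ≤ (M * slopeRadius y ^ 3) ^ 2 := sq_le_sq_of_abs_le h
  calc slopeRadius y ^ (n + 4) * ((1 + y ^ 2) * a) ^ 2
      = slopeRadius y ^ (n + 4) * (1 + y ^ 2) ^ 2 * a ^ 2 := by ring
    _ ≤ slopeRadius y ^ (n + 4) * (1 + y ^ 2) ^ 2 * (M * slopeRadius y ^ 3) ^ 2 := by gcongr
    _ = M ^ 2 * slopeRadius y ^ (n + 2) * (slopeRadius y ^ 4 * (1 + y ^ 2)) ^ 2 := by ring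
    _ = M ^ 2 * slopeRadius y ^ (n + 2) := by rw [h4]; ring
    _ ≤ M ^ 2 * slopeRadius y ^ 3 := by
      gcongr ?_ * ?_; exact slopeRadius_pow_le (by omega : 3 ≤ n + 2) y

lemma integrable_slope_sq (hn : 3 ≤ n) {G G' : ℝ → ℝ} {M : ℝ} (hGc : Continuous G)
    (hG'm : Measurable G') (hM : ∀ y, |G y| ≤ M) (hM' : ∀ y, |G' y| ≤ M * slopeRadius y ^ 3) :
    (Integrable fun y => slopeRadius y ^ (n + 4) * G y ^ 2) ∧
      Integrable fun y => slopeRadius y ^ (n + 4) * ((1 + y ^ 2) * G' y) ^ 2 := by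
  have hcm := continuous_slopeRadius.measurable
  exact ⟨integrable_of_le_slopeRadius (by fun_prop) fun y =>
      abs_slope_pow_mul_sq_le (by omega) (hM y) y,
    integrable_of_le_slopeRadius (by fun_prop) fun y => abs_slope_pow_mul_deriv_sq_le hn (hM' y)⟩

/-- The Hardy inequality whose ground state is `slopeRadius`. -/
lemma slope_hardy (hn : 3 ≤ n) {G G' : ℝ → ℝ} {M : ℝ} (hG : ∀ y, HasDerivAt G (G' y) y)
    (hG'm : Measurable G') (hM : ∀ y, |G y| ≤ M) (hM' : ∀ y, |G' y| ≤ M * slopeRadius y ^ 3) :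
    ((n : ℝ) + 1) * ∫ y, slopeRadius y ^ (n + 4) * G y ^ 2 ≤
      ∫ y, (4 * (slopeRadius y ^ (n + 4) * ((1 + y ^ 2) * G' y) ^ 2) +
        ((n : ℝ) - 1) * (slopeRadius y ^ n * G y ^ 2)) := by
  have hM0 : 0 ≤ M := (abs_nonneg _).trans (hM 0)
  have hGc : Continuous G := continuous_iff_continuousAt.2 fun y => (hG y).continuousAt
  have hcc := continuous_slopeRadius
  have hcm := continuous_slopeRadius.measurable
  have hGsq : ∀ y, G y ^ 2 ≤ M ^ 2 := fun y => sq_le_sq_of_abs_le (hM y)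
  obtain ⟨i1, i3⟩ := integrable_slope_sq hn hGc hG'm hM hM'
  have i2 : Integrable fun y => slopeRadius y ^ n * G y ^ 2 :=
    integrable_of_le_slopeRadius (by fun_prop) fun y => abs_slope_pow_mul_sq_le hn (hM y) y
  have hB : ∀ y, HasDerivAt (fun y => 2 * (slopeRadius y ^ n * y * G y ^ 2))
      (2 * ((-(n / 2) * y * slopeRadius y ^ (n + 4) * y + slopeRadius y ^ n) * G y ^ 2 +
        slopeRadius y ^ n * y * (2 * G y * G' y))) y := fun y => by
    refine ((((hasDerivAt_slopeRadius_pow n y).mul (hasDerivAt_id y)).mul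
      ((hG y).fun_pow 2)).const_mul 2).congr_deriv ?_
    simp
  -- Adding the total derivative of `2cⁿyG²` completes the square. It vanishes for `G = c`, because
  -- `(1+y²)c' = -yc/2`.
  have hid : ∀ y, 4 * (slopeRadius y ^ (n + 4) * ((1 + y ^ 2) * G' y) ^ 2) +
        ((n : ℝ) - 1) * (slopeRadius y ^ n * G y ^ 2) -
        ((n : ℝ) + 1) * (slopeRadius y ^ (n + 4) * G y ^ 2) +
        2 * ((-(n / 2) * y * slopeRadius y ^ (n + 4) * y + slopeRadius y ^ n) * G y ^ 2 +
        slopeRadius y ^ n * y * (2 * G y * G' y)) =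
      4 * slopeRadius y ^ (n + 4) * ((1 + y ^ 2) * G' y + (1 / 2) * y * G y) ^ 2 := fun y => by
    have h4 : slopeRadius y ^ n = slopeRadius y ^ (n + 4) * (1 + y ^ 2) := by
      rw [pow_add, mul_assoc, slopeRadius_pow_four, mul_one]
    rw [h4]
    ring
  have iB : Integrable fun y => 2 * ((-(n / 2) * y * slopeRadius y ^ (n + 4) * y +
      slopeRadius y ^ n) * G y ^ 2 + slopeRadius y ^ n * y * (2 * G y * G' y)) := by
    have j1 : Integrable fun y => slopeRadius y ^ n * y * (2 * G y * G' y) := by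
      refine integrable_of_le_slopeRadius (C := 2 * M * M) (by fun_prop) fun y => ?_
      have hc := slopeRadius_pos y
      have hy := slopeRadius_sq_mul_abs_le y
      obtain ⟨k, rfl⟩ : ∃ k, n = k + 2 := ⟨n - 2, by omega⟩
      rw [abs_mul, abs_mul, abs_mul, abs_mul, abs_of_pos (pow_pos hc _), abs_two]
      calc slopeRadius y ^ (k + 2) * |y| * (2 * |G y| * |G' y|)
          = slopeRadius y ^ k * (slopeRadius y ^ 2 * |y|) * (2 * |G y| * |G' y|) := by ring
        _ ≤ 1 * 1 * (2 * M * (M * slopeRadius y ^ 3)) := by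
            gcongr ?_ * ?_ * (2 * ?_ * ?_)
            · exact pow_le_one₀ hc.le (slopeRadius_le_one y)
            · exact hM y
            · exact hM' y
        _ = _ := by ring
    have : (fun y => 2 * ((-(n / 2) * y * slopeRadius y ^ (n + 4) * y +
      slopeRadius y ^ n) * G y ^ 2 + slopeRadius y ^ n * y * (2 * G y * G' y))) =
      fun y => (2 - n) * (slopeRadius y ^ n * G y ^ 2) + n * (slopeRadius y ^ (n + 4) * G y ^ 2) +
        2 * (slopeRadius y ^ n * y * (2 * G y * G' y)) := by
      ext y
      have h4 : slopeRadius y ^ n = slopeRadius y ^ (n + 4) * (1 + y ^ 2) := by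
        rw [pow_add, mul_assoc, slopeRadius_pow_four, mul_one]
      rw [h4]; ring
    rw [this]
    exact ((i2.const_mul _).add (i1.const_mul _)).add (j1.const_mul _)
  -- Here `n ≥ 3` enters: `c²|y| ≤ 1`, and a further factor `c` is left to force the decay of the
  -- boundary term.
  have hlim : ∀ l : Filter ℝ, Tendsto slopeRadius l (𝓝 0) →
      Tendsto (fun y => 2 * (slopeRadius y ^ n * y * G y ^ 2)) l (𝓝 0) := fun l hl => by
    have hb : Tendsto (fun y => 2 * M ^ 2 * slopeRadius y) l (𝓝 0) := by
      simpa using hl.const_mul (2 * M ^ 2)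
    refine squeeze_zero_norm (fun y => ?_) hb
    have hc := slopeRadius_pos y
    have hy := slopeRadius_sq_mul_abs_le y
    obtain ⟨k, rfl⟩ : ∃ k, n = k + 3 := ⟨n - 3, by omega⟩
    rw [Real.norm_eq_abs, abs_mul, abs_mul, abs_mul, abs_of_pos (pow_pos hc _), abs_two,
      abs_of_nonneg (sq_nonneg (G y))]
    calc 2 * (slopeRadius y ^ (k + 3) * |y| * G y ^ 2)
        = 2 * ((slopeRadius y ^ k * slopeRadius y * (slopeRadius y ^ 2 * |y|)) * G y ^ 2) := by ring
      _ ≤ 2 * ((1 * slopeRadius y * 1) * M ^ 2) := by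
          gcongr 2 * (?_ * slopeRadius y * ?_ * ?_)
          · exact pow_le_one₀ hc.le (slopeRadius_le_one y)
          · exact hGsq y
      _ = _ := by ring
  have hBint := integral_of_hasDerivAt_of_tendsto hB iB (hlim _ tendsto_slopeRadius_atBot)
    (hlim _ tendsto_slopeRadius_atTop)
  have hnn : 0 ≤ ∫ y, (4 * (slopeRadius y ^ (n + 4) * ((1 + y ^ 2) * G' y) ^ 2) +
        ((n : ℝ) - 1) * (slopeRadius y ^ n * G y ^ 2) -
        ((n : ℝ) + 1) * (slopeRadius y ^ (n + 4) * G y ^ 2) +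
        2 * ((-(n / 2) * y * slopeRadius y ^ (n + 4) * y + slopeRadius y ^ n) * G y ^ 2 +
        slopeRadius y ^ n * y * (2 * G y * G' y))) := by
    refine integral_nonneg fun y => ?_
    simp only [hid]
    have := slopeRadius_pos y
    positivity
  have i4 : Integrable fun y => 4 * (slopeRadius y ^ (n + 4) * ((1 + y ^ 2) * G' y) ^ 2) +
      ((n : ℝ) - 1) * (slopeRadius y ^ n * G y ^ 2) := (i3.const_mul _).add (i2.const_mul _)
  have i5 : Integrable fun y => 4 * (slopeRadius y ^ (n + 4) * ((1 + y ^ 2) * G' y) ^ 2) +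
      ((n : ℝ) - 1) * (slopeRadius y ^ n * G y ^ 2) -
      ((n : ℝ) + 1) * (slopeRadius y ^ (n + 4) * G y ^ 2) := i4.sub (i1.const_mul _)
  rw [integral_add i5 iB, integral_sub i4 (i1.const_mul _), hBint, integral_const_mul] at hnn
  linarith

/-- Ground state substitution with `y/√(1+y²)`, which solves `(1+y²)g' = g/y`. The completed square
leaves a nonnegative remainder, which is dropped. -/
lemma slope_poincare_Ioi (hn : 3 ≤ n) {G G' : ℝ → ℝ} {M : ℝ} (hG : ∀ y, HasDerivAt G (G' y) y)
    (hG'm : Measurable G') (h0 : G 0 = 0) (hM : ∀ y, |G y| ≤ M)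
    (hM' : ∀ y, |G' y| ≤ M * slopeRadius y ^ 3) :
    ∫ y in Ioi (0 : ℝ), slopeRadius y ^ (n + 4) * G y ^ 2 ≤
      ∫ y in Ioi (0 : ℝ), slopeRadius y ^ (n + 4) * ((1 + y ^ 2) * G' y) ^ 2 := by
  have hM0 : 0 ≤ M := (abs_nonneg _).trans (hM 0)
  have hGc : Continuous G := continuous_iff_continuousAt.2 fun y => (hG y).continuousAt
  have hcc := continuous_slopeRadius
  have hcm := continuous_slopeRadius.measurable
  have hGsq : ∀ y, G y ^ 2 ≤ M ^ 2 := fun y => sq_le_sq_of_abs_le (hM y)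
  -- `G(0) = 0` with a bounded derivative controls the quotients `G²/y` and `G²/y²` at the origin.
  have hlin : ∀ y, |G y| ≤ M * |y| := fun y => by
    have := (convex_univ).norm_image_sub_le_of_norm_hasDerivWithin_le (f := G) (f' := G') (C := M)
      (x := 0) (y := y) (fun x _ => (hG x).hasDerivWithinAt) (fun x _ => (hM' x).trans (by
        have := pow_le_one₀ (slopeRadius_pos x).le (slopeRadius_le_one x) (n := 3)
        nlinarith)) (mem_univ _) (mem_univ _)
    simpa [h0] using this
  obtain ⟨i1, i3⟩ := integrable_slope_sq hn hGc hG'm hM hM'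
  let B' : ℝ → ℝ := fun y => slopeRadius y ^ n * (2 * G y * G' y) / y -
      slopeRadius y ^ n * G y ^ 2 / y ^ 2 - (n / 2) * (slopeRadius y ^ (n + 4) * G y ^ 2)
  have hB : ∀ y ∈ Ioi (0 : ℝ), HasDerivAt (fun y => slopeRadius y ^ n * G y ^ 2 / y) (B' y) y :=
    fun y hy => by
    have hy : (y : ℝ) ≠ 0 := ne_of_gt hy
    refine (((hasDerivAt_slopeRadius_pow n y).mul ((hG y).fun_pow 2)).div (hasDerivAt_id y)
      hy).congr_deriv ?_
    simp only [B', Pi.mul_apply, id]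
    field_simp
    ring
  have hid : ∀ y ∈ Ioi (0 : ℝ), slopeRadius y ^ (n + 4) * ((1 + y ^ 2) * G' y) ^ 2 -
      slopeRadius y ^ (n + 4) * G y ^ 2 - B' y =
      slopeRadius y ^ (n + 4) * ((1 + y ^ 2) * G' y - G y / y) ^ 2 +
        (n / 2) * (slopeRadius y ^ (n + 4) * G y ^ 2) := fun y hy => by
    have hy : (y : ℝ) ≠ 0 := ne_of_gt hy
    have h4 : slopeRadius y ^ n = slopeRadius y ^ (n + 4) * (1 + y ^ 2) := by
      rw [pow_add, mul_assoc, slopeRadius_pow_four, mul_one]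
    simp only [B', h4]
    field_simp
    ring
  have iB : Integrable B' := by
    have hcn : ∀ y, slopeRadius y ^ n ≤ slopeRadius y ^ 3 := slopeRadius_pow_le hn
    refine (Integrable.sub ?_ ?_).sub (i1.const_mul _)
    · refine integrable_of_le_slopeRadius (C := 2 * M * M) (Measurable.div (by fun_prop)
        measurable_id).aestronglyMeasurable fun y => ?_
      have hc := slopeRadius_pos y
      rw [abs_div, abs_mul, abs_mul, abs_mul, abs_of_pos (pow_pos hc _), abs_two]
      refine div_le_of_le_mul₀ (abs_nonneg _) (by positivity) ?_
      calc slopeRadius y ^ n * (2 * |G y| * |G' y|)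
          ≤ slopeRadius y ^ 3 * (2 * (M * |y|) * (M * 1)) := by
            gcongr ?_ * (2 * ?_ * ?_)
            · exact hcn y
            · exact hlin y
            · exact (hM' y).trans (mul_le_mul_of_nonneg_left (pow_le_one₀ hc.le (slopeRadius_le_one y)) hM0)
        _ = _ := by ring
    · refine integrable_of_le_slopeRadius (C := M ^ 2) (Measurable.div (by fun_prop)
        (measurable_id.pow_const 2)).aestronglyMeasurable fun y => ?_
      have hc := slopeRadius_pos y
      rw [abs_of_nonneg (by positivity)]
      refine div_le_of_le_mul₀ (by positivity) (by positivity) ?_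
      calc slopeRadius y ^ n * G y ^ 2 ≤ slopeRadius y ^ 3 * (M * |y|) ^ 2 := by
            gcongr ?_ * ?_
            · exact hcn y
            · exact sq_le_sq_of_abs_le (hlin y)
        _ = _ := by rw [mul_pow, sq_abs]; ring
  have hbd : ∀ y, |slopeRadius y ^ n * G y ^ 2 / y| ≤ M ^ 2 * |y| := fun y => by
    have hc := slopeRadius_pos y
    rw [abs_div, abs_of_nonneg (a := slopeRadius y ^ n * G y ^ 2) (by positivity)]
    refine div_le_of_le_mul₀ (abs_nonneg _) (by positivity) ?_
    calc slopeRadius y ^ n * G y ^ 2 ≤ 1 * (M * |y|) ^ 2 := by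
          gcongr ?_ * ?_
          · exact pow_le_one₀ hc.le (slopeRadius_le_one y)
          · exact sq_le_sq_of_abs_le (hlin y)
      _ = _ := by ring
  -- The convention `a/0 = 0` agrees with the limit, as the quotient is `O(|y|)`.
  have hcont : ContinuousWithinAt (fun y => slopeRadius y ^ n * G y ^ 2 / y) (Ici 0) 0 := by
    refine ContinuousAt.continuousWithinAt ?_
    rw [ContinuousAt]
    simp only [div_zero]
    refine squeeze_zero_norm hbd ?_
    have : Continuous fun y : ℝ => M ^ 2 * |y| := by fun_prop
    simpa using this.tendsto 0
  have hlim : Tendsto (fun y => slopeRadius y ^ n * G y ^ 2 / y) atTop (𝓝 0) := by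
    have hb : Tendsto (fun y : ℝ => M ^ 2 / |y|) atTop (𝓝 0) :=
      tendsto_const_nhds.div_atTop tendsto_abs_atTop_atTop
    refine squeeze_zero_norm (fun y => ?_) hb
    have hc := slopeRadius_pos y
    rw [Real.norm_eq_abs, abs_div, abs_of_nonneg (a := slopeRadius y ^ n * G y ^ 2) (by positivity)]
    gcongr
    calc slopeRadius y ^ n * G y ^ 2 ≤ 1 * M ^ 2 := by
          gcongr ?_ * ?_
          · exact pow_le_one₀ hc.le (slopeRadius_le_one y)
          · exact hGsq y
      _ = _ := one_mul _
  have hBint := integral_Ioi_of_hasDerivAt_of_tendsto hcont hB iB.integrableOn hlim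
  have hnn : 0 ≤ ∫ y in Ioi (0 : ℝ), (slopeRadius y ^ (n + 4) * ((1 + y ^ 2) * G' y) ^ 2 -
      slopeRadius y ^ (n + 4) * G y ^ 2 - B' y) := by
    refine setIntegral_nonneg measurableSet_Ioi fun y hy => ?_
    rw [hid y hy]
    have := slopeRadius_pos y
    positivity
  have i4 : Integrable (fun y => slopeRadius y ^ (n + 4) * ((1 + y ^ 2) * G' y) ^ 2 -
      slopeRadius y ^ (n + 4) * G y ^ 2) := i3.sub i1
  rw [integral_sub i4.integrableOn iB.integrableOn,
    integral_sub i3.integrableOn i1.integrableOn, hBint] at hnn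
  simp only [div_zero, sub_zero] at hnn
  linarith

/-- A Poincaré inequality with the deviation from the value at slope `0`. -/
lemma slope_poincare (hn : 3 ≤ n) {G G' : ℝ → ℝ} {M : ℝ} (hG : ∀ y, HasDerivAt G (G' y) y)
    (hG'm : Measurable G') (h0 : G 0 = 0) (hM : ∀ y, |G y| ≤ M)
    (hM' : ∀ y, |G' y| ≤ M * slopeRadius y ^ 3) :
    ∫ y, slopeRadius y ^ (n + 4) * G y ^ 2 ≤
      ∫ y, slopeRadius y ^ (n + 4) * ((1 + y ^ 2) * G' y) ^ 2 := by
  have hGc : Continuous G := continuous_iff_continuousAt.2 fun y => (hG y).continuousAt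
  obtain ⟨i1, i3⟩ := integrable_slope_sq hn hGc hG'm hM hM'
  have h1 := slope_poincare_Ioi hn hG hG'm h0 hM hM'
  -- The negative half line is handled by the reflection `y ↦ -y`, under which the weight is even.
  have h2 := slope_poincare_Ioi hn (G := fun y => G (-y)) (G' := fun y => -G' (-y)) (M := M)
    (fun y => by simpa [Function.comp_def] using (hG (-y)).scomp y (hasDerivAt_neg y)) (by fun_prop) (by simpa using h0)
    (fun y => hM _) (fun y => by simpa [slopeRadius_neg] using hM' (-y))
  have e1 := integral_comp_neg_Ioi 0 fun y => slopeRadius y ^ (n + 4) * G y ^ 2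
  have e2 := integral_comp_neg_Ioi 0 fun y => slopeRadius y ^ (n + 4) * ((1 + y ^ 2) * G' y) ^ 2
  simp only [slopeRadius_neg, neg_sq, neg_zero, mul_neg] at h2 e1 e2
  rw [e1, e2] at h2
  rw [← intervalIntegral.integral_Iic_add_Ioi i1.integrableOn i1.integrableOn,
    ← intervalIntegral.integral_Iic_add_Ioi (b := (0 : ℝ)) i3.integrableOn i3.integrableOn]
  exact add_le_add h2 h1

/-! ### Families of functions of the slope variable -/

section Family

variable {Ξ : Type*} [MeasurableSpace Ξ] {ν : Measure Ξ} [IsFiniteMeasure ν]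

lemma integrable_prod_of_le_slopeRadius {H : ℝ → Ξ → ℝ} {C : ℝ}
    (hm : Measurable (Function.uncurry H)) (h : ∀ y ξ, |H y ξ| ≤ C * slopeRadius y ^ 3) :
    Integrable (Function.uncurry H) (volume.prod ν) :=
  (((integrable_slopeRadius_pow le_rfl).const_mul C).comp_fst ν).mono' hm.aestronglyMeasurable
    (ae_of_all _ fun z => h z.1 z.2)

/-- Bias-variance decomposition: `g - a` is orthogonal to constants. -/
lemma integral_sub_sq_eq {g : Ξ → ℝ} {a : ℝ} (hg : Integrable g ν)
    (hg2 : Integrable (fun ξ => g ξ ^ 2) ν) (ha : ∫ ξ, g ξ ∂ν = ν.real univ * a) (m : ℝ) :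
    ∫ ξ, (g ξ - m) ^ 2 ∂ν = ν.real univ * (a - m) ^ 2 + ∫ ξ, (g ξ - a) ^ 2 ∂ν := by
  have key : ∀ r : ℝ, ∫ ξ, (g ξ - r) ^ 2 ∂ν =
      ∫ ξ, g ξ ^ 2 ∂ν - 2 * r * (ν.real univ * a) + ν.real univ * r ^ 2 := fun r => by
    have e : ∀ ξ, (g ξ - r) ^ 2 = g ξ ^ 2 - 2 * r * g ξ + r ^ 2 := fun ξ => by ring
    have i1 : Integrable (fun ξ => g ξ ^ 2 - 2 * r * g ξ) ν := hg2.sub (hg.const_mul _)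
    simp only [e]
    rw [integral_add i1 (integrable_const _), integral_sub hg2 (hg.const_mul _),
      integral_const_mul, ha, integral_const, smul_eq_mul]
  rw [key, key]
  ring

lemma integrable_family_sq {k : ℕ} (hk : 3 ≤ k) {w : ℝ → Ξ → ℝ} {M : ℝ}
    (hm : Measurable (Function.uncurry w)) (hM : ∀ y ξ, |w y ξ| ≤ M) :
    Integrable (Function.uncurry fun y ξ => slopeRadius y ^ k * w y ξ ^ 2) (volume.prod ν) :=
  integrable_prod_of_le_slopeRadius
    (((continuous_slopeRadius.measurable.comp measurable_fst).pow_const _).mul (hm.pow_const 2))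
    fun y ξ => abs_slope_pow_mul_sq_le hk (hM y ξ) y

lemma integrable_family_deriv_sq (hn : 3 ≤ n) {w : ℝ → Ξ → ℝ} {M : ℝ}
    (hm : Measurable (Function.uncurry w)) (hM : ∀ y ξ, |w y ξ| ≤ M * slopeRadius y ^ 3) :
    Integrable (Function.uncurry fun y ξ => slopeRadius y ^ (n + 4) * ((1 + y ^ 2) * w y ξ) ^ 2)
      (volume.prod ν) :=
  integrable_prod_of_le_slopeRadius
    (((continuous_slopeRadius.measurable.comp measurable_fst).pow_const _).mul
      ((Measurable.mul (by fun_prop) hm).pow_const 2))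
    fun y ξ => abs_slope_pow_mul_deriv_sq_le hn (hM y ξ)

/-- Fubini and `slope_hardy` for each parameter. -/
lemma slope_hardy_family (hn : 3 ≤ n) {w w' : ℝ → Ξ → ℝ} {M : ℝ}
    (hw : ∀ ξ y, HasDerivAt (fun y => w y ξ) (w' y ξ) y) (hm : Measurable (Function.uncurry w))
    (hm' : Measurable (Function.uncurry w')) (hM : ∀ y ξ, |w y ξ| ≤ M)
    (hM' : ∀ y ξ, |w' y ξ| ≤ M * slopeRadius y ^ 3) :
    ((n : ℝ) + 1) * ∫ y, ∫ ξ, slopeRadius y ^ (n + 4) * w y ξ ^ 2 ∂ν ≤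
      ∫ y, ∫ ξ, (4 * (slopeRadius y ^ (n + 4) * ((1 + y ^ 2) * w' y ξ) ^ 2) +
        ((n : ℝ) - 1) * (slopeRadius y ^ n * w y ξ ^ 2)) ∂ν := by
  have i1 := integrable_family_sq (ν := ν) (by omega : 3 ≤ n + 4) hm hM
  have i2 := integrable_family_sq (ν := ν) hn hm hM
  have i3 := integrable_family_deriv_sq (ν := ν) hn hm' hM'
  have i4 : Integrable (Function.uncurry fun y ξ =>
      4 * (slopeRadius y ^ (n + 4) * ((1 + y ^ 2) * w' y ξ) ^ 2) +
        ((n : ℝ) - 1) * (slopeRadius y ^ n * w y ξ ^ 2)) (volume.prod ν) :=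
    (i3.const_mul 4).add (i2.const_mul _)
  rw [integral_integral_swap i1, integral_integral_swap i4, ← integral_const_mul]
  refine integral_mono ((i1.integral_prod_right).const_mul _) i4.integral_prod_right fun ξ => ?_
  exact slope_hardy hn (hw ξ) (hm'.comp (by fun_prop : Measurable fun y : ℝ => (y, ξ)))
    (fun y => hM y ξ) (fun y => hM' y ξ)

/-- The Poincaré inequality for families, relative to the average over the family at slope `0`. -/
lemma slope_poincare_family (hn : 3 ≤ n) (hν : ν.real univ ≠ 0) {G G' : ℝ → Ξ → ℝ} {v : ℝ → ℝ}
    {M : ℝ} (hG : ∀ ξ y, HasDerivAt (fun y => G y ξ) (G' y ξ) y)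
    (hm : Measurable (Function.uncurry G)) (hm' : Measurable (Function.uncurry G'))
    (hM : ∀ y ξ, |G y ξ| ≤ M) (hM' : ∀ y ξ, |G' y ξ| ≤ M * slopeRadius y ^ 3)
    (hv : ∀ y, ∫ ξ, G y ξ ∂ν = ν.real univ * v y) :
    4 * ∫ y, slopeRadius y ^ (n + 4) * ∫ ξ, (G y ξ - v 0) ^ 2 ∂ν ≤
      ∫ y, (4 * (slopeRadius y ^ (n + 4) * ∫ ξ, ((1 + y ^ 2) * G' y ξ) ^ 2 ∂ν) +
        ((n : ℝ) - 1) * (slopeRadius y ^ n * ∫ ξ, (G y ξ - v y) ^ 2 ∂ν)) := by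
  set σ := ν.real univ with hσ
  have hσ0 : 0 < σ := lt_of_le_of_ne measureReal_nonneg hν.symm
  have hc := slopeRadius_pos
  obtain ⟨ξ₀⟩ : Nonempty Ξ := by
    by_contra h
    have := not_nonempty_iff.1 h
    exact hν (by rw [hσ, Subsingleton.elim univ (∅ : Set Ξ)]; simp)
  have hM0 : 0 ≤ M := (abs_nonneg _).trans (hM 0 ξ₀)
  have hGy : ∀ y, Measurable (G y) := fun y => hm.comp (by fun_prop : Measurable fun ξ => (y, ξ))
  have hGy' : ∀ y, Measurable (G' y) := fun y => hm'.comp (by fun_prop : Measurable fun ξ => (y, ξ))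
  have hM1 : ∀ y ξ, |G' y ξ| ≤ M := fun y ξ => (hM' y ξ).trans
    (mul_le_of_le_one_right hM0 (pow_le_one₀ (hc y).le (slopeRadius_le_one y)))
  have iG : ∀ y, Integrable (G y) ν := fun y =>
    Integrable.of_bound (hGy y).aestronglyMeasurable M (ae_of_all _ (hM y))
  have iG' : ∀ y, Integrable (G' y) ν := fun y =>
    Integrable.of_bound (hGy' y).aestronglyMeasurable M (ae_of_all _ (hM1 y))
  have iG2 : ∀ y, Integrable (fun ξ => G y ξ ^ 2) ν := fun y =>
    Integrable.of_bound ((hGy y).pow_const 2).aestronglyMeasurable (M ^ 2)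
      (ae_of_all _ fun ξ => by simpa using sq_le_sq_of_abs_le (hM y ξ))
  have iG2' : ∀ y, Integrable (fun ξ => G' y ξ ^ 2) ν := fun y =>
    Integrable.of_bound ((hGy' y).pow_const 2).aestronglyMeasurable (M ^ 2)
      (ae_of_all _ fun ξ => by simpa using sq_le_sq_of_abs_le (hM1 y ξ))
  -- the average and its derivative
  have hv1 : v = fun y => σ⁻¹ * ∫ ξ, G y ξ ∂ν := by
    ext y; rw [hv]; field_simp
  let v' : ℝ → ℝ := fun y => σ⁻¹ * ∫ ξ, G' y ξ ∂ν
  have hv' : ∀ y, ∫ ξ, G' y ξ ∂ν = σ * v' y := fun y => by simp only [v']; field_simp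
  have hvd : ∀ y, HasDerivAt v (v' y) y := fun y => by
    rw [hv1]
    refine HasDerivAt.const_mul _ ?_
    exact (hasDerivAt_integral_of_dominated_loc_of_deriv_le (bound := fun _ => M)
      (s := univ) univ_mem
      (Eventually.of_forall fun y => (hGy y).aestronglyMeasurable) (iG y)
      (hGy' y).aestronglyMeasurable (ae_of_all _ fun ξ y _ => hM1 y ξ) (integrable_const _)
      (ae_of_all _ fun ξ y _ => hG ξ y)).2
  have habs : ∀ {g : Ξ → ℝ} {a C : ℝ}, Measurable g → (∀ ξ, |g ξ| ≤ C) →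
      ∫ ξ, g ξ ∂ν = σ * a → |a| ≤ C := fun {g a C} _ hC ha => by
    have h1 : ‖∫ ξ, g ξ ∂ν‖ ≤ C * σ := norm_integral_le_of_norm_le_const (ae_of_all _ hC)
    rw [ha, Real.norm_eq_abs, abs_mul, abs_of_pos hσ0, mul_comm] at h1
    exact le_of_mul_le_mul_right h1 hσ0
  have hvM : ∀ y, |v y| ≤ M := fun y => habs (hGy y) (hM y) (hv y)
  have hvM' : ∀ y, |v' y| ≤ M * slopeRadius y ^ 3 := fun y => habs (hGy' y) (hM' y) (hv' y)
  have hvc : Continuous v := continuous_iff_continuousAt.2 fun y => (hvd y).continuousAt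
  have hvm' : Measurable v' :=
    (hm'.stronglyMeasurable.integral_prod_right (ν := ν)).measurable.const_mul _
  -- the oscillation
  let w : ℝ → Ξ → ℝ := fun y ξ => G y ξ - v y
  let w' : ℝ → Ξ → ℝ := fun y ξ => G' y ξ - v' y
  have hwm : Measurable (Function.uncurry w) := hm.sub (hvc.measurable.comp measurable_fst)
  have hwm' : Measurable (Function.uncurry w') := hm'.sub (hvm'.comp measurable_fst)
  have hwM : ∀ y ξ, |w y ξ| ≤ 2 * M := fun y ξ =>
    (abs_sub _ _).trans (by linarith [hM y ξ, hvM y])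
  have hwM' : ∀ y ξ, |w' y ξ| ≤ 2 * M * slopeRadius y ^ 3 := fun y ξ =>
    (abs_sub _ _).trans (by linarith [hM' y ξ, hvM' y])
  have hH := slope_hardy_family (ν := ν) (w := w) (w' := w') hn (fun ξ y => (hG ξ y).sub (hvd y)) hwm hwm' hwM hwM'
  have hP := slope_poincare hn (G := fun y => v y - v 0) (fun y => (hvd y).sub_const _) hvm'
    (sub_self _) (M := 2 * M) (fun y => (abs_sub _ _).trans (by linarith [hvM y, hvM 0]))
    (fun y => (hvM' y).trans (mul_le_mul_of_nonneg_right (by linarith) (by have := hc y; positivity)))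
  obtain ⟨j1, j3⟩ := integrable_slope_sq hn (G := fun y => v y - v 0) (hvc.sub continuous_const) hvm'
    (M := 2 * M) (fun y => (abs_sub _ _).trans (by linarith [hvM y, hvM 0]))
    (fun y => (hvM' y).trans (mul_le_mul_of_nonneg_right (by linarith) (by have := hc y; positivity)))
  have i1 : Integrable (fun y => slopeRadius y ^ (n + 4) * ∫ ξ, w y ξ ^ 2 ∂ν) := by
    have := (integrable_family_sq (ν := ν) (by omega : 3 ≤ n + 4) hwm hwM).integral_prod_left
    simpa only [Function.uncurry, integral_const_mul] using this
  have i2 : Integrable (fun y => slopeRadius y ^ n * ∫ ξ, w y ξ ^ 2 ∂ν) := by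
    have := (integrable_family_sq (ν := ν) hn hwm hwM).integral_prod_left
    simpa only [Function.uncurry, integral_const_mul] using this
  have i3 : Integrable (fun y => slopeRadius y ^ (n + 4) * ∫ ξ, ((1 + y ^ 2) * w' y ξ) ^ 2 ∂ν) := by
    have := (integrable_family_deriv_sq (ν := ν) hn hwm' hwM').integral_prod_left
    simpa only [Function.uncurry, integral_const_mul] using this
  -- The oscillation has zero mean, so `G - v(0)` splits orthogonally into the average part `v -
  -- v(0)` and `w`; likewise for the derivatives below.
  have e1 : ∀ y, slopeRadius y ^ (n + 4) * ∫ ξ, (G y ξ - v 0) ^ 2 ∂ν =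
      σ * (slopeRadius y ^ (n + 4) * (v y - v 0) ^ 2) +
        slopeRadius y ^ (n + 4) * ∫ ξ, w y ξ ^ 2 ∂ν := fun y => by
    rw [integral_sub_sq_eq (iG y) (iG2 y) (hv y)]; ring
  have e2 : ∀ y, slopeRadius y ^ (n + 4) * ∫ ξ, ((1 + y ^ 2) * G' y ξ) ^ 2 ∂ν =
      σ * (slopeRadius y ^ (n + 4) * ((1 + y ^ 2) * v' y) ^ 2) +
        slopeRadius y ^ (n + 4) * ∫ ξ, ((1 + y ^ 2) * w' y ξ) ^ 2 ∂ν := fun y => by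
    have := integral_sub_sq_eq (iG' y) (iG2' y) (hv' y) 0
    simp only [sub_zero] at this
    simp only [mul_pow, integral_const_mul]
    rw [this]; ring
  have hH2 : ((n : ℝ) + 1) * ∫ y, slopeRadius y ^ (n + 4) * ∫ ξ, w y ξ ^ 2 ∂ν ≤
      4 * (∫ y, slopeRadius y ^ (n + 4) * ∫ ξ, ((1 + y ^ 2) * w' y ξ) ^ 2 ∂ν) +
        ((n : ℝ) - 1) * ∫ y, slopeRadius y ^ n * ∫ ξ, w y ξ ^ 2 ∂ν := by
    rw [← integral_const_mul 4, ← integral_const_mul ((n : ℝ) - 1),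
      ← integral_add (i3.const_mul _) (i2.const_mul _)]
    simp only [integral_const_mul] at hH
    refine hH.trans (le_of_eq (integral_congr_ae (ae_of_all _ fun y => ?_)))
    have k1 : Integrable (fun ξ => w y ξ ^ 2) ν :=
      Integrable.of_bound ((hwm.comp (by fun_prop : Measurable fun ξ => (y, ξ))).pow_const
        2).aestronglyMeasurable ((2 * M) ^ 2)
        (ae_of_all _ fun ξ => by simpa using sq_le_sq_of_abs_le (hwM y ξ))
    have k2 : Integrable (fun ξ => w' y ξ ^ 2) ν :=
      Integrable.of_bound ((hwm'.comp (by fun_prop : Measurable fun ξ => (y, ξ))).pow_const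
        2).aestronglyMeasurable ((2 * M * slopeRadius y ^ 3) ^ 2)
        (ae_of_all _ fun ξ => by simpa using sq_le_sq_of_abs_le (hwM' y ξ))
    simp only [mul_pow]
    have k3 : Integrable (fun ξ => 4 * (slopeRadius y ^ (n + 4) * ((1 + y ^ 2) ^ 2 * w' y ξ ^ 2))) ν :=
      ((k2.const_mul _).const_mul _).const_mul _
    have k4 : Integrable (fun ξ => ((n : ℝ) - 1) * (slopeRadius y ^ n * w y ξ ^ 2)) ν :=
      (k1.const_mul _).const_mul _
    rw [integral_add k3 k4]
    simp only [integral_const_mul]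
  have hW0 : 0 ≤ ∫ y, slopeRadius y ^ (n + 4) * ∫ ξ, w y ξ ^ 2 ∂ν := integral_nonneg fun y =>
    mul_nonneg (pow_nonneg (hc y).le _) (integral_nonneg fun ξ => sq_nonneg _)
  have i5 : Integrable fun y => 4 * (σ * (slopeRadius y ^ (n + 4) * ((1 + y ^ 2) * v' y) ^ 2) +
      slopeRadius y ^ (n + 4) * ∫ ξ, ((1 + y ^ 2) * w' y ξ) ^ 2 ∂ν) :=
    ((j3.const_mul σ).add i3).const_mul _
  simp only [e1, e2]
  rw [integral_add (j1.const_mul _) i1, integral_add i5 (i2.const_mul _), integral_const_mul,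
    integral_const_mul, integral_const_mul, integral_add (j3.const_mul _) i3, integral_const_mul]
  -- The oscillation satisfies the bound because its Hardy constant `n+1` is at least 4; the average
  -- satisfies it by four times `slope_poincare`.
  have hn3 : (3 : ℝ) ≤ n := by exact_mod_cast hn
  have hP2 := mul_le_mul_of_nonneg_left hP hσ0.le
  nlinarith

end Family

/-! ### The Poincaré inequality on the unit `ϱ`-sphere -/

lemma surf_real_univ_ne_zero (hn : 1 ≤ n) : (surf n).real univ ≠ 0 := by
  have : Nonempty (Fin n) := ⟨⟨0, hn⟩⟩
  rw [measureReal_ne_zero_iff, surf, Measure.toSphere_apply_univ]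
  refine mul_ne_zero ?_ (Metric.measure_ball_pos _ _ one_pos).ne'
  simp; omega

lemma isFiniteMeasure_slopeMeasure {k : ℕ} (hk : 3 ≤ k) : IsFiniteMeasure (slopeMeasure k) :=
  isFiniteMeasure_withDensity_ofReal ((integrable_slopeRadius_pow hk).div_const 2).2

lemma integral_slopeMeasure (k : ℕ) (h : ℝ → ℝ) :
    ∫ y, h y ∂slopeMeasure k = ∫ y, slopeRadius y ^ k / 2 * h y := by
  have hcm := continuous_slopeRadius.measurable
  rw [slopeMeasure, integral_withDensity_eq_integral_toReal_smul (by fun_prop) (by simp)]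
  refine integral_congr_ae (ae_of_all _ fun y => ?_)
  have := slopeRadius_pos y
  simp only [smul_eq_mul]
  rw [ENNReal.toReal_ofReal (by positivity)]

lemma integrable_slopeMeasure {k : ℕ} {h : ℝ → ℝ} (hh : Integrable h (slopeMeasure k)) :
    Integrable fun y => slopeRadius y ^ k / 2 * h y := by
  have hcm := continuous_slopeRadius.measurable
  rw [slopeMeasure, integrable_withDensity_iff_integrable_smul' (by fun_prop) (by simp)] at hh
  refine hh.congr (ae_of_all _ fun y => ?_)
  have := slopeRadius_pos y
  simp only [smul_eq_mul]
  rw [ENNReal.toReal_ofReal (by positivity)]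

lemma isFiniteMeasure_angular (hn : 1 ≤ n) : IsFiniteMeasure (angular n) := by
  have := isFiniteMeasure_slopeMeasure (k := n + 2) (by omega)
  unfold angular; infer_instance

lemma norm_unitPoint_le (θ : ℝ × Sph n) : ‖unitPoint θ‖ ≤ 1 := by
  have h1 := slopeRadius_sq_mul_abs_le θ.1
  have h2 := slopeRadius_pos θ.1
  refine (Prod.norm_def _).trans_le (max_le ?_ ?_)
  · rw [norm_unitPoint_fst]; exact slopeRadius_le_one _
  · simp only [unitPoint, Real.norm_eq_abs, abs_div, abs_mul, abs_two, abs_of_pos (pow_pos h2 2)]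
    linarith

lemma exists_bound_unitPoint {E : Type*} [NormedAddCommGroup E] {F : Space n → E}
    (hF : Continuous F) : ∃ M, ∀ θ, ‖F (unitPoint θ)‖ ≤ M := by
  obtain ⟨M, hM⟩ := (isCompact_closedBall (0 : Space n) 1).exists_bound_of_continuousOn
    hF.continuousOn
  exact ⟨M, fun θ => hM _ (by simpa using norm_unitPoint_le θ)⟩

lemma integrable_angular (hn : 1 ≤ n) {F : Space n → ℝ} (hF : Continuous F) :
    Integrable (fun θ => F (unitPoint θ)) (angular n) := by
  have := isFiniteMeasure_angular hn
  obtain ⟨M, hM⟩ := exists_bound_unitPoint hF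
  exact Integrable.of_bound (hF.comp continuous_unitPoint).aestronglyMeasurable M (ae_of_all _ hM)

lemma integral_angular (hn : 1 ≤ n) {F : Space n → ℝ} (hF : Continuous F) :
    ∫ θ, F (unitPoint θ) ∂angular n =
      ∫ y, slopeRadius y ^ (n + 2) / 2 * ∫ ξ, F (unitPoint (y, ξ)) ∂surf n := by
  rw [← integral_slopeMeasure, angular, integral_prod _ (integrable_angular hn hF)]

/-- The gradient in the `x`-variables. -/
def gradX (f : Space n → ℝ) (p : Space n) : Euc n := WithLp.toLp 2 fun i => dX i f p

lemma inner_gradX (f : Space n → ℝ) (p : Space n) (v : Euc n) :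
    inner ℝ (gradX f p) v = fderiv ℝ f p (v, 0) := by
  rw [fderiv_apply_eq, PiLp.inner_apply]
  simp [gradX]

lemma norm_gradX_sq (f : Space n → ℝ) (p : Space n) : ‖gradX f p‖ ^ 2 = ∑ i, dX i f p ^ 2 :=
  (sum_coord_sq _).symm

lemma continuous_dX {f : Space n → ℝ} (hf : ContDiff ℝ 1 f) (i : Fin n) : Continuous (dX i f) :=
  (hf.continuous_fderiv one_ne_zero).clm_apply continuous_const

lemma continuous_dT {f : Space n → ℝ} (hf : ContDiff ℝ 1 f) : Continuous (dT f) :=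
  (hf.continuous_fderiv one_ne_zero).clm_apply continuous_const

lemma continuous_gradX {f : Space n → ℝ} (hf : ContDiff ℝ 1 f) : Continuous (gradX f) :=
  (PiLp.continuous_toLp 2 _).comp (continuous_pi fun i => continuous_dX hf i)

lemma continuous_gradSq {f : Space n → ℝ} (hf : ContDiff ℝ 1 f) : Continuous (gradSq f) :=
  (continuous_finsetSum _ fun i _ => (continuous_dX hf i).pow 2).add
    ((continuous_fst.norm.mul (continuous_dT hf)).pow 2)

lemma hasDerivAt_unitPoint (ξ : Sph n) (y : ℝ) :
    HasDerivAt (fun y => unitPoint (y, ξ)) ((-(1 / 2) * y * slopeRadius y ^ 5) • (ξ : Euc n),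
      slopeRadius y ^ 6 / 2) y := by
  have h4 := slopeRadius_pow_four y
  refine ((hasDerivAt_slopeRadius y).smul_const (ξ : Euc n)).prodMk
    (((((hasDerivAt_slopeRadius_pow 2 y).mul (hasDerivAt_id y)).div_const 2).congr_deriv ?_))
  simp only [id]
  push_cast
  linear_combination (-(slopeRadius y ^ 2) / 2) * h4

/-- The angular derivatives of `f` at a point of the unit `ϱ`-sphere, in polar coordinates. -/
lemma gradSq_unitPoint (f : Space n → ℝ) (y : ℝ) (ξ : Sph n) :
    gradSq f (unitPoint (y, ξ)) - slopeRadius y ^ 2 * euler f (unitPoint (y, ξ)) ^ 2 =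
      (‖gradX f (unitPoint (y, ξ))‖ ^ 2 - inner ℝ (gradX f (unitPoint (y, ξ))) (ξ : Euc n) ^ 2) +
        4 * (slopeRadius y ^ 2 * ((1 + y ^ 2) * fderiv ℝ f (unitPoint (y, ξ))
          ((-(1 / 2) * y * slopeRadius y ^ 5) • (ξ : Euc n), slopeRadius y ^ 6 / 2)) ^ 2) := by
  have h4 := slopeRadius_pow_four y
  have hlin : ∀ a b : ℝ, fderiv ℝ f (unitPoint (y, ξ)) (a • (ξ : Euc n), b) =
      a * inner ℝ (gradX f (unitPoint (y, ξ))) (ξ : Euc n) + b * dT f (unitPoint (y, ξ)) := by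
    intro a b
    have : ((a • (ξ : Euc n), b) : Space n) = a • ((ξ : Euc n), (0 : ℝ)) + b • ((0 : Euc n), (1 : ℝ)) := by
      simp
    rw [this, map_add, map_smul, map_smul, inner_gradX, dT, smul_eq_mul, smul_eq_mul]
  have he : euler f (unitPoint (y, ξ)) = slopeRadius y *
      inner ℝ (gradX f (unitPoint (y, ξ))) (ξ : Euc n) +
        slopeRadius y ^ 2 * y * dT f (unitPoint (y, ξ)) := by
    rw [euler, ← show slopeRadius y • (ξ : Euc n) = (unitPoint (y, ξ)).1 from rfl, hlin]
    simp only [unitPoint]; ring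
  rw [he, hlin, gradSq, ← norm_gradX_sq, norm_unitPoint_fst]
  generalize inner ℝ (gradX f (unitPoint (y, ξ))) (ξ : Euc n) = β
  generalize dT f (unitPoint (y, ξ)) = τ
  set c := slopeRadius y
  linear_combination (-β ^ 2 - c ^ 2 * τ ^ 2) * h4 + (c ^ 2 * (- y ^ 2 * c ^ 2 * β ^ 2 * (1 + c ^ 4 * (1 + y ^ 2))
    + 2 * y * c ^ 3 * β * τ * (1 + c ^ 4 * (1 + y ^ 2)) - c ^ 4 * τ ^ 2 * (1 + c ^ 4 * (1 + y ^ 2)))) * h4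

/-- For fixed slope the sphere inequality converts the tangential gradient into `(n-1)∫(G-v)²`; the
slope direction is then `slope_poincare_family`. The reference value is the average at slope 0, a
plain mean over a Euclidean sphere, which suits the one-sided Hardy argument with zero value there.
-/
lemma slice_poincare (hn : 3 ≤ n) {f : Space n → ℝ} (hf : ContDiff ℝ 1 f) {m : ℝ}
    (hm : ∫ ξ : Sph n, f (ξ, 0) ∂surf n = (surf n).real univ * m) :
    4 * ∫ θ, ‖(unitPoint θ).1‖ ^ 2 * (f (unitPoint θ) - m) ^ 2 ∂angular n ≤
      ∫ θ, (gradSq f (unitPoint θ) - ‖(unitPoint θ).1‖ ^ 2 * euler f (unitPoint θ) ^ 2)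
        ∂angular n := by
  have hσ := surf_real_univ_ne_zero (n := n) (by omega)
  have hfd := hf.differentiable one_ne_zero
  have hfc := hf.continuous
  have hfc' := hf.continuous_fderiv one_ne_zero
  have hcc := continuous_slopeRadius
  let G : ℝ → Sph n → ℝ := fun y ξ => f (unitPoint (y, ξ))
  let G' : ℝ → Sph n → ℝ := fun y ξ => fderiv ℝ f (unitPoint (y, ξ))
    ((-(1 / 2) * y * slopeRadius y ^ 5) • (ξ : Euc n), slopeRadius y ^ 6 / 2)
  let v : ℝ → ℝ := fun y => ((surf n).real univ)⁻¹ * ∫ ξ, G y ξ ∂surf n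
  have hv : ∀ y, ∫ ξ, G y ξ ∂surf n = (surf n).real univ * v y := fun y => by
    simp only [v]; field_simp
  have hv0 : v 0 = m := by
    have h0 : ∀ ξ : Sph n, unitPoint (0, ξ) = ((ξ : Euc n), (0 : ℝ)) := fun ξ => by
      simp [unitPoint, slopeRadius]
    have := hv 0
    simp only [G, h0, hm] at this
    exact (mul_left_cancel₀ hσ this).symm
  have hG : ∀ ξ y, HasDerivAt (fun y => G y ξ) (G' y ξ) y := fun ξ y =>
    (hfd _).hasFDerivAt.comp_hasDerivAt y (hasDerivAt_unitPoint ξ y)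
  have hGc : Continuous (Function.uncurry G) := hfc.comp continuous_unitPoint
  have hdir : Continuous fun z : ℝ × Sph n => (((-(1 / 2) * z.1 * slopeRadius z.1 ^ 5) • (z.2 : Euc n),
      slopeRadius z.1 ^ 6 / 2) : Space n) := by fun_prop
  have hGc' : Continuous (Function.uncurry G') :=
    (hfc'.comp continuous_unitPoint).clm_apply hdir
  obtain ⟨M₁, hM₁⟩ := exists_bound_unitPoint hfc
  obtain ⟨M₂, hM₂⟩ := exists_bound_unitPoint hfc'
  have hM : ∀ y ξ, |G y ξ| ≤ max M₁ M₂ := fun y ξ => (hM₁ (y, ξ)).trans (le_max_left _ _)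
  -- The velocity of `unitPoint` in `y` has norm at most `c³`, by `c²|y| ≤ 1`.
  have hM' : ∀ y ξ, |G' y ξ| ≤ max M₁ M₂ * slopeRadius y ^ 3 := fun y ξ => by
    have hc := slopeRadius_pos y
    have h1 := slopeRadius_sq_mul_abs_le y
    have h2 := slopeRadius_le_one y
    refine (ContinuousLinearMap.le_opNorm _ _).trans (mul_le_mul ((hM₂ (y, ξ)).trans
      (le_max_right _ _)) ?_ (norm_nonneg _) ((norm_nonneg _).trans ((hM₂ (y, ξ)).trans
      (le_max_right _ _))))
    refine (Prod.norm_def _).trans_le (max_le ?_ ?_)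
    · rw [norm_smul, norm_sph, mul_one, Real.norm_eq_abs, abs_mul, abs_mul,
        abs_of_pos (pow_pos hc _), abs_neg, abs_of_pos (by norm_num : (0 : ℝ) < 1 / 2)]
      calc 1 / 2 * |y| * slopeRadius y ^ 5
          = 1 / 2 * ((slopeRadius y ^ 2 * |y|) * slopeRadius y ^ 3) := by ring
        _ ≤ 1 / 2 * (1 * slopeRadius y ^ 3) := by gcongr
        _ ≤ slopeRadius y ^ 3 := by linarith [pow_pos hc 3]
    · rw [Real.norm_eq_abs, abs_of_pos (by positivity)]
      have := slopeRadius_pow_le (by norm_num : 3 ≤ 6) y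
      linarith [pow_pos hc 6]
  have hfam := slope_poincare_family (ν := surf n) hn hσ hG hGc.measurable hGc'.measurable hM hM' hv
  rw [hv0] at hfam
  -- the sphere inequality on each slice
  have hsph : ∀ y, ((n : ℝ) - 1) * ∫ ξ, (G y ξ - v y) ^ 2 ∂surf n ≤
      slopeRadius y ^ 2 * ∫ ξ, (‖gradX f (unitPoint (y, ξ))‖ ^ 2 -
        inner ℝ (gradX f (unitPoint (y, ξ))) (ξ : Euc n) ^ 2) ∂surf n := fun y => by
    let a : Euc n → Space n := fun x => (slopeRadius y • x, slopeRadius y ^ 2 * y / 2)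
    have hac : Continuous a := by fun_prop
    have hgr : ∀ x, HasGradientAt (fun x => f (a x) - v y) (slopeRadius y • gradX f (a x)) x := by
      intro x
      have ha : HasFDerivAt a ((slopeRadius y • ContinuousLinearMap.id ℝ (Euc n)).prod 0) x :=
        ((hasFDerivAt_id x).const_smul (slopeRadius y)).prodMk (hasFDerivAt_const _ _)
      refine hasGradientAt_iff_hasFDerivAt.2
        ((((hfd (a x)).hasFDerivAt.comp x ha).sub_const _).congr_fderiv ?_)
      ext z
      have : ((slopeRadius y • z, (0 : ℝ)) : Space n) = slopeRadius y • (z, (0 : ℝ)) := by simp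
      change fderiv ℝ f (a x) (slopeRadius y • z, 0) = inner ℝ (slopeRadius y • gradX f (a x)) z
      rw [this, map_smul, inner_smul_left, inner_gradX]
      rfl
    have h := sphere_poincare (n := n) (by omega) hgr (((continuous_gradX hf).comp hac).const_smul (slopeRadius y) :) (by
      have i1 : Integrable (fun ξ : Sph n => f (a ξ)) (surf n) :=
        (hfc.comp (hac.comp continuous_subtype_val)).integrable_of_hasCompactSupport
          (HasCompactSupport.of_compactSpace _)
      rw [integral_sub i1 (integrable_const _), integral_const, smul_eq_mul]
      exact sub_eq_zero.2 (hv y))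
    refine h.trans (le_of_eq ?_)
    rw [← integral_const_mul]
    refine integral_congr_ae (ae_of_all _ fun ξ => ?_)
    simp only [norm_smul, inner_smul_left, Real.norm_eq_abs, mul_pow, sq_abs, a, unitPoint]
    simp
    ring
  rw [integral_angular (by omega) (F := fun p => ‖p.1‖ ^ 2 * (f p - m) ^ 2) (by fun_prop),
    integral_angular (by omega) (F := fun p => gradSq f p - ‖p.1‖ ^ 2 * euler f p ^ 2)
      ((continuous_gradSq hf).sub ((continuous_fst.norm.pow 2).mul ((continuous_euler hf).pow 2)))]
  have hR : Integrable fun y => slopeRadius y ^ (n + 2) / 2 * ∫ ξ,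
      (gradSq f (unitPoint (y, ξ)) - ‖(unitPoint (y, ξ)).1‖ ^ 2 * euler f (unitPoint (y, ξ)) ^ 2)
        ∂surf n := by
    have := integrable_angular (n := n) (by omega) (F := fun p => gradSq f p -
      ‖p.1‖ ^ 2 * euler f p ^ 2) ((continuous_gradSq hf).sub
        ((continuous_fst.norm.pow 2).mul ((continuous_euler hf).pow 2)))
    exact integrable_slopeMeasure (this.integral_prod_left)
  have hn3 : (3 : ℝ) ≤ n := by exact_mod_cast hn
  calc 4 * ∫ y, slopeRadius y ^ (n + 2) / 2 * ∫ ξ, ‖(unitPoint (y, ξ)).1‖ ^ 2 *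
        (f (unitPoint (y, ξ)) - m) ^ 2 ∂surf n
      = 1 / 2 * (4 * ∫ y, slopeRadius y ^ (n + 4) * ∫ ξ, (G y ξ - m) ^ 2 ∂surf n) := by
        rw [mul_left_comm]
        congr 1
        rw [← integral_const_mul]
        refine integral_congr_ae (ae_of_all _ fun y => ?_)
        simp only [norm_unitPoint_fst, integral_const_mul, G]
        ring
    _ ≤ 1 / 2 * ∫ y, (4 * (slopeRadius y ^ (n + 4) * ∫ ξ, ((1 + y ^ 2) * G' y ξ) ^ 2 ∂surf n) +
        ((n : ℝ) - 1) * (slopeRadius y ^ n * ∫ ξ, (G y ξ - v y) ^ 2 ∂surf n)) :=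
        mul_le_mul_of_nonneg_left hfam (by norm_num)
    _ ≤ _ := by
        rw [← integral_const_mul]
        refine integral_mono_of_nonneg (ae_of_all _ fun y => ?_) hR (ae_of_all _ fun y => ?_)
        · have hc := slopeRadius_pos y
          have h1 : 0 ≤ ∫ ξ, ((1 + y ^ 2) * G' y ξ) ^ 2 ∂surf n := integral_nonneg fun _ => sq_nonneg _
          have h2 : 0 ≤ ∫ ξ, (G y ξ - v y) ^ 2 ∂surf n := integral_nonneg fun _ => sq_nonneg _
          have h3 : (0 : ℝ) ≤ n - 1 := by linarith
          simp only [Pi.zero_apply]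
          positivity
        · have hc := slopeRadius_pos y
          have hu : Continuous fun ξ : Sph n => unitPoint (y, ξ) :=
            continuous_unitPoint.comp (by fun_prop)
          have hgX := (continuous_gradX hf).comp hu
          have i1 : Integrable (fun ξ : Sph n => ‖gradX f (unitPoint (y, ξ))‖ ^ 2 -
              inner ℝ (gradX f (unitPoint (y, ξ))) (ξ : Euc n) ^ 2) (surf n) :=
            ((hgX.norm.pow 2).sub ((hgX.inner continuous_subtype_val).pow
              2)).integrable_of_hasCompactSupport (HasCompactSupport.of_compactSpace _)
          have i2 : Integrable (fun ξ : Sph n => 4 * (slopeRadius y ^ 2 *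
              ((1 + y ^ 2) * G' y ξ) ^ 2)) (surf n) := by
            have : Continuous fun ξ : Sph n => G' y ξ :=
              hGc'.comp (f := fun ξ : Sph n => (y, ξ)) (by fun_prop)
            exact (((this.const_mul _).pow 2).const_mul _ |>.const_mul
              _).integrable_of_hasCompactSupport (HasCompactSupport.of_compactSpace _)
          simp only [norm_unitPoint_fst, gradSq_unitPoint]
          rw [integral_add i1 i2]
          simp only [integral_const_mul]
          -- The slice inequality carries `c²`; the remaining part of the angular weight `c^{n+2}`
          -- is `cⁿ`.
          have h5 := mul_le_mul_of_nonneg_left (hsph y) (pow_pos hc n).le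
          have e : slopeRadius y ^ (n + 2) = slopeRadius y ^ n * slopeRadius y ^ 2 := pow_add _ _ _
          have e' : slopeRadius y ^ (n + 4) = slopeRadius y ^ n * slopeRadius y ^ 4 := pow_add _ _ _
          rw [e, e']
          linarith

/-! ### Supports in `ϱ`-annuli -/

lemma norm_le_of_rho (p : Space n) : ‖p‖ ≤ rho p + rho p ^ 2 := by
  have h1 := norm_le_rho p
  have h2 := abs_le_rho_sq p
  have h3 := rho_nonneg p
  refine (Prod.norm_def _).trans_le (max_le ?_ ?_)
  · nlinarith
  · rw [Real.norm_eq_abs]; nlinarith [abs_nonneg p.2]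

lemma isCompact_rho_le (R : ℝ) : IsCompact {p : Space n | rho p ≤ R} := by
  refine Metric.isCompact_of_isClosed_isBounded (isClosed_le continuous_rho continuous_const)
    (isBounded_iff_forall_norm_le.2 ⟨R + R ^ 2, fun p hp => (norm_le_of_rho p).trans ?_⟩)
  have hp : rho p ≤ R := hp
  have := rho_nonneg p
  gcongr

lemma hasCompactSupport_of_rho {α : Type*} [Zero α] {F : Space n → α} {R : ℝ}
    (h : ∀ p, R < rho p → F p = 0) : HasCompactSupport F :=
  HasCompactSupport.intro (isCompact_rho_le R) fun p hp => h p (not_le.1 hp)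

lemma eventually_rho_lt {δ : ℝ} (hδ : 0 < δ) : ∀ᶠ p in 𝓝 (0 : Space n), rho p < δ :=
  continuous_rho.continuousAt.eventually_lt continuousAt_const (by simpa using hδ)

lemma suppOff_of_rho {α : Type*} [Zero α] {F : Space n → α} {δ R : ℝ} (hδ : 0 < δ)
    (h0 : ∀ p, rho p < δ → F p = 0) (h : ∀ p, R < rho p → F p = 0) : SuppOff F :=
  ⟨hasCompactSupport_of_rho h, notMem_tsupport_iff_eventuallyEq.2
    ((eventually_rho_lt hδ).mono h0)⟩

lemma exists_rho_of_eventually {P : Space n → Prop} (h : ∀ᶠ p in 𝓝 (0 : Space n), P p) :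
    ∃ δ > 0, ∀ p, rho p < δ → P p := by
  obtain ⟨ε, hε, hP⟩ := Metric.eventually_nhds_iff.1 h
  -- For `ϱ < 1` one has `ϱ + ϱ² ≤ 2ϱ`.
  refine ⟨min 1 (ε / 2), by positivity, fun p hp => hP ?_⟩
  have h1 := hp.trans_le (min_le_left _ _)
  have h2 := hp.trans_le (min_le_right _ _)
  have h3 := rho_nonneg p
  rw [dist_zero_right]
  refine (norm_le_of_rho p).trans_lt ?_
  nlinarith

lemma exists_rho_of_hasCompactSupport {α : Type*} [Zero α] {F : Space n → α}
    (h : HasCompactSupport F) : ∃ R, ∀ p, R < rho p → F p = 0 := by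
  obtain ⟨R, hR⟩ := h.isCompact.exists_bound_of_continuousOn (continuous_rho (n := n)).continuousOn
  refine ⟨R, fun p hp => image_eq_zero_of_notMem_tsupport fun hp' => ?_⟩
  exact absurd ((le_abs_self _).trans (hR p hp')) (not_le.2 hp)

lemma testFunctions_subset : testFunctions n ⊆ testFunctionsConst n := by
  rintro u ⟨h1, h2, h3⟩
  have h0 : ∀ᶠ p in 𝓝 (0 : Space n), u p = 0 :=
    notMem_tsupport_iff_eventuallyEq.1 fun h => h3 h rfl
  refine ⟨h1, h2, h0.mono fun p hp => ?_⟩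
  rw [hp, h0.self_of_nhds]

/-- Being constant near the origin is enough: all energies involve derivatives of `u` only. This is
why both classes of test functions are treated together. -/
lemma suppOff_fderiv {u : Space n → ℝ} (hu : u ∈ testFunctionsConst n) : SuppOff (fderiv ℝ u) := by
  obtain ⟨-, h2, h3⟩ := hu
  refine ⟨h2.fderiv ℝ, notMem_tsupport_iff_eventuallyEq.2 ?_⟩
  have : u =ᶠ[𝓝 0] fun _ => u 0 := h3
  refine this.fderiv.trans (Eventually.of_forall fun p => ?_)
  simp

/-! ### The bilinear form `⟨∇_G u, ∇_G v⟩` -/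

/-- Cauchy–Schwarz for the `n + 1` components of the Grushin gradient, indexed by `Fin n ⊕ Unit`. -/
lemma gradInner_sq_le (u v : Space n → ℝ) (p : Space n) :
    gradInner u v p ^ 2 ≤ gradSq u p * gradSq v p := by
  let a : Fin n ⊕ Unit → ℝ := Sum.elim (fun i => dX i u p) fun _ => ‖p.1‖ * dT u p
  let b : Fin n ⊕ Unit → ℝ := Sum.elim (fun i => dX i v p) fun _ => ‖p.1‖ * dT v p
  have h := Finset.sum_mul_sq_le_sq_mul_sq Finset.univ a b
  simp only [Fintype.sum_sum_type, a, b, Sum.elim_inl, Sum.elim_inr, Finset.univ_unique,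
    Finset.sum_singleton] at h
  refine le_trans (le_of_eq ?_) h
  simp only [gradInner]
  ring

lemma gradSq_nonneg (u : Space n → ℝ) (p : Space n) : 0 ≤ gradSq u p := by
  unfold gradSq; positivity

lemma gradInner_add_left {u v : Space n → ℝ} {p : Space n} (hu : DifferentiableAt ℝ u p)
    (hv : DifferentiableAt ℝ v p) (w : Space n → ℝ) :
    gradInner (fun p => u p + v p) w p = gradInner u w p + gradInner v w p := by
  simp only [gradInner, dX, dT, fderiv_fun_add hu hv, add_apply, add_mul,
    Finset.sum_add_distrib]
  ring

lemma gradInner_mul_left {u v : Space n → ℝ} {p : Space n} (hu : DifferentiableAt ℝ u p)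
    (hv : DifferentiableAt ℝ v p) (w : Space n → ℝ) :
    gradInner (fun p => u p * v p) w p = u p * gradInner v w p + v p * gradInner u w p := by
  simp only [gradInner, dX, dT, fderiv_fun_mul hu hv, add_apply,
    smul_apply, smul_eq_mul, add_mul, Finset.sum_add_distrib, mul_assoc,
    ← Finset.mul_sum]
  ring

lemma gradInner_const_mul_left {u : Space n → ℝ} {p : Space n} (c : ℝ)
    (hu : DifferentiableAt ℝ u p) (w : Space n → ℝ) :
    gradInner (fun p => c * u p) w p = c * gradInner u w p := by
  simp only [gradInner, dX, dT, fderiv_const_mul hu, smul_apply, smul_eq_mul,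
    mul_assoc, ← Finset.mul_sum]
  ring

/-- The radial derivative is bounded by the gradient. -/
lemma normSq_mul_euler_sq_le (u : Space n → ℝ) (p : Space n) :
    ‖p.1‖ ^ 2 * euler u p ^ 2 ≤ rho p ^ 4 * gradSq u p := by
  -- The vector `(|x|x, 2t)` has squared length `ϱ⁴`, and its product with `∇_G u` is `|x|Zu`.
  let a : Fin n ⊕ Unit → ℝ := Sum.elim (fun i => ‖p.1‖ * p.1 i) fun _ => 2 * p.2
  let b : Fin n ⊕ Unit → ℝ := Sum.elim (fun i => dX i u p) fun _ => ‖p.1‖ * dT u p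
  have h := Finset.sum_mul_sq_le_sq_mul_sq Finset.univ a b
  simp only [Fintype.sum_sum_type, a, b, Sum.elim_inl, Sum.elim_inr, Finset.univ_unique,
    Finset.sum_singleton, mul_pow, ← Finset.mul_sum, sum_coord_sq, mul_assoc] at h
  rw [rho_pow_four, gradSq, euler_eq]
  simp only [mul_pow]
  calc ‖p.1‖ ^ 2 * (∑ i, p.1 i * dX i u p + 2 * p.2 * dT u p) ^ 2
      = (‖p.1‖ * ∑ i, p.1 i * dX i u p + 2 * (p.2 * (‖p.1‖ * dT u p))) ^ 2 := by ring
    _ ≤ _ := h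
    _ = _ := by ring

/-! ### Radial functions -/

lemma hasFDerivAt_rho {p : Space n} (hp : p ≠ 0) :
    HasFDerivAt (rho : Space n → ℝ) (fderiv ℝ rho p) p :=
  ((contDiffOn_rho.contDiffAt (isOpen_compl_singleton.mem_nhds hp)).differentiableAt
    (by simp)).hasFDerivAt

lemma fderiv_comp_rho {U : ℝ → ℝ} {U' : ℝ} {p : Space n} (hp : p ≠ 0)
    (hU : HasDerivAt U U' (rho p)) :
    HasFDerivAt (fun p => U (rho p)) (U' • fderiv ℝ (rho : Space n → ℝ) p) p :=
  hU.comp_hasFDerivAt p (hasFDerivAt_rho hp)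

lemma euler_rho {p : Space n} (hp : p ≠ 0) : euler (rho : Space n → ℝ) p = rho p := by
  simpa using euler_rho_rpow 1 hp

lemma gradInner_rho {p : Space n} (hp : p ≠ 0) (u : Space n → ℝ) :
    gradInner (rho : Space n → ℝ) u p = rho p ^ (-3 : ℝ) * ‖p.1‖ ^ 2 * euler u p := by
  have := gradInner_rho_rpow 1 hp u
  norm_num at this
  simpa using this

lemma euler_comp_rho {U : ℝ → ℝ} {U' : ℝ} {p : Space n} (hp : p ≠ 0)
    (hU : HasDerivAt U U' (rho p)) : euler (fun p => U (rho p)) p = U' * rho p := by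
  rw [euler, (fderiv_comp_rho hp hU).fderiv, smul_apply, smul_eq_mul,
    ← euler, euler_rho hp]

lemma gradInner_comp_rho {U : ℝ → ℝ} {U' : ℝ} {p : Space n} (hp : p ≠ 0)
    (hU : HasDerivAt U U' (rho p)) (u : Space n → ℝ) :
    gradInner (fun p => U (rho p)) u p = U' * (rho p ^ (-3 : ℝ) * ‖p.1‖ ^ 2 * euler u p) := by
  rw [← gradInner_rho hp]
  simp only [gradInner, dX, dT, (fderiv_comp_rho hp hU).fderiv, smul_apply,
    smul_eq_mul, mul_add, Finset.mul_sum]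
  congr 1
  · exact Finset.sum_congr rfl fun i _ => by ring
  · ring

/-! ### The average over spheres in the hyperplane `t = 0` -/

/-- The average of `u` over the sphere of radius `r` in the hyperplane `t = 0`. -/
def sphAvg (u : Space n → ℝ) (r : ℝ) : ℝ :=
  ((surf n).real univ)⁻¹ * ∫ ξ : Sph n, u (r • (ξ : Euc n), 0) ∂surf n

/-- The derivative of `sphAvg u`. -/
def sphAvgDeriv (u : Space n → ℝ) (r : ℝ) : ℝ :=
  ((surf n).real univ)⁻¹ * ∫ ξ : Sph n, fderiv ℝ u (r • (ξ : Euc n), 0) ((ξ : Euc n), 0) ∂surf n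

lemma continuous_integral_surf {H : ℝ × Sph n → ℝ} (hH : Continuous H) :
    Continuous fun r => ∫ ξ, H (r, ξ) ∂surf n := by
  simpa using continuous_parametric_integral_of_continuous (μ := surf n) (s := univ)
    (f := fun r ξ => H (r, ξ)) hH isCompact_univ

lemma hasDerivAt_sphAvg {u : Space n → ℝ} (hu : ContDiff ℝ 1 u) (hs : HasCompactSupport u) (r : ℝ) :
    HasDerivAt (sphAvg u) (sphAvgDeriv u r) r := by
  have hc' := hu.continuous_fderiv one_ne_zero
  obtain ⟨M, hM⟩ := (hs.fderiv ℝ).exists_bound_of_continuous hc'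
  refine HasDerivAt.const_mul _ ?_
  have hF : ∀ r : ℝ, Continuous fun ξ : Sph n => u (r • (ξ : Euc n), 0) := fun r =>
    hu.continuous.comp (by fun_prop)
  have hF' : ∀ r : ℝ, Continuous fun ξ : Sph n => fderiv ℝ u (r • (ξ : Euc n), 0) ((ξ : Euc n), 0) :=
    fun r => (hc'.comp (by fun_prop)).clm_apply (by fun_prop)
  refine (hasDerivAt_integral_of_dominated_loc_of_deriv_le (bound := fun _ => M)
    (F' := fun r (ξ : Sph n) => fderiv ℝ u (r • (ξ : Euc n), 0) ((ξ : Euc n), 0))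
    (s := univ) univ_mem (Eventually.of_forall fun y => (hF y).aestronglyMeasurable)
    ((hF r).integrable_of_hasCompactSupport (HasCompactSupport.of_compactSpace _))
    (hF' r).aestronglyMeasurable (ae_of_all _ fun ξ y _ => ?_) (integrable_const _)
    (ae_of_all _ fun ξ y _ => ?_)).2
  · refine (ContinuousLinearMap.le_opNorm _ _).trans ?_
    have : ‖(((ξ : Euc n), (0 : ℝ)) : Space n)‖ = 1 := by simp [Prod.norm_def]
    rw [this, mul_one]
    exact hM _
  · have h1 : HasDerivAt (fun r : ℝ => ((r • (ξ : Euc n), (0 : ℝ)) : Space n)) ((ξ : Euc n), 0) y := by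
      have := ((hasDerivAt_id y).smul_const (ξ : Euc n)).prodMk (hasDerivAt_const y (0 : ℝ))
      simpa using this
    exact (hu.differentiable one_ne_zero _).hasFDerivAt.comp_hasDerivAt y h1

lemma contDiff_sphAvg {u : Space n → ℝ} (hu : ContDiff ℝ 1 u) (hs : HasCompactSupport u) :
    ContDiff ℝ 1 (sphAvg u) := by
  refine contDiff_one_iff_deriv.2 ⟨fun r => (hasDerivAt_sphAvg hu hs r).differentiableAt, ?_⟩
  have : deriv (sphAvg u) = sphAvgDeriv u := funext fun r => (hasDerivAt_sphAvg hu hs r).deriv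
  rw [this]
  refine continuous_const.mul (continuous_integral_surf (H := fun z : ℝ × Sph n =>
    fderiv ℝ u (z.1 • (z.2 : Euc n), 0) ((z.2 : Euc n), 0)) ?_)
  exact ((hu.continuous_fderiv one_ne_zero).comp (by fun_prop)).clm_apply (by fun_prop)

lemma rho_smul_sph {r : ℝ} (hr : 0 ≤ r) (ξ : Sph n) : rho ((r • (ξ : Euc n), 0) : Space n) = r := by
  have h : rho ((r • (ξ : Euc n), 0) : Space n) ^ 4 = r ^ 4 := by
    rw [rho_pow_four]
    simp [norm_smul, abs_of_nonneg hr]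
  exact (pow_left_inj₀ (rho_nonneg _) hr (by norm_num)).1 h

lemma sphAvg_eq_of_forall (hn : 1 ≤ n) {u : Space n → ℝ} {r a : ℝ} (hr : 0 ≤ r)
    (h : ∀ p, rho p = r → u p = a) : sphAvg u r = a := by
  have hσ := surf_real_univ_ne_zero hn
  simp only [sphAvg, h _ (rho_smul_sph hr _), integral_const, smul_eq_mul]
  field_simp

/-- Where `u` is constant on a whole `ϱ`-sphere the average equals that constant; this covers a
neighbourhood of the origin and the exterior of the support. -/
lemma suppOff_sub_sphAvg (hn : 1 ≤ n) {u : Space n → ℝ} (hu : u ∈ testFunctionsConst n) :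
    SuppOff fun p => u p - sphAvg u (rho p) := by
  obtain ⟨δ, hδ, h0⟩ := exists_rho_of_eventually hu.2.2
  obtain ⟨R, hR⟩ := exists_rho_of_hasCompactSupport hu.2.1
  refine suppOff_of_rho hδ (R := R) (fun p hp => ?_) fun p hp => ?_
  · rw [sphAvg_eq_of_forall hn (rho_nonneg p) fun q hq => h0 q (hq ▸ hp), h0 p hp, sub_self]
  · rw [sphAvg_eq_of_forall hn (rho_nonneg p) fun q hq => hR q (hq ▸ hp), hR p hp, sub_self]

/-- `ϱ` is not smooth at the origin, but the difference vanishes near it. -/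
lemma contDiff_sub_sphAvg (hn : 1 ≤ n) {u : Space n → ℝ} (hu : u ∈ testFunctionsConst n) :
    ContDiff ℝ 1 fun p => u p - sphAvg u (rho p) := by
  have hu1 : ContDiff ℝ 1 u := hu.1.of_le (by simp)
  refine contDiff_iff_contDiffAt.2 fun p => ?_
  by_cases hp : p = 0
  · subst hp
    exact (contDiffAt_const (c := (0 : ℝ))).congr_of_eventuallyEq
      (suppOff_sub_sphAvg hn hu).eventually_zero
  · exact hu1.contDiffAt.sub ((contDiff_sphAvg hu1 hu.2.1).contDiffAt.comp p
      ((contDiffOn_rho.contDiffAt (isOpen_compl_singleton.mem_nhds hp)).of_le (by simp)))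

/-! ### The Poincaré inequality for the deviation from the radial average -/

lemma ae_radialMeasure_pos (k : ℕ) : ∀ᵐ r ∂radialMeasure k, 0 < r :=
  (withDensity_absolutelyContinuous _ _).ae_le (ae_restrict_mem measurableSet_Ioi)

lemma fderiv_comp_dil {u : Space n → ℝ} (hu : Differentiable ℝ u) (r : ℝ) (p v : Space n) :
    fderiv ℝ (fun p => u (dil r p)) p v = fderiv ℝ u (dil r p) (dil r v) := by
  let A : Space n →L[ℝ] Space n := (r • ContinuousLinearMap.fst ℝ _ _).prod
    (r ^ 2 • ContinuousLinearMap.snd ℝ _ _)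
  have hA : ∀ p : Space n, dil r p = A p := fun p => by simp [A, dil]
  have h := (hu (dil r p)).hasFDerivAt
  rw [hA] at h ⊢
  have h2 : HasFDerivAt (fun p => u (dil r p)) ((fderiv ℝ u (A p)).comp A) p := by
    simp only [hA]
    exact h.comp p A.hasFDerivAt
  rw [h2.fderiv, hA]
  rfl

lemma euler_comp_dil {u : Space n → ℝ} (hu : Differentiable ℝ u) (r : ℝ) (p : Space n) :
    euler (fun p => u (dil r p)) p = euler u (dil r p) := by
  rw [euler, euler, fderiv_comp_dil hu]
  congr 1
  simp only [dil, Prod.mk.injEq, true_and]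
  ring

lemma gradSq_comp_dil {u : Space n → ℝ} (hu : Differentiable ℝ u) (r : ℝ) (p : Space n) :
    gradSq (fun p => u (dil r p)) p = r ^ 2 * gradSq u (dil r p) := by
  have h1 : ∀ i, dX i (fun p => u (dil r p)) p = r * dX i u (dil r p) := fun i => by
    rw [dX, dX, fderiv_comp_dil hu, ← smul_eq_mul, ← map_smul]
    congr 1
    simp [dil]
  have h2 : dT (fun p => u (dil r p)) p = r ^ 2 * dT u (dil r p) := by
    rw [dT, dT, fderiv_comp_dil hu, ← smul_eq_mul, ← map_smul]
    congr 1
    simp [dil]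
  have h3 : ‖(dil r p).1‖ ^ 2 = r ^ 2 * ‖p.1‖ ^ 2 := by simp [dil, norm_smul, mul_pow]
  simp only [gradSq, h1, h2, mul_pow, h3, mul_add, Finset.mul_sum]
  ring

lemma contDiff_dil (r : ℝ) : ContDiff ℝ ∞ (dil r : Space n → Space n) :=
  (contDiff_fst.const_smul r).prodMk (contDiff_const.mul contDiff_snd)

/-- The angular part of the Dirichlet integral controls the deviation from the average. -/
lemma bulk_poincare (hn : 3 ≤ n) {u : Space n → ℝ} (hu : u ∈ testFunctionsConst n) :
    4 * ∫ p, rho p ^ (-6 : ℝ) * (‖p.1‖ ^ 2 * (u p - sphAvg u (rho p)) ^ 2) ≤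
      (∫ p, rho p ^ (-2 : ℝ) * gradSq u p) - ∫ p, rho p ^ (-6 : ℝ) * (‖p.1‖ ^ 2 * euler u p ^ 2) := by
  have hn1 : 1 ≤ n := by omega
  have hu1 : ContDiff ℝ 1 u := hu.1.of_le (by simp)
  have hud := hu1.differentiable one_ne_zero
  have hsf := suppOff_fderiv hu
  have hF := suppOff_sub_sphAvg hn1 hu
  have hFc := (contDiff_sub_sphAvg hn1 hu).continuous
  have i1 : Integrable fun p : Space n => rho p ^ (-6 : ℝ) * (‖p.1‖ ^ 2 * (u p - sphAvg u (rho p)) ^ 2) :=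
    SuppOff.integrable_rho_rpow_mul (F := fun p => ‖p.1‖ ^ 2 * (u p - sphAvg u (rho p)) ^ 2)
      (hF.mono_zero fun p hp => by simp only [hp]; ring) (by fun_prop) _
  have i2 : Integrable fun p : Space n => rho p ^ (-2 : ℝ) * gradSq u p :=
    SuppOff.integrable_rho_rpow_mul (hsf.mono_zero fun p hp => by simp [gradSq, dX, dT, hp])
      (continuous_gradSq hu1) _
  have i3 : Integrable fun p : Space n => rho p ^ (-6 : ℝ) * (‖p.1‖ ^ 2 * euler u p ^ 2) :=
    SuppOff.integrable_rho_rpow_mul (F := fun p => ‖p.1‖ ^ 2 * euler u p ^ 2)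
      (hsf.mono_zero fun p hp => by simp [euler, hp])
      (by have := continuous_euler hu1; fun_prop) _
  have i4 : Integrable fun p : Space n => rho p ^ (-2 : ℝ) * gradSq u p -
      rho p ^ (-6 : ℝ) * (‖p.1‖ ^ 2 * euler u p ^ 2) := i2.sub i3
  rw [← integral_sub i2 i3, integral_polar hn1 i1, integral_polar hn1 i4, ← integral_const_mul]
  refine integral_mono_ae
    ((((integrable_polar hn1 i1.1).1 i1).integral_prod_left).const_mul _)
    (((integrable_polar hn1 i4.1).1 i4).integral_prod_left) ?_
  filter_upwards [ae_radialMeasure_pos (n + 1)] with r hr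
  have hf : ContDiff ℝ 1 fun p => u (dil r p) := hu1.comp ((contDiff_dil r).of_le (by simp))
  -- The inequality on the sphere `ϱ = r` is that on the unit sphere for the dilated function; the
  -- powers of `r` are restored below.
  have h := slice_poincare hn hf (m := sphAvg u r) (by
    have hσ := surf_real_univ_ne_zero hn1
    simp only [sphAvg, dil, mul_zero]
    field_simp)
  simp only [euler_comp_dil hud, gradSq_comp_dil hud] at h
  have h6 : r ^ (-6 : ℝ) * r ^ 2 = r ^ (-4 : ℝ) := by
    rw [← Real.rpow_natCast, ← Real.rpow_add hr]; norm_num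
  have h4 : r ^ (-4 : ℝ) * r ^ 2 = r ^ (-2 : ℝ) := by
    rw [← Real.rpow_natCast, ← Real.rpow_add hr]; norm_num
  have hn' : ∀ θ : ℝ × Sph n, ‖(dil r (unitPoint θ)).1‖ ^ 2 = r ^ 2 * ‖(unitPoint θ).1‖ ^ 2 :=
    fun θ => by simp [dil, norm_smul, mul_pow]
  simp only [rho_dil hr.le, rho_unitPoint, mul_one, hn']
  have e1 : ∀ θ : ℝ × Sph n, r ^ (-6 : ℝ) * (r ^ 2 * ‖(unitPoint θ).1‖ ^ 2 *
      (u (dil r (unitPoint θ)) - sphAvg u r) ^ 2) =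
      r ^ (-4 : ℝ) * (‖(unitPoint θ).1‖ ^ 2 * (u (dil r (unitPoint θ)) - sphAvg u r) ^ 2) :=
    fun θ => by rw [← h6]; ring
  have e2 : ∀ θ : ℝ × Sph n, r ^ (-2 : ℝ) * gradSq u (dil r (unitPoint θ)) -
      r ^ (-6 : ℝ) * (r ^ 2 * ‖(unitPoint θ).1‖ ^ 2 * euler u (dil r (unitPoint θ)) ^ 2) =
      r ^ (-4 : ℝ) * (r ^ 2 * gradSq u (dil r (unitPoint θ)) -
        ‖(unitPoint θ).1‖ ^ 2 * euler u (dil r (unitPoint θ)) ^ 2) :=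
    fun θ => by rw [← h4, ← h6]; ring
  simp only [e1, e2, integral_const_mul]
  have := mul_le_mul_of_nonneg_left h (Real.rpow_nonneg hr.le (-4))
  linarith

/-! ### Finite energies -/

/-- Domination by a product of a radial and a slope function; the remaining spherical measure is
finite. -/
lemma integrable_of_polar_bound (hn : 1 ≤ n) {F : Space n → ℝ} (hF : AEStronglyMeasurable F)
    {g k : ℝ → ℝ} (hg : Integrable g (radialMeasure (n + 1)))
    (hk : Integrable k (slopeMeasure (n + 2)))
    (h : ∀ r > 0, ∀ y ξ, |F (dil r (unitPoint (y, ξ)))| ≤ g r * k y) : Integrable F := by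
  rw [integrable_polar hn hF]
  have hp := measurePreserving_polar hn
  have hk' : Integrable (fun θ : ℝ × Sph n => k θ.1) (angular n) := hk.comp_fst _
  refine (hg.mul_prod hk').mono' (hF.comp_measurePreserving hp) ?_
  have : ∀ᵐ z ∂(radialMeasure (n + 1)).prod (angular n), 0 < z.1 :=
    Measure.quasiMeasurePreserving_fst.ae (ae_radialMeasure_pos _)
  filter_upwards [this] with z hz
  exact h _ hz _ _

lemma integrable_slopeMeasure_of {k : ℕ} {h : ℝ → ℝ}
    (hh : Integrable fun y => slopeRadius y ^ k / 2 * h y) : Integrable h (slopeMeasure k) := by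
  have hcm := continuous_slopeRadius.measurable
  rw [slopeMeasure, integrable_withDensity_iff_integrable_smul' (by fun_prop) (by simp)]
  refine hh.congr (ae_of_all _ fun y => ?_)
  have := slopeRadius_pos y
  simp only [smul_eq_mul]
  rw [ENNReal.toReal_ofReal (by positivity)]

/-- The factor `1/|∇ϱ|²` blows up on the `t`-axis like `c⁻²`. Against the density `c^{n+2}` it
leaves `cⁿ`, integrable for `n ≥ 3`. -/
lemma integrable_inv_slopeRadius_sq (hn : 3 ≤ n) :
    Integrable (fun y => (slopeRadius y ^ 2)⁻¹) (slopeMeasure (n + 2)) := by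
  refine integrable_slopeMeasure_of (((integrable_slopeRadius_pow hn).div_const 2).congr
    (ae_of_all _ fun y => ?_))
  have := slopeRadius_pos y
  simp only
  rw [pow_add]
  field_simp

lemma suppOff_lap {u : Space n → ℝ} (hu : u ∈ testFunctionsConst n) : SuppOff (lap u) := by
  have hsf := suppOff_fderiv hu
  have h0 : ∀ p, p ∉ tsupport (fderiv ℝ u) → lap u p = 0 := fun p hp => by
    have hz : ∀ e : Space n, fderiv ℝ (fun q => fderiv ℝ u q e) p = 0 := fun e => by
      have h1 : (fun q => fderiv ℝ u q e) =ᶠ[𝓝 p] fun _ => 0 :=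
        (notMem_tsupport_iff_eventuallyEq.1 hp).mono fun q hq => by simp [hq]
      rw [h1.fderiv_eq]; simp
    have hX : ∀ i, dX i (dX i u) p = 0 := fun i => by
      change fderiv ℝ (fun q => fderiv ℝ u q _) p _ = 0
      rw [hz]; rfl
    have hT : dT (dT u) p = 0 := by
      change fderiv ℝ (fun q => fderiv ℝ u q _) p _ = 0
      rw [hz]; rfl
    simp [lap, hX, hT]
  exact hsf.mono (closure_minimal (fun p hp => by_contra fun h => hp (h0 p h))
    (isClosed_tsupport _))

lemma lapDensity_eq (u : Space n → ℝ) {p : Space n} (hp : p ≠ 0) :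
    lapDensity u p = lap u p ^ 2 * rho p ^ 2 / ‖p.1‖ ^ 2 := by
  rw [lapDensity, gradSq_rho hp, div_div_eq_mul_div]

lemma norm_dil_unitPoint_fst {r : ℝ} (hr : 0 < r) (θ : ℝ × Sph n) :
    ‖(dil r (unitPoint θ)).1‖ = r * slopeRadius θ.1 := by
  rw [dil, norm_smul, norm_unitPoint_fst, Real.norm_eq_abs, abs_of_pos hr]

lemma measurable_gradSq_rho : Measurable fun p : Space n => ‖p.1‖ ^ 2 / rho p ^ 2 :=
  Measurable.div (by fun_prop) (measurable_rho.pow_const 2)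

lemma finiteEnergies (hn : 3 ≤ n) {u : Space n → ℝ} (hu : u ∈ testFunctionsConst n) (s r : ℝ) :
    FiniteEnergies s r u := by
  have hu1 : ContDiff ℝ 1 u := hu.1.of_le (by simp)
  have hg : ∀ s : ℝ, Integrable (gradDensity s u) := fun s =>
    SuppOff.integrable_rho_rpow_mul ((suppOff_fderiv hu).mono_zero fun p hp => by
      simp [gradSq, dX, dT, hp]) (continuous_gradSq hu1) _
  refine ⟨?_, hg s, hg r⟩
  have hL := suppOff_lap hu
  have hLc : Continuous (lap u) := (contDiff_lap hu.1).continuous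
  obtain ⟨M, hM⟩ := hL.1.exists_bound_of_continuous hLc
  obtain ⟨R, hR⟩ := exists_rho_of_hasCompactSupport hL.1
  have hm : AEStronglyMeasurable (fun p : Space n => lap u p ^ 2 * rho p ^ 2 / ‖p.1‖ ^ 2) :=
    (Measurable.div ((hLc.measurable.pow_const 2).mul (measurable_rho.pow_const 2))
      (by fun_prop)).aestronglyMeasurable
  have hae : lapDensity u =ᵐ[volume] fun p => lap u p ^ 2 * rho p ^ 2 / ‖p.1‖ ^ 2 :=
    ae_ne_zero.mono fun p hp => lapDensity_eq u hp
  refine Integrable.congr ?_ hae.symm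
  have hgi : Integrable (indicator (Icc 0 R) fun _ => M ^ 2) (radialMeasure (n + 1)) := by
    rw [integrable_indicator_iff measurableSet_Icc]
    refine integrableOn_const ?_
    rw [radialMeasure, withDensity_apply _ measurableSet_Icc]
    refine ne_of_lt (lt_of_le_of_lt (lintegral_mono' (Measure.restrict_mono le_rfl
      Measure.restrict_le_self) le_rfl) ?_)
    have : Continuous fun r : ℝ => r ^ (n + 1) := by fun_prop
    exact (this.continuousOn.integrableOn_compact isCompact_Icc).lintegral_lt_top
  -- On the support `ϱ²/|x|² = c⁻²`, so the density is at most `M²c⁻²` for `r ≤ R`.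
  refine integrable_of_polar_bound (by omega) hm hgi (integrable_inv_slopeRadius_sq hn)
    fun r hr y ξ => ?_
  have hc := slopeRadius_pos y
  rw [norm_dil_unitPoint_fst hr, rho_dil hr.le, rho_unitPoint]
  by_cases hrR : r ≤ R
  · rw [indicator_of_mem (mem_Icc.2 ⟨hr.le, hrR⟩), abs_of_nonneg (by positivity)]
    have : lap u (dil r (unitPoint (y, ξ))) ^ 2 ≤ M ^ 2 := sq_le_sq_of_abs_le (hM _)
    calc lap u (dil r (unitPoint (y, ξ))) ^ 2 * (r * 1) ^ 2 / (r * slopeRadius y) ^ 2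
        = lap u (dil r (unitPoint (y, ξ))) ^ 2 * (slopeRadius y ^ 2)⁻¹ := by field_simp
      _ ≤ _ := by gcongr ?_ * _
  · rw [hR _ (by rw [rho_dil hr.le, rho_unitPoint]; linarith), indicator_of_notMem
      (fun h => hrR h.2)]
    simp

/-! ### The second order inequality -/

/-- Cauchy–Schwarz in a form needing only a pointwise bound `f² ≤ AB`, so the vector fields need not
be factored. -/
lemma abs_integral_le_sqrt_mul_sqrt {α : Type*} [MeasurableSpace α] {μ : Measure α} {f A B : α → ℝ}
    (hA : Integrable A μ) (hB : Integrable B μ) (hA0 : ∀ x, 0 ≤ A x) (hB0 : ∀ x, 0 ≤ B x)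
    (h : ∀ x, f x ^ 2 ≤ A x * B x) : |∫ x, f x ∂μ| ≤ √(∫ x, A x ∂μ) * √(∫ x, B x ∂μ) := by
  have hL : ∀ {C : α → ℝ}, Integrable C μ → (∀ x, 0 ≤ C x) →
      MemLp (fun x => √(C x)) (ENNReal.ofReal 2) μ := fun {C} hC hC0 => by
    have hm : AEStronglyMeasurable (fun x => √(C x)) μ :=
      (Real.continuous_sqrt.measurable.comp_aemeasurable hC.1.aemeasurable).aestronglyMeasurable
    rw [show ENNReal.ofReal 2 = 2 by simp, memLp_two_iff_integrable_sq hm]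
    exact hC.congr (ae_of_all _ fun x => (Real.sq_sqrt (hC0 x)).symm)
  have hH := integral_mul_le_Lp_mul_Lq_of_nonneg (μ := μ) (p := 2) (q := 2)
    (Real.HolderConjugate.two_two) (ae_of_all _ fun x => Real.sqrt_nonneg (A x))
    (ae_of_all _ fun x => Real.sqrt_nonneg (B x)) (hL hA hA0) (hL hB hB0)
  have hsq : ∀ {C : α → ℝ}, (∀ x, 0 ≤ C x) → ∀ x, √(C x) ^ (2 : ℝ) = C x := fun hC0 x => by
    rw [Real.rpow_two, Real.sq_sqrt (hC0 x)]
  simp only [hsq hA0, hsq hB0] at hH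
  rw [← Real.sqrt_eq_rpow, ← Real.sqrt_eq_rpow] at hH
  refine le_trans ?_ hH
  refine (abs_integral_le_integral_abs).trans ?_
  have hi : Integrable (fun x => √(A x) * √(B x)) μ := by
    have hA2 := hL hA hA0
    have hB2 := hL hB hB0
    rw [show ENNReal.ofReal 2 = 2 by simp] at hA2 hB2
    exact hA2.integrable_mul hB2
  refine integral_mono_of_nonneg (ae_of_all _ fun x => abs_nonneg _) hi (ae_of_all _ fun x => ?_)
  simp only
  rw [← Real.sqrt_mul (hA0 x), ← Real.sqrt_sq_eq_abs]
  exact Real.sqrt_le_sqrt (h x)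

/-! ### Integral identities along the dilations and the inequality for test functions -/

section Admissible

variable {u : Space n → ℝ}

lemma suppOff_euler (hu : u ∈ testFunctionsConst n) : SuppOff (euler u) :=
  (suppOff_fderiv hu).mono_zero fun p hp => by simp [euler, hp]

lemma suppOff_gradInner (hu : u ∈ testFunctionsConst n) (v : Space n → ℝ) :
    SuppOff (gradInner v u) :=
  (suppOff_fderiv hu).mono_zero fun p hp => by simp [gradInner, dX, dT, hp]

lemma suppOff_gradSq (hu : u ∈ testFunctionsConst n) : SuppOff (gradSq u) :=
  (suppOff_fderiv hu).mono_zero fun p hp => by simp [gradSq, dX, dT, hp]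

lemma integrable_gradInner (hu : u ∈ testFunctionsConst n) {v : Space n → ℝ} (hv : ContDiff ℝ ∞ v)
    (s : ℝ) : Integrable fun p => rho p ^ s * gradInner v u p :=
  (suppOff_gradInner hu v).integrable_rho_rpow_mul (contDiff_gradInner hv hu.1).continuous s

lemma integrable_normSq_mul {F : Space n → ℝ} (hF : SuppOff F) (hFc : Continuous F) (s : ℝ) :
    Integrable fun p => rho p ^ s * (‖p.1‖ ^ 2 * F p) :=
  (hF.mul_left (fun p => ‖p.1‖ ^ 2)).integrable_rho_rpow_mul (by fun_prop) s

/-- `∫ ϱ^s ⟨∇ Zv, ∇ u⟩ + ∫ ϱ^s ⟨∇ v, ∇ Zu⟩ = -(Q + s - 2) ∫ ϱ^s ⟨∇ v, ∇ u⟩`. -/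
lemma integral_gradInner_euler (hu : u ∈ testFunctionsConst n) {v : Space n → ℝ}
    (hv : ContDiff ℝ ∞ v) (s : ℝ) :
    (∫ p, rho p ^ s * gradInner (euler v) u p) + (∫ p, rho p ^ s * gradInner v (euler u) p) =
      -(homDim n + s - 2) * ∫ p, rho p ^ s * gradInner v u p := by
  have h := integral_rho_rpow_mul_euler s ((contDiff_gradInner hv hu.1).of_le (by simp))
    (suppOff_gradInner hu v)
  have hZu : SuppOff (gradInner v (euler u)) :=
    (suppOff_euler hu).fderiv.mono_zero fun p hp => by simp [gradInner, dX, dT, hp]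
  have i1 := integrable_gradInner hu (contDiff_euler hv) s
  have i2 : Integrable fun p => rho p ^ s * gradInner v (euler u) p :=
    hZu.integrable_rho_rpow_mul (contDiff_gradInner hv (contDiff_euler hu.1)).continuous s
  have i3 := integrable_gradInner hu hv s
  have e : ∀ p, rho p ^ s * euler (gradInner v u) p = rho p ^ s * gradInner (euler v) u p +
      rho p ^ s * gradInner v (euler u) p - 2 * (rho p ^ s * gradInner v u p) := fun p => by
    rw [euler_gradInner hv hu.1]; ring
  have i4 : Integrable fun p => rho p ^ s * gradInner (euler v) u p +
      rho p ^ s * gradInner v (euler u) p := i1.add i2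
  simp only [e] at h
  rw [integral_sub i4 (i3.const_mul _), integral_add i1 i2, integral_const_mul] at h
  linarith

/-- For `v = u` the two terms on the left of `integral_gradInner_euler` coincide. -/
lemma integral_gradInner_euler_self (hu : u ∈ testFunctionsConst n) (s : ℝ) :
    ∫ p, rho p ^ s * gradInner (euler u) u p = -(homDim n + s - 2) / 2 * gradEnergy s u := by
  have h := integral_gradInner_euler hu hu.1 s
  simp only [gradInner_comm u (euler u), gradInner_self] at h
  simp only [gradEnergy, gradDensity]
  linarith

/-- `∫ ϱ⁻² F Lu = -∫ ϱ⁻² ⟨∇F, ∇u⟩ + 2 ∫ ψ ϱ⁻⁴ F Zu`. -/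
lemma integral_rho_rpow_mul_lap (hu : u ∈ testFunctionsConst n) {F : Space n → ℝ}
    (hF : ContDiff ℝ 1 F) (hFs : SuppOff F) :
    ∫ p, rho p ^ (-2 : ℝ) * (F p * lap u p) = -(∫ p, rho p ^ (-2 : ℝ) * gradInner F u p) +
      2 * ∫ p, rho p ^ (-6 : ℝ) * (‖p.1‖ ^ 2 * (F p * euler u p)) := by
  have hG : ContDiff ℝ 1 (fun p => rho p ^ (-2 : ℝ) * F p) :=
    hFs.contDiff_mul hF ((contDiffOn_rho_rpow _).of_le (by simp))
  have h := integral_mul_lap hG (hFs.mul_left _).1 hu.1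
  have hu1 : ContDiff ℝ 1 u := hu.1.of_le (by simp)
  have hFc := hF.continuous
  have hec := continuous_euler hu1
  have i1 : Integrable fun p => rho p ^ (-2 : ℝ) * gradInner F u p := by
    refine (suppOff_gradInner hu F).integrable_rho_rpow_mul ?_ _
    exact (continuous_finsetSum _ fun i _ => (continuous_dX hF i).mul (continuous_dX hu1 i)).add
      ((continuous_fst.norm.pow 2).mul ((continuous_dT hF).mul (continuous_dT hu1)))
  have i2 := integrable_normSq_mul (hFs.mul_right (euler u)) (hFc.mul hec) (-6)
  simp only [mul_assoc] at h
  have i3 : Integrable fun p => -(rho p ^ (-2 : ℝ) * gradInner F u p) := i1.neg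
  rw [h, ← integral_const_mul, ← integral_neg, ← integral_neg, ← integral_add i3 (i2.const_mul 2)]
  refine integral_congr_ae (ae_ne_zero.mono fun p hp => ?_)
  have hd : DifferentiableAt ℝ (fun p : Space n => rho p ^ (-2 : ℝ)) p :=
    (hasFDerivAt_rho_rpow _ hp).differentiableAt
  simp only
  rw [gradInner_mul_left hd (hF.differentiable one_ne_zero p), gradInner_rho_rpow _ hp]
  norm_num
  ring

/-- The weight `|x|²ϱ⁻⁶` has degree -4, so the adjoint of `Z` in this weight is `-Z - (Q-4)`. -/
lemma integral_normSq_mul_euler_mul {F G : Space n → ℝ} (hF : ContDiff ℝ 1 F)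
    (hG : ContDiff ℝ 1 G) (hs : SuppOff G) :
    (∫ p, rho p ^ (-6 : ℝ) * (‖p.1‖ ^ 2 * (euler F p * G p))) +
      (∫ p, rho p ^ (-6 : ℝ) * (‖p.1‖ ^ 2 * (F p * euler G p))) =
      -(homDim n - 4) * ∫ p, rho p ^ (-6 : ℝ) * (‖p.1‖ ^ 2 * (F p * G p)) := by
  have h := integral_normSq_rho_rpow_mul_euler (-6) (hF.mul hG) (hs.mul_left F)
  have hFc := hF.continuous
  have hGc := hG.continuous
  have hFe := continuous_euler hF
  have hGe := continuous_euler hG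
  rw [← integral_add (integrable_normSq_mul (hs.mul_left (euler F)) (hFe.mul hGc) _)
    (integrable_normSq_mul (hs.euler.mul_left F) (hFc.mul hGe) _)]
  rw [show -(homDim n - 4) = -(homDim n + -6 + 2) by ring]
  refine Eq.trans (integral_congr_ae (ae_of_all _ fun p => ?_)) h
  simp only
  rw [euler_mul (hF.differentiable one_ne_zero p) (hG.differentiable one_ne_zero p)]
  ring

lemma ae_norm_fst_ne_zero (hn : 1 ≤ n) : ∀ᵐ p : Space n, ‖p.1‖ ≠ 0 := by
  have : Nonempty (Fin n) := ⟨⟨0, hn⟩⟩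
  have : Nontrivial (EuclideanSpace ℝ (Fin n)) := inferInstance
  have h : ∀ᵐ x : EuclideanSpace ℝ (Fin n), ‖x‖ ≠ 0 := by
    have : ∀ᵐ x : EuclideanSpace ℝ (Fin n), x ≠ 0 := compl_mem_ae_iff.2 (measure_singleton _)
    exact this.mono fun x hx => norm_ne_zero_iff.2 hx
  exact (Measure.quasiMeasurePreserving_fst (μ := (volume : Measure (EuclideanSpace ℝ (Fin n))))
    (ν := (volume : Measure ℝ))).ae h

/-- The identity behind the estimate of the angular part. -/
lemma integral_deviation (hn : 1 ≤ n) (hu : u ∈ testFunctionsConst n) :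
    (∫ p, rho p ^ (-6 : ℝ) * (‖p.1‖ ^ 2 * ((u p - sphAvg u (rho p)) *
      (euler (euler u) p + (homDim n - 2) * euler u p)))) -
      (∫ p, rho p ^ (-2 : ℝ) * ((u p - sphAvg u (rho p)) * lap u p)) =
    (∫ p, rho p ^ (-2 : ℝ) * gradSq u p) -
      ∫ p, rho p ^ (-6 : ℝ) * (‖p.1‖ ^ 2 * euler u p ^ 2) := by
  have hu1 : ContDiff ℝ 1 u := hu.1.of_le (by simp)
  have hU : ContDiff ℝ ∞ (euler u) := contDiff_euler hu.1
  have hU1 : ContDiff ℝ 1 (euler u) := hU.of_le (by simp)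
  have hF := suppOff_sub_sphAvg hn hu
  have hF1 := contDiff_sub_sphAvg hn hu
  have hUs := suppOff_euler hu
  have hZ := integral_normSq_mul_euler_mul hF1 hU1 hUs
  have hL := integral_rho_rpow_mul_lap hu hF1 hF
  have hFc := hF1.continuous
  have hUc := hU1.continuous
  have hFe := continuous_euler hF1
  have hU2c := continuous_euler hU1
  set F := fun p => u p - sphAvg u (rho p) with hFdef
  have i1 : Integrable fun p => rho p ^ (-6 : ℝ) * (‖p.1‖ ^ 2 * (F p * euler (euler u) p)) :=
    integrable_normSq_mul (hF.mul_right _) (hFc.mul hU2c) _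
  have i2 : Integrable fun p => rho p ^ (-6 : ℝ) * (‖p.1‖ ^ 2 * (F p * euler u p)) :=
    integrable_normSq_mul (hF.mul_right _) (hFc.mul hUc) _
  have i3 : Integrable fun p => rho p ^ (-6 : ℝ) * (‖p.1‖ ^ 2 * (euler F p * euler u p)) :=
    integrable_normSq_mul (hUs.mul_left _) (hFe.mul hUc) _
  have i4 : Integrable fun p => rho p ^ (-2 : ℝ) * gradInner F u p := by
    refine (suppOff_gradInner hu F).integrable_rho_rpow_mul ?_ _
    exact (continuous_finsetSum _ fun i _ => (continuous_dX hF1 i).mul (continuous_dX hu1 i)).add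
      ((continuous_fst.norm.pow 2).mul ((continuous_dT hF1).mul (continuous_dT hu1)))
  have i5 : Integrable fun p => rho p ^ (-2 : ℝ) * gradSq u p :=
    (suppOff_gradSq hu).integrable_rho_rpow_mul (continuous_gradSq hu1) _
  have i6 : Integrable fun p => rho p ^ (-6 : ℝ) * (‖p.1‖ ^ 2 * euler u p ^ 2) :=
    integrable_normSq_mul (hUs.mono_zero fun p hp => by simp [hp]) (hUc.pow 2) _
  have hB : ∫ p, rho p ^ (-6 : ℝ) * (‖p.1‖ ^ 2 * (F p *
      (euler (euler u) p + (homDim n - 2) * euler u p))) =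
      (∫ p, rho p ^ (-6 : ℝ) * (‖p.1‖ ^ 2 * (F p * euler (euler u) p))) +
      (homDim n - 2) * ∫ p, rho p ^ (-6 : ℝ) * (‖p.1‖ ^ 2 * (F p * euler u p)) := by
    rw [← integral_const_mul, ← integral_add i1 (i2.const_mul _)]
    exact integral_congr_ae (ae_of_all _ fun p => by simp only; ring)
  have hD : (∫ p, rho p ^ (-2 : ℝ) * gradInner F u p) -
      (∫ p, rho p ^ (-6 : ℝ) * (‖p.1‖ ^ 2 * (euler F p * euler u p))) =
      (∫ p, rho p ^ (-2 : ℝ) * gradSq u p) -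
      ∫ p, rho p ^ (-6 : ℝ) * (‖p.1‖ ^ 2 * euler u p ^ 2) := by
    rw [← integral_sub i4 i3, ← integral_sub i5 i6]
    refine integral_congr_ae (ae_ne_zero.mono fun p hp => ?_)
    have hv := hasDerivAt_sphAvg hu1 hu.2.1 (rho p)
    have hud := hu1.differentiable one_ne_zero p
    have hvd := (fderiv_comp_rho hp hv).differentiableAt
    have hneg : DifferentiableAt ℝ (fun p => -1 * sphAvg u (rho p)) p := hvd.const_mul _
    have hFe : F = fun p => u p + -1 * sphAvg u (rho p) := by
      ext p; simp only [hFdef]; ring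
    have h1 : gradInner F u p = gradSq u p - sphAvgDeriv u (rho p) *
        (rho p ^ (-3 : ℝ) * ‖p.1‖ ^ 2 * euler u p) := by
      rw [hFe, gradInner_add_left hud hneg, gradInner_const_mul_left _ hvd,
        gradInner_comp_rho hp hv, gradInner_self]
      ring
    have h2 : euler F p = euler u p - sphAvgDeriv u (rho p) * rho p := by
      have h3 := euler_comp_rho hp hv
      rw [euler] at h3
      rw [euler, hFdef, fderiv_fun_sub hud hvd, sub_apply, h3, euler]
    have h4 : rho p ^ (-2 : ℝ) * rho p ^ (-3 : ℝ) = rho p ^ (-6 : ℝ) * rho p := by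
      have h := rho_rpow_mul hp (-6) 1
      rw [Real.rpow_one] at h
      rw [h, rho_rpow_mul hp]
      norm_num
    simp only [h1, h2]
    linear_combination (-sphAvgDeriv u (rho p) * ‖p.1‖ ^ 2 * euler u p) * h4
  linarith

/-- The lower bound for `∫ |Lu|²/|∇ϱ|²` by the gradient of `Zu`. -/
lemma lapEnergy_ge (hn : 3 ≤ n) (hu : u ∈ testFunctionsConst n) :
    gradEnergy (-2) (euler u) + 2 * (homDim n - 2) * gradEnergy (-2) u ≤ lapEnergy u := by
  have hn1 : 1 ≤ n := by omega
  have hu1 : ContDiff ℝ 1 u := hu.1.of_le (by simp)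
  have hU : ContDiff ℝ ∞ (euler u) := contDiff_euler hu.1
  have hU1 : ContDiff ℝ 1 (euler u) := hU.of_le (by simp)
  have hU2 : ContDiff ℝ ∞ (euler (euler u)) := contDiff_euler hU
  have hUs := suppOff_euler hu
  have hU2s := hUs.euler
  have hUc := hU.continuous
  have hU2c := hU2.continuous
  have hLc := (contDiff_lap hu.1).continuous
  have hLs := suppOff_lap hu
  have hF := suppOff_sub_sphAvg hn1 hu
  have hFc := (contDiff_sub_sphAvg hn1 hu).continuous
  have hdev := integral_deviation hn1 hu
  have hbulk := bulk_poincare hn hu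
  set q := homDim n with hq
  set F := fun p => u p - sphAvg u (rho p) with hFdef
  -- For radial `u` one has `ϱ²Lu = |∇ϱ|²B`; in general the difference is the angular part of the
  -- operator.
  let B : Space n → ℝ := fun p => euler (euler u) p + (q - 2) * euler u p
  have hB : ContDiff ℝ ∞ B := hU2.add (contDiff_const.mul hU)
  have hBs : SuppOff B := hU2s.add (hUs.mul_left _)
  have hBc := hB.continuous
  have i1 : Integrable fun p => rho p ^ (-6 : ℝ) * (‖p.1‖ ^ 2 * (F p * B p)) :=
    integrable_normSq_mul (hF.mul_right _) (hFc.mul hBc) _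
  have i2 : Integrable fun p => rho p ^ (-2 : ℝ) * (F p * lap u p) :=
    (hF.mul_right _).integrable_rho_rpow_mul (hFc.mul hLc) _
  have i3 : Integrable fun p => rho p ^ (-6 : ℝ) * (‖p.1‖ ^ 2 * F p ^ 2) :=
    integrable_normSq_mul (hF.mono_zero fun p hp => by simp [hp]) (hFc.pow 2) _
  have i4 : Integrable fun p => rho p ^ (-6 : ℝ) * (‖p.1‖ ^ 2 * B p ^ 2) :=
    integrable_normSq_mul (hBs.mono_zero fun p hp => by simp [hp]) (hBc.pow 2) _
  have i5 : Integrable fun p => rho p ^ (-2 : ℝ) * (B p * lap u p) :=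
    (hBs.mul_right _).integrable_rho_rpow_mul (hBc.mul hLc) _
  have i6 : Integrable (lapDensity u) := (finiteEnergies hn hu 0 0).1
  -- the arithmetic-geometric mean inequality
  have hAG : 8 * ((∫ p, rho p ^ (-6 : ℝ) * (‖p.1‖ ^ 2 * (F p * B p))) -
      ∫ p, rho p ^ (-2 : ℝ) * (F p * lap u p)) ≤
      16 * (∫ p, rho p ^ (-6 : ℝ) * (‖p.1‖ ^ 2 * F p ^ 2)) +
      ((∫ p, rho p ^ (-6 : ℝ) * (‖p.1‖ ^ 2 * B p ^ 2)) -
        2 * (∫ p, rho p ^ (-2 : ℝ) * (B p * lap u p)) + lapEnergy u) := by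
    have j1 : Integrable fun p => rho p ^ (-6 : ℝ) * (‖p.1‖ ^ 2 * B p ^ 2) -
        2 * (rho p ^ (-2 : ℝ) * (B p * lap u p)) := i4.sub (i5.const_mul 2)
    have j2 : Integrable fun p => rho p ^ (-6 : ℝ) * (‖p.1‖ ^ 2 * B p ^ 2) -
        2 * (rho p ^ (-2 : ℝ) * (B p * lap u p)) + lapDensity u p := j1.add i6
    rw [lapEnergy, ← integral_sub i1 i2, ← integral_const_mul, ← integral_const_mul,
      ← integral_const_mul, ← integral_sub i4 (i5.const_mul 2), ← integral_add j1 i6,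
      ← integral_add (i3.const_mul 16) j2]
    refine integral_mono_ae ((i1.sub i2).const_mul 8) ((i3.const_mul 16).add j2) ?_
    filter_upwards [ae_ne_zero, ae_norm_fst_ne_zero hn1] with p hp hx
    have hr := rho_pos hp
    have ha : 0 < rho p ^ (-6 : ℝ) * ‖p.1‖ ^ 2 := by positivity
    have hd : lapDensity u p = (rho p ^ (-2 : ℝ) * lap u p) ^ 2 / (rho p ^ (-6 : ℝ) * ‖p.1‖ ^ 2) := by
      have h6 : (rho p ^ (-2 : ℝ)) ^ 2 = rho p ^ (-6 : ℝ) * rho p ^ 2 := by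
        rw [← Real.rpow_natCast, ← Real.rpow_natCast, ← Real.rpow_mul hr.le, ← Real.rpow_add hr]
        norm_num
      rw [lapDensity_eq u hp, mul_pow, h6]
      field_simp
    -- With `a = ϱ⁻⁶|x|²` this is `a(4F - (B - ϱ²Lu/|∇ϱ|²))²`. The factor 4 is matched to the
    -- constant of `bulk_poincare`.
    have hsq : 0 ≤ (4 * (rho p ^ (-6 : ℝ) * ‖p.1‖ ^ 2) * F p - ((rho p ^ (-6 : ℝ) * ‖p.1‖ ^ 2) * B p -
        rho p ^ (-2 : ℝ) * lap u p)) ^ 2 / (rho p ^ (-6 : ℝ) * ‖p.1‖ ^ 2) := by positivity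
    rw [hd]
    have hA : rho p ^ (-6 : ℝ) * (‖p.1‖ ^ 2 * (F p * B p)) =
        (rho p ^ (-6 : ℝ) * ‖p.1‖ ^ 2) * (F p * B p) := by ring
    have hA2 : rho p ^ (-6 : ℝ) * (‖p.1‖ ^ 2 * F p ^ 2) =
        (rho p ^ (-6 : ℝ) * ‖p.1‖ ^ 2) * F p ^ 2 := by ring
    have hA3 : rho p ^ (-6 : ℝ) * (‖p.1‖ ^ 2 * B p ^ 2) =
        (rho p ^ (-6 : ℝ) * ‖p.1‖ ^ 2) * B p ^ 2 := by ring
    rw [hA, hA2, hA3]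
    generalize rho p ^ (-6 : ℝ) * ‖p.1‖ ^ 2 = a at *
    generalize rho p ^ (-2 : ℝ) = c at *
    have : (4 * a * F p - (a * B p - c * lap u p)) ^ 2 / a = 16 * (a * F p ^ 2) +
        (a * B p ^ 2 - 2 * (c * (B p * lap u p)) + (c * lap u p) ^ 2 / a) -
        8 * (a * (F p * B p) - c * (F p * lap u p)) := by
      field_simp; ring
    linarith
  -- the radial identities
  have hY := integral_gradInner_euler_self hu (-2)
  have hW := integral_gradInner_euler hu hU (-2)
  have hee := integral_normSq_mul_euler_mul hU1 hU1 hUs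
  have hBL := integral_rho_rpow_mul_lap hu (hB.of_le (by simp)) hBs
  have k1 : Integrable fun p => rho p ^ (-6 : ℝ) * (‖p.1‖ ^ 2 * (euler (euler u) p * euler u p)) :=
    integrable_normSq_mul (hUs.mul_left _) (hU2c.mul hUc) _
  have k2 : Integrable fun p => rho p ^ (-6 : ℝ) * (‖p.1‖ ^ 2 * euler u p ^ 2) :=
    integrable_normSq_mul (hUs.mono_zero fun p hp => by simp [hp]) (hUc.pow 2) _
  have k3 : Integrable fun p => rho p ^ (-6 : ℝ) * (‖p.1‖ ^ 2 * euler (euler u) p ^ 2) :=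
    integrable_normSq_mul (hU2s.mono_zero fun p hp => by simp [hp]) (hU2c.pow 2) _
  have hBU : ∫ p, rho p ^ (-6 : ℝ) * (‖p.1‖ ^ 2 * (B p * euler u p)) =
      (∫ p, rho p ^ (-6 : ℝ) * (‖p.1‖ ^ 2 * (euler (euler u) p * euler u p))) +
        (q - 2) * ∫ p, rho p ^ (-6 : ℝ) * (‖p.1‖ ^ 2 * euler u p ^ 2) := by
    rw [← integral_const_mul, ← integral_add k1 (k2.const_mul _)]
    exact integral_congr_ae (ae_of_all _ fun p => by simp only [B]; ring)
  have hBB : ∫ p, rho p ^ (-6 : ℝ) * (‖p.1‖ ^ 2 * B p ^ 2) =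
      (∫ p, rho p ^ (-6 : ℝ) * (‖p.1‖ ^ 2 * euler (euler u) p ^ 2)) +
        (2 * (q - 2) * (∫ p, rho p ^ (-6 : ℝ) * (‖p.1‖ ^ 2 * (euler (euler u) p * euler u p))) +
        (q - 2) ^ 2 * ∫ p, rho p ^ (-6 : ℝ) * (‖p.1‖ ^ 2 * euler u p ^ 2)) := by
    have k4 : Integrable fun p => 2 * (q - 2) * (rho p ^ (-6 : ℝ) * (‖p.1‖ ^ 2 *
        (euler (euler u) p * euler u p))) + (q - 2) ^ 2 * (rho p ^ (-6 : ℝ) *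
        (‖p.1‖ ^ 2 * euler u p ^ 2)) := (k1.const_mul _).add (k2.const_mul _)
    rw [← integral_const_mul, ← integral_const_mul, ← integral_add (k1.const_mul _) (k2.const_mul _),
      ← integral_add k3 k4]
    exact integral_congr_ae (ae_of_all _ fun p => by simp only [B]; ring)
  have hBg : ∫ p, rho p ^ (-2 : ℝ) * gradInner B u p =
      (∫ p, rho p ^ (-2 : ℝ) * gradInner (euler (euler u)) u p) +
        (q - 2) * ∫ p, rho p ^ (-2 : ℝ) * gradInner (euler u) u p := by
    rw [← integral_const_mul, ← integral_add (integrable_gradInner hu hU2 _)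
      ((integrable_gradInner hu hU _).const_mul _)]
    refine integral_congr_ae (ae_of_all _ fun p => ?_)
    have hd : DifferentiableAt ℝ (euler u) p := hU1.differentiable one_ne_zero p
    simp only [B]
    rw [gradInner_add_left (hU2.differentiable (by simp) p) (hd.const_mul _),
      gradInner_const_mul_left _ hd]
    ring
  -- The expansion yields `2D₋₂(Zu)`; one copy pays for the term with `(Z²u)²`, the other survives.
  have hXh : ∫ p, rho p ^ (-6 : ℝ) * (‖p.1‖ ^ 2 * euler (euler u) p ^ 2) ≤
      gradEnergy (-2) (euler u) := by
    have k5 : Integrable (gradDensity (-2) (euler u)) :=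
      SuppOff.integrable_rho_rpow_mul (hUs.fderiv.mono_zero fun p hp => by
        simp [gradSq, dX, dT, hp]) (continuous_gradSq hU1) _
    refine integral_mono_ae k3 k5 (ae_ne_zero.mono fun p hp => ?_)
    have h := normSq_mul_euler_sq_le (euler u) p
    have h6 : rho p ^ (-6 : ℝ) * rho p ^ 4 = rho p ^ (-2 : ℝ) := by
      rw [← Real.rpow_natCast, rho_rpow_mul hp]; norm_num
    have hr := rho_pos hp
    calc rho p ^ (-6 : ℝ) * (‖p.1‖ ^ 2 * euler (euler u) p ^ 2)
        ≤ rho p ^ (-6 : ℝ) * (rho p ^ 4 * gradSq (euler u) p) := by gcongr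
      _ = gradDensity (-2) (euler u) p := by rw [gradDensity, ← h6]; ring
  have hcomm : ∫ p, rho p ^ (-6 : ℝ) * (‖p.1‖ ^ 2 * (euler u p * euler (euler u) p)) =
      ∫ p, rho p ^ (-6 : ℝ) * (‖p.1‖ ^ 2 * (euler (euler u) p * euler u p)) :=
    integral_congr_ae (ae_of_all _ fun p => by simp only; ring)
  rw [hcomm] at hee
  simp only [gradInner_self, ← pow_two] at hW hee
  simp only [gradEnergy, gradDensity, ← hq] at hY hW hee hBL hXh ⊢
  -- What remains is linear algebra. `bulk_poincare` turns `8E ≤ 16∫aF² + …` into `4E ≤ …`; after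
  -- substituting the identities, the coefficient of `∫a(Zu)²` is zero and that of `D₋₂(u)` is `4 -
  -- (Q-4)² + (Q-2)(Q-4) = 2(Q-2)`.
  rw [hdev] at hAG
  rw [hY] at hW
  rw [hBg, hBU, hY] at hBL
  rw [hBB, hBL] at hAG
  generalize ∫ p, rho p ^ (-6 : ℝ) * (‖p.1‖ ^ 2 * (euler (euler u) p * euler u p)) = N12 at *
  generalize ∫ p, rho p ^ (-6 : ℝ) * (‖p.1‖ ^ 2 * euler u p ^ 2) = e at *
  generalize ∫ p, rho p ^ (-2 : ℝ) * gradSq u p = D at *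
  generalize ∫ p, rho p ^ (-2 : ℝ) * gradSq (euler u) p = X at *
  generalize ∫ p, rho p ^ (-2 : ℝ) * gradInner (euler (euler u)) u p = W at *
  have hN12 : N12 = -(q - 4) / 2 * e := by linarith
  have hW' : W = -(q + -2 - 2) * (-(q + -2 - 2) / 2 * D) - X := by linarith
  rw [hN12, hW'] at hAG
  linarith

/-- Both forms of the second order uncertainty principle. -/
lemma uncertainty (hn : 3 ≤ n) (hu : u ∈ testFunctionsConst n) (b lam : ℝ)
    (hl : lam ^ 2 - (homDim n - 4) * lam - 2 * (homDim n - 2) = 0) :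
    |lam - (homDim n - b - 3) / 2| * gradEnergy (-b - 1) u ≤
      √(lapEnergy u) * √(gradEnergy (-2 * b) u) := by
  have hU : ContDiff ℝ ∞ (euler u) := contDiff_euler hu.1
  have hU1 : ContDiff ℝ 1 (euler u) := hU.of_le (by simp)
  have hu1 : ContDiff ℝ 1 u := hu.1.of_le (by simp)
  have hS : ∀ s : ℝ, Integrable fun p => rho p ^ s * gradSq u p := fun s =>
    (suppOff_gradSq hu).integrable_rho_rpow_mul (continuous_gradSq hu1) s
  have hX : Integrable fun p => rho p ^ (-2 : ℝ) * gradSq (euler u) p :=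
    SuppOff.integrable_rho_rpow_mul ((suppOff_euler hu).fderiv.mono_zero fun p hp => by
      simp [gradSq, dX, dT, hp]) (continuous_gradSq hU1) _
  have hP := fun s => integrable_gradInner hu hU s
  -- `A` is `|∇Zu + λ∇u|²`, expanded.
  let A : Space n → ℝ := fun p => gradSq (euler u) p + 2 * lam * gradInner (euler u) u p +
    lam ^ 2 * gradSq u p
  have hcs : ∀ p, (gradInner (euler u) u p + lam * gradSq u p) ^ 2 ≤ A p * gradSq u p := fun p => by
    have := gradInner_sq_le (euler u) u p
    simp only [A]
    linarith
  have hA0 : ∀ p, 0 ≤ A p := fun p => by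
    have h1 := gradInner_sq_le (euler u) u p
    have h2 := gradSq_nonneg u p
    have h3 := gradSq_nonneg (euler u) p
    rcases h2.eq_or_lt with h | h
    · rw [← h, mul_zero] at h1
      have : gradInner (euler u) u p = 0 := by nlinarith
      simp only [A, this, ← h]
      linarith
    · exact nonneg_of_mul_nonneg_left ((sq_nonneg _).trans (hcs p)) h
  have iA1 : Integrable fun p => rho p ^ (-2 : ℝ) * gradSq (euler u) p +
      2 * lam * (rho p ^ (-2 : ℝ) * gradInner (euler u) u p) := hX.add ((hP _).const_mul _)
  have hAe : ∀ p, rho p ^ (-2 : ℝ) * A p = rho p ^ (-2 : ℝ) * gradSq (euler u) p +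
      2 * lam * (rho p ^ (-2 : ℝ) * gradInner (euler u) u p) +
      lam ^ 2 * (rho p ^ (-2 : ℝ) * gradSq u p) := fun p => by simp only [A]; ring
  have iA : Integrable fun p => rho p ^ (-2 : ℝ) * A p := by
    simp only [hAe]; exact iA1.add ((hS _).const_mul _)
  -- The cross term equals `-(Q-4)λ D₋₂(u)`, so the equation for `λ` makes this integral exactly the
  -- lower bound of `lapEnergy_ge`.
  have hAint : ∫ p, rho p ^ (-2 : ℝ) * A p ≤ lapEnergy u := by
    refine le_trans (le_of_eq ?_) (lapEnergy_ge hn hu)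
    simp only [hAe]
    rw [integral_add iA1 ((hS _).const_mul _), integral_add hX ((hP _).const_mul _),
      integral_const_mul, integral_const_mul, integral_gradInner_euler_self hu]
    simp only [gradEnergy, gradDensity]
    linear_combination (∫ p, rho p ^ (-2 : ℝ) * gradSq u p) * hl
  have hCS := abs_integral_le_sqrt_mul_sqrt (f := fun p => rho p ^ (-b - 1) *
    (gradInner (euler u) u p + lam * gradSq u p)) iA (hS (-2 * b))
    (fun p => mul_nonneg (Real.rpow_nonneg (rho_nonneg p) _) (hA0 p))
    (fun p => mul_nonneg (Real.rpow_nonneg (rho_nonneg p) _) (gradSq_nonneg u p)) fun p => by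
      -- The origin is separated because the laws of exponents for `ϱ` need `ϱ > 0`; there both
      -- gradients vanish.
      by_cases hp : p = 0
      · have h0 : gradSq u p = 0 := by
          have := (suppOff_gradSq hu).eventually_zero.self_of_nhds
          rw [hp]; exact this
        have h1 : gradInner (euler u) u p = 0 := by
          have := (suppOff_gradInner hu (euler u)).eventually_zero.self_of_nhds
          rw [hp]; exact this
        simp [h0, h1]
      · have hr := rho_pos hp
        have h2 : (rho p ^ (-b - 1)) ^ 2 = rho p ^ (-2 : ℝ) * rho p ^ (-2 * b) := by
          rw [← Real.rpow_natCast, ← Real.rpow_mul hr.le, rho_rpow_mul hp]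
          congr 1; push_cast; ring
        rw [mul_pow, h2]
        calc _ ≤ rho p ^ (-2 : ℝ) * rho p ^ (-2 * b) * (A p * gradSq u p) := by
              gcongr; exact hcs p
          _ = _ := by ring
  have hI : ∫ p, rho p ^ (-b - 1) * (gradInner (euler u) u p + lam * gradSq u p) =
      (lam - (homDim n - b - 3) / 2) * gradEnergy (-b - 1) u := by
    have h := integral_gradInner_euler_self hu (-b - 1)
    simp only [mul_add, mul_left_comm _ lam]
    rw [integral_add (hP _) ((hS _).const_mul _), integral_const_mul, h]
    simp only [gradEnergy, gradDensity]
    ring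
  have hD0 : 0 ≤ gradEnergy (-b - 1) u := integral_nonneg fun p =>
    mul_nonneg (Real.rpow_nonneg (rho_nonneg p) _) (gradSq_nonneg u p)
  rw [hI, abs_mul, abs_of_nonneg hD0] at hCS
  refine hCS.trans (mul_le_mul_of_nonneg_right (Real.sqrt_le_sqrt hAint) (Real.sqrt_nonneg _))

/-- The root `λ = -2`, for which `λ - (Q-b-3)/2 = -(Q+1-b)/2`. -/
lemma uncertainty_of_one_sub (hn : 3 ≤ n) (hu : u ∈ testFunctionsConst n) (b : ℝ) :
    Uncertainty (-2 * b) (-b - 1) ((homDim n + 1 - b) / 2) u := by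
  have h := uncertainty hn hu b (-2) (by ring)
  have hD0 : 0 ≤ gradEnergy (-b - 1) u := integral_nonneg fun p =>
    mul_nonneg (Real.rpow_nonneg (rho_nonneg p) _) (gradSq_nonneg u p)
  refine le_trans (mul_le_mul_of_nonneg_right ?_ hD0) h
  refine le_trans (le_of_eq ?_) (neg_le_abs _)
  ring

/-- The root `λ = Q-2`, for which `λ - (Q-b-3)/2 = (Q+b-1)/2`. -/
lemma uncertainty_of_sub_one (hn : 3 ≤ n) (hu : u ∈ testFunctionsConst n) (b : ℝ) :
    Uncertainty (-2 * b) (-b - 1) ((homDim n + b - 1) / 2) u := by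
  have h := uncertainty hn hu b (homDim n - 2) (by ring)
  have hD0 : 0 ≤ gradEnergy (-b - 1) u := integral_nonneg fun p =>
    mul_nonneg (Real.rpow_nonneg (rho_nonneg p) _) (gradSq_nonneg u p)
  refine le_trans (mul_le_mul_of_nonneg_right ?_ hD0) h
  refine le_trans (le_of_eq ?_) (le_abs_self _)
  ring

end Admissible

/-! ### Radial functions -/

lemma fderiv_rho {p : Space n} (hp : p ≠ 0) (v : Space n) :
    fderiv ℝ (rho : Space n → ℝ) p v =
      rho p ^ (-3 : ℝ) * (‖p.1‖ ^ 2 * inner ℝ p.1 v.1 + 2 * p.2 * v.2) := by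
  have h := fderiv_rho_rpow 1 hp v
  simp only [Real.rpow_one, one_mul] at h
  rw [show (1 - 4 : ℝ) = -3 by norm_num] at h
  exact h

lemma gradSq_comp_rho {U : ℝ → ℝ} {U' : ℝ} {p : Space n} (hp : p ≠ 0)
    (hU : HasDerivAt U U' (rho p)) :
    gradSq (fun p => U (rho p)) p = ‖p.1‖ ^ 2 / rho p ^ 2 * U' ^ 2 := by
  have hr := rho_pos hp
  have h3 : rho p ^ (-3 : ℝ) = (rho p ^ 3)⁻¹ := by
    rw [Real.rpow_neg hr.le]; norm_cast
  rw [← gradInner_self, gradInner_comp_rho hp hU, euler_comp_rho hp hU, h3]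
  field_simp

lemma lap_comp_rho {U V V' : ℝ → ℝ} (hU : ∀ s > 0, HasDerivAt U (V s) s)
    (hV : ∀ s > 0, HasDerivAt V (V' s) s) {p : Space n} (hp : p ≠ 0) :
    lap (fun p => U (rho p)) p =
      ‖p.1‖ ^ 2 / rho p ^ 2 * (V' (rho p) + ((n : ℝ) + 1) * (V (rho p) / rho p)) := by
  have hr := rho_pos hp
  have hev : ∀ᶠ q in 𝓝 p, q ≠ 0 := isOpen_ne.mem_nhds hp
  -- With this quotient the Euclidean gradient of `U(ϱ)` is `W(ϱ)(|x|²x, 2t)`, a scalar times a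
  -- polynomial field, convenient for the second derivatives.
  let W : ℝ → ℝ := fun s => V s * (s ^ 3)⁻¹
  let W' : ℝ := V' (rho p) * (rho p ^ 3)⁻¹ - 3 * V (rho p) * (rho p ^ 4)⁻¹
  have hW : HasDerivAt W W' (rho p) := by
    refine ((hV _ hr).mul ((hasDerivAt_pow 3 (rho p)).fun_inv (by positivity))).congr_deriv ?_
    simp only [W']
    field_simp
    ring
  have hfd : ∀ q : Space n, q ≠ 0 → ∀ v : Space n, fderiv ℝ (fun p => U (rho p)) q v =
      W (rho q) * (‖q.1‖ ^ 2 * inner ℝ q.1 v.1 + 2 * q.2 * v.2) := fun q hq v => by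
    have hrq := rho_pos hq
    have h3 : rho q ^ (-3 : ℝ) = (rho q ^ 3)⁻¹ := by
      rw [Real.rpow_neg hrq.le]; norm_cast
    rw [(fderiv_comp_rho hq (hU _ hrq)).fderiv, smul_apply, fderiv_rho hq, h3]
    simp only [W, smul_eq_mul]
    ring
  have hWd := fderiv_comp_rho hp hW
  have h3 : rho p ^ (-3 : ℝ) = (rho p ^ 3)⁻¹ := by
    rw [Real.rpow_neg hr.le]; norm_cast
  have hX : ∀ i, dX i (dX i fun p => U (rho p)) p =
      W' * (rho p ^ 3)⁻¹ * ‖p.1‖ ^ 4 * p.1 i ^ 2 + W (rho p) * (2 * p.1 i ^ 2 + ‖p.1‖ ^ 2) := by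
    intro i
    have he : dX i (fun p => U (rho p)) =ᶠ[𝓝 p] fun q => W (rho q) * (‖q.1‖ ^ 2 * q.1 i) :=
      hev.mono fun q hq => by
        simp only [dX, hfd q hq, inner_single_right]; ring
    have hc : HasFDerivAt (fun q : Space n => q.1 i)
        ((EuclideanSpace.proj i : EuclideanSpace ℝ (Fin n) →L[ℝ] ℝ).comp
          (ContinuousLinearMap.fst ℝ _ _)) p :=
      (EuclideanSpace.proj i : EuclideanSpace ℝ (Fin n) →L[ℝ] ℝ).hasFDerivAt.comp p hasFDerivAt_fst
    have hn2 : HasFDerivAt (fun q : Space n => ‖q.1‖ ^ 2) _ p :=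
      (hasFDerivAt_fst (𝕜 := ℝ) (p := p)).norm_sq
    have hproj : (EuclideanSpace.proj i : EuclideanSpace ℝ (Fin n) →L[ℝ] ℝ)
        (EuclideanSpace.single i 1) = 1 := by simp
    rw [dX, he.fderiv_eq, (hWd.fun_mul (hn2.fun_mul hc)).fderiv]
    simp only [add_apply, smul_apply, smul_eq_mul, fderiv_rho hp, h3, inner_single_right,
      ContinuousLinearMap.comp_apply, ContinuousLinearMap.coe_fst', innerSL_apply_apply,
      hproj, nsmul_eq_mul]
    push_cast
    ring
  have hT : dT (dT fun p => U (rho p)) p =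
      W' * (rho p ^ 3)⁻¹ * (4 * p.2 ^ 2) + W (rho p) * 2 := by
    have he : dT (fun p => U (rho p)) =ᶠ[𝓝 p] fun q => W (rho q) * (2 * q.2) :=
      hev.mono fun q hq => by
        simp only [dT, hfd q hq, inner_zero_right]; ring
    have hc : HasFDerivAt (fun q : Space n => 2 * q.2)
        ((2 : ℝ) • ContinuousLinearMap.snd ℝ (EuclideanSpace ℝ (Fin n)) ℝ) p :=
      hasFDerivAt_snd.const_mul 2
    rw [dT, he.fderiv_eq, (hWd.fun_mul hc).fderiv]
    simp only [add_apply, smul_apply, smul_eq_mul, fderiv_rho hp, h3, inner_zero_right,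
      ContinuousLinearMap.coe_snd']
    ring
  rw [lap, hT]
  simp only [hX, Finset.sum_add_distrib, ← Finset.mul_sum, sum_coord_sq, Finset.sum_const,
    Finset.card_univ, Fintype.card_fin, nsmul_eq_mul]
  have h4 := rho_pow_four p
  have ht : 4 * p.2 ^ 2 = rho p ^ 4 - ‖p.1‖ ^ 4 := by linarith
  rw [ht]
  simp only [W, W']
  field_simp
  ring

lemma lapDensity_comp_rho {U V V' : ℝ → ℝ} (hU : ∀ s > 0, HasDerivAt U (V s) s)
    (hV : ∀ s > 0, HasDerivAt V (V' s) s) {p : Space n} (hp : p ≠ 0) :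
    lapDensity (fun p => U (rho p)) p =
      ‖p.1‖ ^ 2 / rho p ^ 2 * (V' (rho p) + ((n : ℝ) + 1) * (V (rho p) / rho p)) ^ 2 := by
  rw [lapDensity, gradSq_rho hp, lap_comp_rho hU hV hp]
  -- On the `t`-axis both sides are 0, the left one by division by zero.
  by_cases h : ‖p.1‖ = 0
  · simp [h]
  · have hr := rho_pos hp
    have hx : 0 < ‖p.1‖ := lt_of_le_of_ne (norm_nonneg _) (Ne.symm h)
    have : ‖p.1‖ ^ 2 / rho p ^ 2 ≠ 0 := by positivity
    field_simp

lemma gradDensity_comp_rho {U V : ℝ → ℝ} (hU : ∀ s > 0, HasDerivAt U (V s) s) (r : ℝ)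
    {p : Space n} (hp : p ≠ 0) :
    gradDensity r (fun p => U (rho p)) p = ‖p.1‖ ^ 2 / rho p ^ 2 * (rho p ^ r * V (rho p) ^ 2) := by
  rw [gradDensity, gradSq_comp_rho hp (hU _ (rho_pos hp))]
  ring

/-- The total mass of `|∇_G ϱ|²` on the unit `ϱ`-sphere. -/
def angularMass (n : ℕ) : ℝ := ∫ θ, slopeRadius θ.1 ^ 2 ∂angular n

lemma integrable_slopeRadius_sq_angular (hn : 1 ≤ n) :
    Integrable (fun θ => slopeRadius θ.1 ^ 2) (angular n) := by
  have := integrable_angular hn (F := fun p => ‖p.1‖ ^ 2) (by fun_prop)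
  simpa only [norm_unitPoint_fst] using this

lemma angularMass_pos (hn : 1 ≤ n) : 0 < angularMass n := by
  have hc : ∀ y, 0 < slopeRadius y := slopeRadius_pos
  rw [angularMass, integral_pos_iff_support_of_nonneg (fun θ => sq_nonneg _)
    (integrable_slopeRadius_sq_angular hn)]
  have hs : Function.support (fun θ : ℝ × Sph n => slopeRadius θ.1 ^ 2) = univ :=
    eq_univ_of_forall fun θ => (pow_pos (hc _) 2).ne'
  rw [hs, pos_iff_ne_zero]
  -- If the angular measure vanished, polar coordinates would make Lebesgue measure zero.
  intro h
  have h0 := Measure.measure_univ_eq_zero.1 h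
  have hp := (measurePreserving_polar hn).map_eq
  rw [h0, Measure.prod_zero, Measure.map_zero] at hp
  exact (NeZero.ne (volume : Measure (Space n))) hp.symm

lemma integral_radialMeasure (k : ℕ) (h : ℝ → ℝ) :
    ∫ r, h r ∂radialMeasure k = ∫ r in Ioi (0 : ℝ), r ^ k * h r := by
  rw [radialMeasure, integral_withDensity_eq_integral_toReal_smul (by fun_prop) (by simp)]
  refine setIntegral_congr_fun measurableSet_Ioi fun r hr => ?_
  have : (0 : ℝ) < r := hr
  simp only [smul_eq_mul]
  rw [ENNReal.toReal_ofReal (by positivity)]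

lemma integrable_radialMeasure {k : ℕ} {h : ℝ → ℝ}
    (hh : IntegrableOn (fun r => r ^ k * h r) (Ioi 0)) : Integrable h (radialMeasure k) := by
  rw [radialMeasure, integrable_withDensity_iff_integrable_smul' (by fun_prop) (by simp)]
  refine IntegrableOn.congr_fun hh (fun r hr => ?_) measurableSet_Ioi
  have : (0 : ℝ) < r := hr
  simp only [smul_eq_mul]
  rw [ENNReal.toReal_ofReal (by positivity)]

lemma integrable_radial (hn : 1 ≤ n) {h : ℝ → ℝ} (hc : ContinuousOn h (Ioi 0))
    (hi : IntegrableOn (fun r => r ^ (n + 1) * h r) (Ioi 0)) :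
    Integrable fun p : Space n => ‖p.1‖ ^ 2 / rho p ^ 2 * h (rho p) := by
  have hm : AEStronglyMeasurable (fun p : Space n => h (rho p)) := by
    have : ContinuousOn (fun p : Space n => h (rho p)) {0}ᶜ :=
      hc.comp continuous_rho.continuousOn fun p hp => rho_pos hp
    have h2 := this.aestronglyMeasurable (μ := volume) (measurableSet_singleton _).compl
    rwa [restrict_compl_singleton] at h2
  refine integrable_of_polar_bound hn (measurable_gradSq_rho.aestronglyMeasurable.mul hm)
    (integrable_radialMeasure hi).abs (k := fun y => slopeRadius y ^ 2) ?_ fun r hr y ξ => ?_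
  · refine integrable_slopeMeasure_of (((integrable_slopeRadius_pow (by omega : 3 ≤ n + 4)).div_const
      2).congr (ae_of_all _ fun y => ?_))
    simp only
    ring
  · simp only [norm_dil_unitPoint_fst hr, rho_dil hr.le, rho_unitPoint, mul_one]
    have hc := slopeRadius_pos y
    rw [abs_mul, mul_comm, abs_of_nonneg (by positivity : 0 ≤ (r * slopeRadius y) ^ 2 / r ^ 2)]
    refine le_of_eq ?_
    field_simp

lemma integral_radial (hn : 1 ≤ n) {h : ℝ → ℝ}
    (hi : Integrable fun p : Space n => ‖p.1‖ ^ 2 / rho p ^ 2 * h (rho p)) :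
    ∫ p : Space n, ‖p.1‖ ^ 2 / rho p ^ 2 * h (rho p) =
      angularMass n * ∫ r in Ioi (0 : ℝ), r ^ (n + 1) * h r := by
  rw [integral_polar hn hi, ← integral_radialMeasure, ← integral_const_mul]
  refine integral_congr_ae ((ae_radialMeasure_pos _).mono fun r hr => ?_)
  simp only [norm_dil_unitPoint_fst hr, rho_dil hr.le, rho_unitPoint, mul_one, angularMass]
  rw [← integral_mul_const]
  refine integral_congr_ae (ae_of_all _ fun θ => ?_)
  simp only
  field_simp

/-! ### Energies of radial functions as one-dimensional integrals -/

section Energies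

variable {U V V' : ℝ → ℝ}

lemma lapEnergy_comp_rho (hn : 1 ≤ n) (hU : ∀ s > 0, HasDerivAt U (V s) s)
    (hV : ∀ s > 0, HasDerivAt V (V' s) s)
    (hi : Integrable (lapDensity fun p : Space n => U (rho p))) :
    lapEnergy (fun p : Space n => U (rho p)) = angularMass n *
      ∫ s in Ioi (0 : ℝ), s ^ (n + 1) * (V' s + ((n : ℝ) + 1) * (V s / s)) ^ 2 := by
  have hae := ae_ne_zero.mono fun (p : Space n) hp => lapDensity_comp_rho hU hV hp
  rw [lapEnergy, integral_congr_ae hae]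
  exact integral_radial hn (h := fun s => (V' s + ((n : ℝ) + 1) * (V s / s)) ^ 2) (hi.congr hae)

lemma gradEnergy_comp_rho (hn : 1 ≤ n) (hU : ∀ s > 0, HasDerivAt U (V s) s) (r : ℝ)
    (hi : Integrable (gradDensity r fun p : Space n => U (rho p))) :
    gradEnergy r (fun p : Space n => U (rho p)) = angularMass n *
      ∫ s in Ioi (0 : ℝ), s ^ (n + 1) * (s ^ r * V s ^ 2) := by
  have hae := ae_ne_zero.mono fun (p : Space n) hp => gradDensity_comp_rho hU r hp
  rw [gradEnergy, integral_congr_ae hae]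
  exact integral_radial hn (h := fun s => s ^ r * V s ^ 2) (hi.congr hae)

lemma integrable_lapDensity_comp_rho (hn : 1 ≤ n) (hU : ∀ s > 0, HasDerivAt U (V s) s)
    (hV : ∀ s > 0, HasDerivAt V (V' s) s) (hc : ContinuousOn V' (Ioi 0))
    (hi : IntegrableOn (fun s => s ^ (n + 1) * (V' s + ((n : ℝ) + 1) * (V s / s)) ^ 2) (Ioi 0)) :
    Integrable (lapDensity fun p : Space n => U (rho p)) := by
  have hae := ae_ne_zero.mono fun (p : Space n) hp => lapDensity_comp_rho hU hV hp
  have hVc : ContinuousOn V (Ioi 0) := fun s hs => (hV s hs).continuousAt.continuousWithinAt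
  refine Integrable.congr (integrable_radial hn (h := fun s => (V' s + ((n : ℝ) + 1) *
    (V s / s)) ^ 2) ?_ hi) (EventuallyEq.symm hae)
  exact (hc.add (continuousOn_const.mul (hVc.div continuousOn_id fun s hs => ne_of_gt hs))).pow 2

lemma integrable_gradDensity_comp_rho (hn : 1 ≤ n) (hU : ∀ s > 0, HasDerivAt U (V s) s)
    (hVc : ContinuousOn V (Ioi 0)) (r : ℝ)
    (hi : IntegrableOn (fun s => s ^ (n + 1) * (s ^ r * V s ^ 2)) (Ioi 0)) :
    Integrable (gradDensity r fun p : Space n => U (rho p)) := by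
  have hae := ae_ne_zero.mono fun (p : Space n) hp => gradDensity_comp_rho hU r hp
  refine Integrable.congr (integrable_radial hn (h := fun s => s ^ r * V s ^ 2) ?_ hi)
    (EventuallyEq.symm hae)
  exact (continuousOn_id.rpow_const fun s hs => Or.inl (ne_of_gt hs)).mul (hVc.pow 2)

end Energies

/-! ### Gamma integrals -/

section Gamma

variable {γ p m : ℝ}

/-- The integrand under `y = sᵖ`. The absolute value of `p` admits negative exponents, needed for `p
= 1 - b` with `b > 1`. -/
lemma rpow_mul_exp_comp (hp : p ≠ 0) {s : ℝ} (hs : 0 < s) :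
    (|p| * s ^ (p - 1)) * ((s ^ p) ^ ((m + 1) / p - 1) * Real.exp (-(γ * s ^ p))) =
      |p| * (s ^ m * Real.exp (-γ * s ^ p)) := by
  rw [← Real.rpow_mul hs.le, show p * ((m + 1) / p - 1) = m + 1 - p by field_simp]
  have : s ^ (p - 1) * s ^ (m + 1 - p) = s ^ m := by
    rw [← Real.rpow_add hs]; congr 1; ring
  rw [← this, neg_mul]
  ring

lemma integrableOn_rpow_mul_exp (hγ : 0 < γ) (hp : p ≠ 0) (hm : 0 < (m + 1) / p) :
    IntegrableOn (fun s => s ^ m * Real.exp (-γ * s ^ p)) (Ioi 0) := by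
  have h2 : IntegrableOn (fun y => y ^ ((m + 1) / p - 1) * Real.exp (-(γ * y))) (Ioi 0) := by
    have := integrableOn_rpow_mul_exp_neg_mul_rpow (s := (m + 1) / p - 1) (p := 1) (b := γ)
      (by linarith) one_pos hγ
    simpa only [Real.rpow_one, neg_mul] using this
  have h3 := (integrableOn_Ioi_comp_rpow_iff _ hp).2 h2
  have h4 : IntegrableOn (fun s => |p| * (s ^ m * Real.exp (-γ * s ^ p))) (Ioi 0) :=
    h3.congr_fun (fun s hs => rpow_mul_exp_comp hp hs) measurableSet_Ioi
  have h5 : IntegrableOn (fun s => |p|⁻¹ * (|p| * (s ^ m * Real.exp (-γ * s ^ p)))) (Ioi 0) :=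
    h4.const_mul _
  refine h5.congr_fun (fun s _ => ?_) measurableSet_Ioi
  have : |p| ≠ 0 := abs_ne_zero.2 hp
  simp only
  field_simp

lemma integral_rpow_mul_exp (hγ : 0 < γ) (hp : p ≠ 0) (hm : 0 < (m + 1) / p) :
    |p| * ∫ s in Ioi (0 : ℝ), s ^ m * Real.exp (-γ * s ^ p) =
      (1 / γ) ^ ((m + 1) / p) * Real.Gamma ((m + 1) / p) := by
  rw [← Real.integral_rpow_mul_exp_neg_mul_Ioi hm hγ, ← integral_const_mul,
    ← integral_comp_rpow_Ioi (fun t => t ^ ((m + 1) / p - 1) * Real.exp (-(γ * t))) hp]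
  refine setIntegral_congr_fun measurableSet_Ioi fun s hs => ?_
  simp only [smul_eq_mul]
  exact (rpow_mul_exp_comp hp hs).symm

lemma integral_rpow_mul_exp_pos (hγ : 0 < γ) (hp : p ≠ 0) (hm : 0 < (m + 1) / p) :
    0 < ∫ s in Ioi (0 : ℝ), s ^ m * Real.exp (-γ * s ^ p) := by
  have h := integral_rpow_mul_exp hγ hp hm
  have h2 : 0 < |p| := abs_pos.2 hp
  have h3 : 0 < (1 / γ) ^ ((m + 1) / p) * Real.Gamma ((m + 1) / p) :=
    mul_pos (by positivity) (Real.Gamma_pos_of_pos hm)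
  rw [← h] at h3
  exact (mul_pos_iff_of_pos_left h2).1 h3

/-- This is `Γ(z+1) = zΓ(z)` at `z = (m+1)/p`; it relates the three energies of an extremal
function. -/
lemma integral_rpow_mul_exp_succ (hγ : 0 < γ) (hp : p ≠ 0) (hm : 0 < (m + 1) / p) :
    γ * p * ∫ s in Ioi (0 : ℝ), s ^ (m + p) * Real.exp (-γ * s ^ p) =
      (m + 1) * ∫ s in Ioi (0 : ℝ), s ^ m * Real.exp (-γ * s ^ p) := by
  have e : (m + p + 1) / p = (m + 1) / p + 1 := by field_simp; ring
  have h1 := integral_rpow_mul_exp hγ hp hm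
  have h2 := integral_rpow_mul_exp (m := m + p) hγ hp (by rw [e]; positivity)
  rw [e, Real.Gamma_add_one hm.ne', Real.rpow_add (by positivity), Real.rpow_one] at h2
  have h3 : |p| ≠ 0 := abs_ne_zero.2 hp
  refine mul_left_cancel₀ h3 ?_
  calc |p| * (γ * p * ∫ s in Ioi (0 : ℝ), s ^ (m + p) * Real.exp (-γ * s ^ p))
      = γ * p * (|p| * ∫ s in Ioi (0 : ℝ), s ^ (m + p) * Real.exp (-γ * s ^ p)) := by ring
    _ = (m + 1) * ((1 / γ) ^ ((m + 1) / p) * Real.Gamma ((m + 1) / p)) := by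
      rw [h2]; field_simp
    _ = _ := by rw [← h1]; ring

/-- Powers times the exponential are bounded on the half line. -/
lemma exists_bound_rpow_mul_exp (hγ : 0 < γ) (hm : 0 ≤ m / p) (hp : p ≠ 0) :
    ∃ M, ∀ s > 0, s ^ m * Real.exp (-γ * s ^ p) ≤ M := by
  -- With `y = sᵖ`, use `y^{m/p} ≤ 1 + y^N` and the exponential series bound `(γy)^N/N! ≤ e^{γy}`.
  obtain ⟨N, hN⟩ := exists_nat_ge (m / p)
  refine ⟨1 + (N.factorial : ℝ) / γ ^ N, fun s hs => ?_⟩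
  set y := s ^ p with hy
  have hy0 : 0 < y := Real.rpow_pos_of_pos hs _
  have hs' : s ^ m = y ^ (m / p) := by
    rw [hy, ← Real.rpow_mul hs.le]; congr 1; field_simp
  have h1 : y ^ (m / p) ≤ 1 + y ^ N := by
    rcases le_total y 1 with h | h
    · have := Real.rpow_le_one hy0.le h hm
      have := pow_pos hy0 N
      linarith
    · have := Real.rpow_le_rpow_of_exponent_le h hN
      rw [Real.rpow_natCast] at this
      linarith
  have h2 := Real.pow_div_factorial_le_exp (γ * y) (by positivity) N
  have h3 : Real.exp (-γ * y) * Real.exp (γ * y) = 1 := by rw [← Real.exp_add]; simp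
  have h4 : Real.exp (-γ * y) ≤ 1 := Real.exp_le_one_iff.2 (by nlinarith)
  have hf : (0 : ℝ) < N.factorial := by exact_mod_cast N.factorial_pos
  have h5 : y ^ N * Real.exp (-γ * y) ≤ (N.factorial : ℝ) / γ ^ N := by
    rw [le_div_iff₀ (by positivity)]
    have := mul_le_mul_of_nonneg_right h2 (Real.exp_pos (-γ * y)).le
    rw [mul_comm (Real.exp (γ * y)), h3, mul_pow, div_mul_eq_mul_div, div_le_one hf] at this
    linarith
  rw [hs']
  calc y ^ (m / p) * Real.exp (-γ * y) ≤ (1 + y ^ N) * Real.exp (-γ * y) := by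
        gcongr
    _ ≤ _ := by linarith

end Gamma

/-! ### Primitives on half lines -/

lemma hasDerivAt_integral_Ioi {g : ℝ → ℝ} (hi : IntegrableOn g (Ioi 0))
    (hc : ContinuousOn g (Ioi 0)) {s : ℝ} (hs : 0 < s) :
    HasDerivAt (fun s => ∫ t in Ioi s, g t) (-g s) s := by
  have hsub : ∀ {r}, 0 < r → IntegrableOn g (Ioi r) := fun hr =>
    hi.mono_set (Ioi_subset_Ioi hr.le)
  have hev : (fun s => ∫ t in Ioi s, g t) =ᶠ[𝓝 s]
      fun r => (∫ t in Ioi s, g t) - ∫ t in s..r, g t := by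
    filter_upwards [lt_mem_nhds hs] with r hr
    -- The tail is differentiated as a constant minus an interval integral.
    rw [← intervalIntegral.integral_Ioi_sub_Ioi' (hsub hs) (hsub hr)]
    ring
  have hcs : ContinuousAt g s := hc.continuousAt (Ioi_mem_nhds hs)
  have hsm : StronglyMeasurableAtFilter g (𝓝 s) :=
    hc.stronglyMeasurableAtFilter isOpen_Ioi s hs
  have := (intervalIntegral.integral_hasDerivAt_right (a := s) (b := s)
    IntervalIntegrable.refl hsm hcs).const_sub (∫ t in Ioi s, g t)
  exact this.congr_of_eventuallyEq hev

lemma contDiffOn_of_hasDerivAt {U V : ℝ → ℝ} (hU : ∀ s > 0, HasDerivAt U (V s) s)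
    (hV : ContDiffOn ℝ ∞ V (Ioi 0)) : ContDiffOn ℝ ∞ U (Ioi 0) := by
  rw [contDiffOn_infty_iff_deriv_of_isOpen isOpen_Ioi]
  exact ⟨fun s hs => (hU s hs).differentiableAt.differentiableWithinAt,
    hV.congr fun s hs => (hU s hs).deriv⟩

lemma contDiffOn_comp_rho {U : ℝ → ℝ} (hU : ContDiffOn ℝ ∞ U (Ioi 0)) :
    ContDiffOn ℝ ∞ (fun p : Space n => U (rho p)) {0}ᶜ :=
  hU.comp contDiffOn_rho fun _ hp => rho_pos hp

/-! ### Extremal profiles -/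

/-- `V` is the radial derivative of an extremal function: the three radial integrals are finite and
satisfy the equality. -/
structure IsExtremal (n : ℕ) (s r K : ℝ) (V V' : ℝ → ℝ) : Prop where
  hasDerivAt : ∀ t > 0, HasDerivAt V (V' t) t
  contDiffOn : ContDiffOn ℝ ∞ V (Ioi 0)
  integrable_lap :
    IntegrableOn (fun t => t ^ (n + 1) * (V' t + ((n : ℝ) + 1) * (V t / t)) ^ 2) (Ioi 0)
  integrable_left : IntegrableOn (fun t => t ^ (n + 1) * (t ^ s * V t ^ 2)) (Ioi 0)
  integrable_right : IntegrableOn (fun t => t ^ (n + 1) * (t ^ r * V t ^ 2)) (Ioi 0)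
  equality : √(∫ t in Ioi (0 : ℝ), t ^ (n + 1) * (V' t + ((n : ℝ) + 1) * (V t / t)) ^ 2) *
    √(∫ t in Ioi (0 : ℝ), t ^ (n + 1) * (t ^ s * V t ^ 2)) =
      K * ∫ t in Ioi (0 : ℝ), t ^ (n + 1) * (t ^ r * V t ^ 2)

lemma IsExtremal.continuousOn_deriv {s r K : ℝ} {V V' : ℝ → ℝ} (h : IsExtremal n s r K V V') :
    ContinuousOn V' (Ioi 0) :=
  (h.contDiffOn.continuousOn_deriv_of_isOpen isOpen_Ioi (by simp)).congr fun t ht =>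
    (h.hasDerivAt t ht).deriv.symm

lemma IsExtremal.finiteEnergies (hn : 1 ≤ n) {s r K : ℝ} {U V V' : ℝ → ℝ}
    (h : IsExtremal n s r K V V') (hU : ∀ t > 0, HasDerivAt U (V t) t) :
    FiniteEnergies s r fun p : Space n => U (rho p) :=
  ⟨integrable_lapDensity_comp_rho hn hU h.hasDerivAt h.continuousOn_deriv h.integrable_lap,
    integrable_gradDensity_comp_rho hn hU h.contDiffOn.continuousOn s h.integrable_left,
    integrable_gradDensity_comp_rho hn hU h.contDiffOn.continuousOn r h.integrable_right⟩

lemma sqrt_const_mul_mul_sqrt {C a b : ℝ} (hC : 0 ≤ C) : √(C * a) * √(C * b) = C * (√a * √b) := by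
  rw [Real.sqrt_mul hC, Real.sqrt_mul hC]
  linear_combination √a * √b * Real.mul_self_sqrt hC

lemma IsExtremal.isEqualityCase (hn : 1 ≤ n) {s r K : ℝ} {U V V' : ℝ → ℝ}
    (h : IsExtremal n s r K V V') (hU : ∀ t > 0, HasDerivAt U (V t) t) :
    IsEqualityCase s r K fun p : Space n => U (rho p) := by
  have hf := h.finiteEnergies hn hU
  refine ⟨contDiffOn_comp_rho (contDiffOn_of_hasDerivAt hU h.contDiffOn), hf, ?_⟩
  rw [lapEnergy_comp_rho hn hU h.hasDerivAt hf.1, gradEnergy_comp_rho hn hU s hf.2.1,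
    gradEnergy_comp_rho hn hU r hf.2.2, sqrt_const_mul_mul_sqrt (angularMass_pos hn).le, h.equality]
  ring

lemma IsExtremal.gradEnergy_pos (hn : 1 ≤ n) {s r K : ℝ} {U V V' : ℝ → ℝ}
    (h : IsExtremal n s r K V V') (hU : ∀ t > 0, HasDerivAt U (V t) t)
    (hpos : 0 < ∫ t in Ioi (0 : ℝ), t ^ (n + 1) * (t ^ r * V t ^ 2)) :
    0 < gradEnergy r fun p : Space n => U (rho p) := by
  rw [gradEnergy_comp_rho hn hU r (h.finiteEnergies hn hU).2.2]
  exact mul_pos (angularMass_pos hn) hpos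

/-- The three radial integrals are determined by one Gamma integral. -/
lemma isExtremal_of_integrals {s r K B I J : ℝ} {V V' : ℝ → ℝ} (hB : 0 ≤ B) (hI : 0 ≤ I)
    (hV : ∀ t > 0, HasDerivAt V (V' t) t) (hc : ContDiffOn ℝ ∞ V (Ioi 0))
    (i1 : IntegrableOn (fun t => t ^ (n + 1) * (V' t + ((n : ℝ) + 1) * (V t / t)) ^ 2) (Ioi 0))
    (i2 : IntegrableOn (fun t => t ^ (n + 1) * (t ^ s * V t ^ 2)) (Ioi 0))
    (i3 : IntegrableOn (fun t => t ^ (n + 1) * (t ^ r * V t ^ 2)) (Ioi 0))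
    (e1 : ∫ t in Ioi (0 : ℝ), t ^ (n + 1) * (V' t + ((n : ℝ) + 1) * (V t / t)) ^ 2 = B ^ 2 * I)
    (e2 : ∫ t in Ioi (0 : ℝ), t ^ (n + 1) * (t ^ s * V t ^ 2) = I)
    (e3 : ∫ t in Ioi (0 : ℝ), t ^ (n + 1) * (t ^ r * V t ^ 2) = J) (hK : B * I = K * J) :
    IsExtremal n s r K V V' := by
  refine ⟨hV, hc, i1, i2, i3, ?_⟩
  rw [e1, e2, e3, ← hK, Real.sqrt_mul (sq_nonneg B), Real.sqrt_sq hB, mul_assoc,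
    Real.mul_self_sqrt hI]

lemma hasDerivAt_exp_rpow (δ p : ℝ) {t : ℝ} (ht : 0 < t) :
    HasDerivAt (fun t => Real.exp (-δ * t ^ p)) (-δ * p * t ^ (p - 1) * Real.exp (-δ * t ^ p)) t := by
  refine (((Real.hasDerivAt_rpow_const (Or.inl ht.ne')).const_mul (-δ)).exp).congr_deriv ?_
  ring

lemma contDiffOn_exp_rpow (δ p : ℝ) : ContDiffOn ℝ ∞ (fun t : ℝ => Real.exp (-δ * t ^ p)) (Ioi 0) :=
  (contDiffOn_const.mul (contDiffOn_id.rpow_const_of_ne fun _ ht => ne_of_gt ht)).exp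

lemma exp_neg_sq (δ x : ℝ) : Real.exp (-δ * x) ^ 2 = Real.exp (-(2 * δ) * x) := by
  rw [← Real.exp_nat_mul]; congr 1; push_cast; ring

/-- The extremal profile for `b < 1`. -/
def profileLT (b β : ℝ) (t : ℝ) : ℝ := t * Real.exp (-(β / (1 - b)) * t ^ (1 - b))

/-- The extremal profile for `b > 1`. -/
def profileGT (n : ℕ) (b β : ℝ) (t : ℝ) : ℝ :=
  t ^ (-(n : ℝ) - 1) * Real.exp (-(β / (b - 1)) * t ^ (1 - b))

/-! ### The profile for `b < 1` -/

section LT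

variable {b β : ℝ}

lemma contDiffOn_profileLT : ContDiffOn ℝ ∞ (profileLT b β) (Ioi 0) :=
  contDiffOn_id.mul (contDiffOn_exp_rpow _ _)

lemma hasDerivAt_profileLT (hb : b < 1) {t : ℝ} (ht : 0 < t) :
    HasDerivAt (profileLT b β)
      ((1 - β * t ^ (1 - b)) * Real.exp (-(β / (1 - b)) * t ^ (1 - b))) t := by
  have hb' : 1 - b ≠ 0 := by linarith
  refine ((hasDerivAt_id t).mul (hasDerivAt_exp_rpow (β / (1 - b)) (1 - b) ht)).congr_deriv ?_
  have h : t ^ (1 - b) = t * t ^ (1 - b - 1) := by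
    rw [mul_comm, ← Real.rpow_add_one ht.ne']; congr 1; ring
  simp only [id]
  rw [show -(β / (1 - b)) * (1 - b) = -β by field_simp]
  linear_combination (β * Real.exp (-(β / (1 - b)) * t ^ (1 - b))) * h

/-- The profile solves `tV' - V = -βt^{1-b}V`, the equality case of Cauchy–Schwarz for `λ = -2`. -/
lemma isExtremal_profileLT (hb : b < 1) (hβ : 0 < β) (κ : ℝ) :
    IsExtremal n (-2 * b) (-b - 1) ((homDim n + 1 - b) / 2) (fun t => κ * profileLT b β t)
      (fun t => κ * ((1 - β * t ^ (1 - b)) * Real.exp (-(β / (1 - b)) * t ^ (1 - b)))) ∧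
    (κ ≠ 0 → 0 < ∫ t in Ioi (0 : ℝ), t ^ (n + 1) * (t ^ (-b - 1) * (κ * profileLT b β t) ^ 2)) := by
  obtain ⟨c, hc⟩ : ∃ c, c = 1 - b := ⟨_, rfl⟩
  have hc0 : 0 < c := by linarith
  obtain rfl : b = 1 - c := by linarith
  set γ := 2 * (β / c) with hγ
  have hγ0 : 0 < γ := by positivity
  have hγc : γ * c = 2 * β := by rw [hγ]; field_simp
  let J : ℝ → ℝ := fun m => ∫ t in Ioi (0 : ℝ), t ^ m * Real.exp (-γ * t ^ c)
  have iJ : ∀ {m : ℝ}, 0 ≤ m → IntegrableOn (fun t => t ^ m * Real.exp (-γ * t ^ c)) (Ioi 0) :=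
    fun {m} hm => integrableOn_rpow_mul_exp hγ0 hc0.ne' (by positivity)
  have hn0 : (0 : ℝ) ≤ n := Nat.cast_nonneg n
  have hJ1 : 2 * β * J (n + 1 + c) = homDim n * J (n + 1) := by
    have := integral_rpow_mul_exp_succ (m := (n : ℝ) + 1) hγ0 hc0.ne' (by positivity)
    rw [hγc] at this
    rw [homDim, show (n : ℝ) + 2 = n + 1 + 1 by ring]
    exact this
  have hJ2 : 2 * β * J (n + 1 + c + c) = (homDim n + c) * J (n + 1 + c) := by
    have := integral_rpow_mul_exp_succ (m := (n : ℝ) + 1 + c) hγ0 hc0.ne' (by positivity)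
    rw [hγc] at this
    rw [homDim, show (n : ℝ) + 2 + c = n + 1 + c + 1 by ring]
    exact this
  have hcc : 1 - (1 - c) = c := by ring
  have hE : ∀ t : ℝ, Real.exp (-(β / c) * t ^ c) ^ 2 = Real.exp (-γ * t ^ c) := fun t =>
    exp_neg_sq _ _
  have hpow : ∀ {t : ℝ}, 0 < t → ∀ k : ℝ, t ^ (n + 1) * t ^ k = t ^ ((n : ℝ) + 1 + k) := by
    intro t ht k
    rw [Real.rpow_add ht]; norm_cast
  -- Here `V' + (n+1)V/t` is `κ(Q - βtᶜ)` times the exponential; its square gives three Gamma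
  -- integrals.
  have q1 : ∀ t ∈ Ioi (0 : ℝ), t ^ (n + 1) * (κ * ((1 - β * t ^ (1 - (1 - c))) *
      Real.exp (-(β / (1 - (1 - c))) * t ^ (1 - (1 - c)))) +
        ((n : ℝ) + 1) * (κ * profileLT (1 - c) β t / t)) ^ 2 =
      κ ^ 2 * homDim n ^ 2 * (t ^ ((n : ℝ) + 1) * Real.exp (-γ * t ^ c)) -
        κ ^ 2 * (2 * β * homDim n) * (t ^ ((n : ℝ) + 1 + c) * Real.exp (-γ * t ^ c)) +
        κ ^ 2 * β ^ 2 * (t ^ ((n : ℝ) + 1 + c + c) * Real.exp (-γ * t ^ c)) := fun t ht => by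
    have ht : 0 < t := ht
    have h0 := hpow ht 0
    rw [Real.rpow_zero, mul_one, add_zero] at h0
    have h1 := hpow ht c
    have h2 := hpow ht (c + c)
    rw [Real.rpow_add ht, ← add_assoc] at h2
    rw [← h0, ← h1, ← h2, ← hE, profileLT, hcc, homDim]
    field_simp
    ring
  have q2 : ∀ t ∈ Ioi (0 : ℝ), t ^ (n + 1) * (t ^ (-2 * (1 - c)) * (κ * profileLT (1 - c) β t) ^ 2) =
      κ ^ 2 * (t ^ ((n : ℝ) + 1 + c + c) * Real.exp (-γ * t ^ c)) := fun t ht => by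
    have ht : 0 < t := ht
    have h2 := hpow ht (c + c)
    have h3 : t ^ (-2 * (1 - c)) * t ^ 2 = t ^ (c + c) := by
      rw [← Real.rpow_natCast, ← Real.rpow_add ht]; congr 1; push_cast; ring
    rw [← add_assoc] at h2
    rw [← h2, ← h3, ← hE, profileLT, hcc]
    ring
  have q3 : ∀ t ∈ Ioi (0 : ℝ), t ^ (n + 1) * (t ^ (-(1 - c) - 1) * (κ * profileLT (1 - c) β t) ^ 2) =
      κ ^ 2 * (t ^ ((n : ℝ) + 1 + c) * Real.exp (-γ * t ^ c)) := fun t ht => by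
    have ht : 0 < t := ht
    have h2 := hpow ht c
    have h3 : t ^ (-(1 - c) - 1) * t ^ 2 = t ^ c := by
      rw [← Real.rpow_natCast, ← Real.rpow_add ht]; congr 1; push_cast; ring
    rw [← h2, ← hE, profileLT, hcc]
    linear_combination (κ ^ 2 * t ^ (n + 1) * Real.exp (-(β / c) * t ^ c) ^ 2) * h3
  have i0 := iJ (m := (n : ℝ) + 1) (by positivity)
  have i1 := iJ (m := (n : ℝ) + 1 + c) (by positivity)
  have i2 := iJ (m := (n : ℝ) + 1 + c + c) (by positivity)
  have e3 : ∫ t in Ioi (0 : ℝ), t ^ (n + 1) * (t ^ (-(1 - c) - 1) * (κ * profileLT (1 - c) β t) ^ 2) =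
      κ ^ 2 * J (n + 1 + c) := by
    rw [setIntegral_congr_fun measurableSet_Ioi q3, integral_const_mul]
  have hJ2pos : 0 < J (n + 1 + c + c) := integral_rpow_mul_exp_pos hγ0 hc0.ne' (by positivity)
  refine ⟨isExtremal_of_integrals (B := β) (I := κ ^ 2 * J (n + 1 + c + c))
    (J := κ ^ 2 * J (n + 1 + c)) hβ.le (by positivity)
    (fun t ht => (hasDerivAt_profileLT hb ht).const_mul κ)
    (contDiffOn_const.mul contDiffOn_profileLT) ?_ ?_ ?_ ?_ ?_ e3 ?_, fun hκ => ?_⟩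
  · refine IntegrableOn.congr_fun ?_ (fun t ht => (q1 t ht).symm) measurableSet_Ioi
    exact ((i0.const_mul _).sub (i1.const_mul _)).add (i2.const_mul _)
  · exact IntegrableOn.congr_fun (i2.const_mul _) (fun t ht => (q2 t ht).symm) measurableSet_Ioi
  · exact IntegrableOn.congr_fun (i1.const_mul _) (fun t ht => (q3 t ht).symm) measurableSet_Ioi
  · rw [setIntegral_congr_fun measurableSet_Ioi q1]
    have i3 : IntegrableOn (fun t => κ ^ 2 * homDim n ^ 2 * (t ^ ((n : ℝ) + 1) *
        Real.exp (-γ * t ^ c)) - κ ^ 2 * (2 * β * homDim n) * (t ^ ((n : ℝ) + 1 + c) *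
        Real.exp (-γ * t ^ c))) (Ioi 0) := (i0.const_mul _).sub (i1.const_mul _)
    rw [integral_add i3 (i2.const_mul _), integral_sub (i0.const_mul _) (i1.const_mul _),
      integral_const_mul, integral_const_mul, integral_const_mul]
    -- The recursion cancels the first two of the three integrals.
    linear_combination (-κ ^ 2 * homDim n) * hJ1
  · rw [setIntegral_congr_fun measurableSet_Ioi q2, integral_const_mul]
  · linear_combination (κ ^ 2 / 2) * hJ2
  · rw [e3]
    have : 0 < J (n + 1 + c) := integral_rpow_mul_exp_pos hγ0 hc0.ne' (by positivity)
    positivity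

end LT

/-! ### The profile for `b > 1` -/

section GT

variable {b β : ℝ}

lemma contDiffOn_profileGT : ContDiffOn ℝ ∞ (profileGT n b β) (Ioi 0) :=
  (contDiffOn_id.rpow_const_of_ne fun _ ht => ne_of_gt ht).mul (contDiffOn_exp_rpow _ _)

lemma hasDerivAt_profileGT (hb : 1 < b) {t : ℝ} (ht : 0 < t) :
    HasDerivAt (profileGT n b β) ((β * t ^ (-b) - ((n : ℝ) + 1) / t) * profileGT n b β t) t := by
  have hb' : b - 1 ≠ 0 := by linarith
  refine ((Real.hasDerivAt_rpow_const (p := -(n : ℝ) - 1) (Or.inl ht.ne')).mul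
    (hasDerivAt_exp_rpow (β / (b - 1)) (1 - b) ht)).congr_deriv ?_
  rw [profileGT, show -(β / (b - 1)) * (1 - b) = β by field_simp; ring,
    show 1 - b - 1 = -b by ring, Real.rpow_sub_one ht.ne']
  field_simp
  ring

/-- The profile solves `V' + (n+1)V/t = βt⁻ᵇV`, the equality case for `λ = Q-2`, so the first two
radial integrals are proportional pointwise and only their ratio to the third needs the Gamma
recursion. -/
lemma isExtremal_profileGT (hb : 1 < b) (hβ : 0 < β) (κ : ℝ) :
    IsExtremal n (-2 * b) (-b - 1) ((homDim n + b - 1) / 2) (fun t => κ * profileGT n b β t)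
      (fun t => κ * ((β * t ^ (-b) - ((n : ℝ) + 1) / t) * profileGT n b β t)) ∧
    (κ ≠ 0 → 0 < ∫ t in Ioi (0 : ℝ), t ^ (n + 1) * (t ^ (-b - 1) * (κ * profileGT n b β t) ^ 2)) := by
  have hb1 : 0 < b - 1 := by linarith
  set γ := 2 * (β / (b - 1)) with hγ
  have hγ0 : 0 < γ := by positivity
  have hγp : γ * (1 - b) = -(2 * β) := by rw [hγ]; field_simp; ring
  have hp0 : 1 - b ≠ 0 := by linarith
  let J : ℝ → ℝ := fun m => ∫ t in Ioi (0 : ℝ), t ^ m * Real.exp (-γ * t ^ (1 - b))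
  have hm : ∀ {m : ℝ}, m < -1 → 0 < (m + 1) / (1 - b) := fun hm =>
    div_pos_of_neg_of_neg (by linarith) (by linarith)
  have hn0 : (0 : ℝ) ≤ n := Nat.cast_nonneg n
  have hJ : 2 * β * J (-(n : ℝ) - 1 - 2 * b) = (homDim n + b - 1) * J (-(n : ℝ) - 2 - b) := by
    have := integral_rpow_mul_exp_succ (m := -(n : ℝ) - 2 - b) hγ0 hp0 (hm (by linarith))
    rw [hγp, show -(n : ℝ) - 2 - b + (1 - b) = -(n : ℝ) - 1 - 2 * b by ring] at this
    simp only [J, homDim]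
    linarith
  have hE : ∀ t : ℝ, Real.exp (-(β / (b - 1)) * t ^ (1 - b)) ^ 2 = Real.exp (-γ * t ^ (1 - b)) :=
    fun t => exp_neg_sq _ _
  have hpow : ∀ {t : ℝ}, 0 < t → ∀ k l : ℝ, (n : ℝ) + 1 + k + 2 * (-(n : ℝ) - 1) = l →
      t ^ (n + 1) * t ^ k * (t ^ (-(n : ℝ) - 1)) ^ 2 = t ^ l := by
    intro t ht k l h
    rw [← h, Real.rpow_add ht, Real.rpow_add ht, mul_comm (2 : ℝ), Real.rpow_mul ht.le]
    norm_cast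
  have q2 : ∀ t ∈ Ioi (0 : ℝ), t ^ (n + 1) * (t ^ (-2 * b) * (κ * profileGT n b β t) ^ 2) =
      κ ^ 2 * (t ^ (-(n : ℝ) - 1 - 2 * b) * Real.exp (-γ * t ^ (1 - b))) := fun t ht => by
    rw [← hpow ht (-2 * b) (-(n : ℝ) - 1 - 2 * b) (by ring), ← hE, profileGT]
    ring
  have q1 : ∀ t ∈ Ioi (0 : ℝ), t ^ (n + 1) * (κ * ((β * t ^ (-b) - ((n : ℝ) + 1) / t) *
      profileGT n b β t) + ((n : ℝ) + 1) * (κ * profileGT n b β t / t)) ^ 2 =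
      β ^ 2 * (κ ^ 2 * (t ^ (-(n : ℝ) - 1 - 2 * b) * Real.exp (-γ * t ^ (1 - b)))) := fun t ht => by
    have ht' : 0 < t := ht
    have h2 : t ^ (-2 * b) = (t ^ (-b)) ^ 2 := by
      rw [← Real.rpow_natCast, ← Real.rpow_mul ht'.le]; congr 1; push_cast; ring
    rw [← q2 t ht, h2]
    field_simp
    ring
  have q3 : ∀ t ∈ Ioi (0 : ℝ), t ^ (n + 1) * (t ^ (-b - 1) * (κ * profileGT n b β t) ^ 2) =
      κ ^ 2 * (t ^ (-(n : ℝ) - 2 - b) * Real.exp (-γ * t ^ (1 - b))) := fun t ht => by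
    rw [← hpow ht (-b - 1) (-(n : ℝ) - 2 - b) (by ring), ← hE, profileGT]
    ring
  have i2 := integrableOn_rpow_mul_exp hγ0 hp0 (hm (by linarith : -(n : ℝ) - 1 - 2 * b < -1))
  have i3 := integrableOn_rpow_mul_exp hγ0 hp0 (hm (by linarith : -(n : ℝ) - 2 - b < -1))
  have e2 : ∫ t in Ioi (0 : ℝ), t ^ (n + 1) * (t ^ (-2 * b) * (κ * profileGT n b β t) ^ 2) =
      κ ^ 2 * J (-(n : ℝ) - 1 - 2 * b) := by
    rw [setIntegral_congr_fun measurableSet_Ioi q2, integral_const_mul]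
  have e3 : ∫ t in Ioi (0 : ℝ), t ^ (n + 1) * (t ^ (-b - 1) * (κ * profileGT n b β t) ^ 2) =
      κ ^ 2 * J (-(n : ℝ) - 2 - b) := by
    rw [setIntegral_congr_fun measurableSet_Ioi q3, integral_const_mul]
  have hJpos : 0 < J (-(n : ℝ) - 1 - 2 * b) := integral_rpow_mul_exp_pos hγ0 hp0 (hm (by linarith))
  refine ⟨isExtremal_of_integrals (B := β) hβ.le (by positivity)
    (fun t ht => (hasDerivAt_profileGT hb ht).const_mul κ)
    (contDiffOn_const.mul contDiffOn_profileGT) ?_ ?_ ?_ ?_ e2 e3 ?_, fun hκ => ?_⟩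
  · exact IntegrableOn.congr_fun ((i2.const_mul _).const_mul _) (fun t ht => (q1 t ht).symm)
      measurableSet_Ioi
  · exact IntegrableOn.congr_fun (i2.const_mul _) (fun t ht => (q2 t ht).symm) measurableSet_Ioi
  · exact IntegrableOn.congr_fun (i3.const_mul _) (fun t ht => (q3 t ht).symm) measurableSet_Ioi
  · rw [setIntegral_congr_fun measurableSet_Ioi q1, integral_const_mul, integral_const_mul]
  · linear_combination (κ ^ 2 / 2) * hJ
  · rw [e3]
    have : 0 < J (-(n : ℝ) - 2 - b) := integral_rpow_mul_exp_pos hγ0 hp0 (hm (by linarith))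
    positivity

end GT

/-! ### Logarithmic cutoffs -/

/-- The logarithmic scale of the `k`-th cutoff. -/
def cutScale (k : ℕ) : ℝ := ((k : ℝ) + 1) ^ 2

lemma cutScale_pos (k : ℕ) : 0 < cutScale k := by unfold cutScale; positivity

/-- The density `1/s` on the support of the `k`-th cutoff. -/
def logWindow (k : ℕ) : ℝ → ℝ :=
  (Icc (Real.exp (-(2 * cutScale k))) (Real.exp (2 * cutScale k))).indicator fun s => s⁻¹

lemma logWindow_nonneg (k : ℕ) (s : ℝ) : 0 ≤ logWindow k s :=
  indicator_nonneg (fun _ hs => inv_nonneg.2 ((Real.exp_pos _).le.trans hs.1)) s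

lemma mem_window {k : ℕ} {s : ℝ} (hs : 0 < s) :
    s ∈ Icc (Real.exp (-(2 * cutScale k))) (Real.exp (2 * cutScale k)) ↔
      |Real.log s| ≤ 2 * cutScale k := by
  rw [mem_Icc, ← Real.le_log_iff_exp_le hs, ← Real.log_le_iff_le_exp hs, abs_le]

lemma window_subset (k : ℕ) :
    Icc (Real.exp (-(2 * cutScale k))) (Real.exp (2 * cutScale k)) ⊆ Ioi 0 :=
  fun _ hs => (Real.exp_pos _).trans_le hs.1

lemma integrableOn_logWindow (k : ℕ) : IntegrableOn (logWindow k) (Ioi 0) := by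
  refine ((integrable_indicator_iff measurableSet_Icc).2 ?_).integrableOn
  exact (continuousOn_id.inv₀ fun s hs => ne_of_gt (window_subset k hs)).integrableOn_Icc

lemma integral_logWindow (k : ℕ) : ∫ s in Ioi 0, logWindow k s = 4 * cutScale k := by
  have hκ := cutScale_pos k
  have hle : Real.exp (-(2 * cutScale k)) ≤ Real.exp (2 * cutScale k) :=
    Real.exp_le_exp.2 (by linarith)
  rw [logWindow, setIntegral_indicator measurableSet_Icc, inter_eq_right.2 (window_subset k),
    integral_Icc_eq_integral_Ioc, ← intervalIntegral.integral_of_le hle,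
    integral_inv_of_pos (Real.exp_pos _) (Real.exp_pos _), ← Real.exp_sub, Real.log_exp]
  ring

/-- Young's inequality with parameter `N`; letting `N` grow makes the coefficient of `a²` small. -/
lemma abs_add_sq_sub_sq_le {N : ℝ} (hN : 0 < N) (a e : ℝ) :
    |(a + e) ^ 2 - a ^ 2| ≤ 1 / N * a ^ 2 + (N + 1) * e ^ 2 := by
  have h1 : 0 ≤ 1 / N * (a - N * e) ^ 2 := by positivity
  have h2 : 0 ≤ 1 / N * (a + N * e) ^ 2 := by positivity
  have e1 : 1 / N * (a - N * e) ^ 2 = 1 / N * a ^ 2 - 2 * a * e + N * e ^ 2 := by field_simp; ring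
  have e2 : 1 / N * (a + N * e) ^ 2 = 1 / N * a ^ 2 + 2 * a * e + N * e ^ 2 := by field_simp; ring
  rw [abs_le]
  constructor <;> nlinarith [sq_nonneg e]

/-- Truncation with an error of logarithmic size does not change the limit of weighted `L²`
integrals. -/
lemma tendsto_integral_cutoff {w f : ℝ → ℝ} {χ e : ℕ → ℝ → ℝ} {C : ℝ} (hC : 0 ≤ C)
    (hw : ∀ s > 0, 0 ≤ w s) (hwc : ContinuousOn w (Ioi 0)) (hfc : ContinuousOn f (Ioi 0))
    (hf : IntegrableOn (fun s => w s * f s ^ 2) (Ioi 0))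
    (hχ : ∀ k s, |χ k s| ≤ 1) (hχ1 : ∀ s > 0, ∀ᶠ k in atTop, χ k s = 1)
    (hχc : ∀ k, ContinuousOn (χ k) (Ioi 0)) (hec : ∀ k, ContinuousOn (e k) (Ioi 0))
    (he : ∀ k, ∀ s > 0, w s * e k s ^ 2 ≤ C / cutScale k ^ 2 * logWindow k s) :
    Tendsto (fun k => ∫ s in Ioi 0, w s * (χ k s * f s + e k s) ^ 2) atTop
      (𝓝 (∫ s in Ioi 0, w s * f s ^ 2)) := by
  have hχ2 : ∀ k s, χ k s ^ 2 ≤ 1 := fun k s => by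
    rw [← sq_abs]; exact pow_le_one₀ (abs_nonneg _) (hχ k s)
  have hm : ∀ k, AEStronglyMeasurable (fun s => w s * (χ k s * f s) ^ 2) (volume.restrict (Ioi 0)) :=
    fun k => (hwc.mul (((hχc k).mul hfc).pow 2)).aestronglyMeasurable measurableSet_Ioi
  have hm' : ∀ k, AEStronglyMeasurable (fun s => w s * (χ k s * f s + e k s) ^ 2)
      (volume.restrict (Ioi 0)) := fun k =>
    (hwc.mul ((((hχc k).mul hfc).add (hec k)).pow 2)).aestronglyMeasurable measurableSet_Ioi
  have hb : ∀ k, ∀ s > 0, w s * (χ k s * f s) ^ 2 ≤ w s * f s ^ 2 := fun k s hs => by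
    refine mul_le_mul_of_nonneg_left ?_ (hw s hs)
    rw [mul_pow]
    nlinarith [hχ2 k s, sq_nonneg (f s)]
  have t1 : Tendsto (fun k => ∫ s in Ioi 0, w s * (χ k s * f s) ^ 2) atTop
      (𝓝 (∫ s in Ioi 0, w s * f s ^ 2)) := by
    refine tendsto_integral_of_dominated_convergence (fun s => w s * f s ^ 2) hm hf ?_ ?_
    · intro k
      refine (ae_restrict_mem measurableSet_Ioi).mono fun s hs => ?_
      rw [Real.norm_of_nonneg (mul_nonneg (hw s hs) (sq_nonneg _))]
      exact hb k s hs
    · refine (ae_restrict_mem measurableSet_Ioi).mono fun s hs => ?_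
      refine tendsto_const_nhds.congr' ((hχ1 s hs).mono fun k hk => ?_)
      simp only [hk, one_mul]
  have hh : ∀ k, IntegrableOn (fun s => w s * (χ k s * f s) ^ 2) (Ioi 0) := fun k => by
    refine Integrable.mono' hf (hm k) ((ae_restrict_mem measurableSet_Ioi).mono fun s hs => ?_)
    rw [Real.norm_of_nonneg (mul_nonneg (hw s hs) (sq_nonneg _))]
    exact hb k s hs
  -- Young's inequality with `N = k + 1`.
  have hbd : ∀ k, ∀ s > 0, |w s * (χ k s * f s + e k s) ^ 2 - w s * (χ k s * f s) ^ 2| ≤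
      (1 / ((k : ℝ) + 1)) * (w s * f s ^ 2) +
        (((k : ℝ) + 2) * (C / cutScale k ^ 2)) * logWindow k s := fun k s hs => by
    have h := mul_le_mul_of_nonneg_left
      (abs_add_sq_sub_sq_le (N := (k : ℝ) + 1) (by positivity) (χ k s * f s) (e k s)) (hw s hs)
    have h1 := mul_le_mul_of_nonneg_left (hb k s hs) (by positivity : 0 ≤ 1 / ((k : ℝ) + 1))
    have h2 := mul_le_mul_of_nonneg_left (he k s hs) (by positivity : 0 ≤ (k : ℝ) + 2)
    rw [← mul_sub, abs_mul, abs_of_nonneg (hw s hs)]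
    calc _ ≤ _ := h
      _ = 1 / ((k : ℝ) + 1) * (w s * (χ k s * f s) ^ 2) + ((k : ℝ) + 2) * (w s * e k s ^ 2) := by
        ring
      _ ≤ _ := by rw [mul_assoc]; exact add_le_add h1 h2
  have hbi : ∀ k : ℕ, IntegrableOn (fun s => (1 / ((k : ℝ) + 1)) * (w s * f s ^ 2) +
      (((k : ℝ) + 2) * (C / cutScale k ^ 2)) * logWindow k s) (Ioi 0) := fun k =>
    (hf.const_mul _).add ((integrableOn_logWindow k).const_mul _)
  have hd : ∀ k, IntegrableOn (fun s => w s * (χ k s * f s + e k s) ^ 2 -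
      w s * (χ k s * f s) ^ 2) (Ioi 0) := fun k =>
    Integrable.mono' (hbi k) ((hm' k).sub (hm k))
      ((ae_restrict_mem measurableSet_Ioi).mono fun s hs => hbd k s hs)
  have hg : ∀ k, IntegrableOn (fun s => w s * (χ k s * f s + e k s) ^ 2) (Ioi 0) := fun k => by
    refine ((hd k).add (hh k)).congr (ae_of_all _ fun s => ?_)
    simp
  -- The window has mass `4(k+1)²` and the error density carries `C/(k+1)⁴`. The quadratic scale
  -- leaves `(k+2)/(k+1)² → 0` after the loss of `k+2` in Young's inequality.
  have key : ∀ k : ℕ, |(∫ s in Ioi 0, w s * (χ k s * f s + e k s) ^ 2) -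
      ∫ s in Ioi 0, w s * (χ k s * f s) ^ 2| ≤
        ((∫ s in Ioi 0, w s * f s ^ 2) + 8 * C) * (1 / ((k : ℝ) + 1)) := fun k => by
    rw [← integral_sub (hg k) (hh k)]
    refine (abs_integral_le_integral_abs).trans ((setIntegral_mono_on (hd k).abs (hbi k)
      measurableSet_Ioi fun s hs => hbd k s hs).trans ?_)
    rw [integral_add (hf.const_mul _) ((integrableOn_logWindow k).const_mul _), integral_const_mul,
      integral_const_mul, integral_logWindow, cutScale]
    suffices h : ((k : ℝ) + 2) * (C / (((k : ℝ) + 1) ^ 2) ^ 2) * (4 * ((k : ℝ) + 1) ^ 2) ≤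
        8 * C * (1 / ((k : ℝ) + 1)) by
      rw [add_mul (∫ s in Ioi 0, w s * f s ^ 2), mul_comm (1 / ((k : ℝ) + 1))]
      exact add_le_add_right h _
    rw [mul_one_div, le_div_iff₀ (by positivity)]
    have hk : (0 : ℝ) ≤ k := Nat.cast_nonneg k
    have e1 : ((k : ℝ) + 2) * (C / (((k : ℝ) + 1) ^ 2) ^ 2) * (4 * ((k : ℝ) + 1) ^ 2) * ((k : ℝ) + 1) =
        4 * C * (((k : ℝ) + 2) / ((k : ℝ) + 1)) := by field_simp
    have e2 : ((k : ℝ) + 2) / ((k : ℝ) + 1) ≤ 2 := by rw [div_le_iff₀ (by positivity)]; linarith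
    rw [e1]
    nlinarith
  have t2 : Tendsto (fun k : ℕ => ((∫ s in Ioi 0, w s * f s ^ 2) + 8 * C) * (1 / ((k : ℝ) + 1)))
      atTop (𝓝 0) := by
    simpa using tendsto_one_div_add_atTop_nhds_zero_nat.const_mul
      ((∫ s in Ioi 0, w s * f s ^ 2) + 8 * C)
  have t3 : Tendsto (fun k => (∫ s in Ioi 0, w s * (χ k s * f s + e k s) ^ 2) -
      ∫ s in Ioi 0, w s * (χ k s * f s) ^ 2) atTop (𝓝 0) :=
    squeeze_zero_norm (fun k => by rw [Real.norm_eq_abs]; exact key k) t2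
  simpa using t3.add t1

/-- A smooth function equal to `1` on `[-1, 1]` and vanishing off `(-2, 2)`. -/
def plateau : ContDiffBump (0 : ℝ) := ⟨1, 2, one_pos, one_lt_two⟩

lemma contDiff_plateau : ContDiff ℝ ∞ plateau := plateau.contDiff

lemma hasDerivAt_plateau (y : ℝ) : HasDerivAt plateau (deriv plateau y) y :=
  (contDiff_plateau.differentiable (by simp) y).hasDerivAt

lemma contDiff_deriv_plateau : ContDiff ℝ ∞ (deriv plateau) :=
  (contDiff_infty_iff_deriv.1 contDiff_plateau).2

lemma hasDerivAt_deriv_plateau (y : ℝ) :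
    HasDerivAt (deriv plateau) (deriv (deriv plateau) y) y :=
  (contDiff_deriv_plateau.differentiable (by simp) y).hasDerivAt

lemma exists_bound_plateau : ∃ M ≥ 0, (∀ y, |deriv plateau y| ≤ M) ∧
    ∀ y, |deriv (deriv plateau) y| ≤ M := by
  have hs : HasCompactSupport (plateau : ℝ → ℝ) := plateau.hasCompactSupport
  obtain ⟨M, hM⟩ := hs.deriv.exists_bound_of_continuous contDiff_deriv_plateau.continuous
  obtain ⟨M', hM'⟩ := hs.deriv.deriv.exists_bound_of_continuous
    (contDiff_infty_iff_deriv.1 contDiff_deriv_plateau).2.continuous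
  exact ⟨max M M', ((norm_nonneg _).trans (hM 0)).trans (le_max_left _ _),
    fun y => (hM y).trans (le_max_left _ _), fun y => (hM' y).trans (le_max_right _ _)⟩

lemma plateau_eq_zero {y : ℝ} (h : 2 < |y|) : plateau y = 0 ∧ deriv plateau y = 0 ∧
    deriv (deriv plateau) y = 0 := by
  have hev : (plateau : ℝ → ℝ) =ᶠ[𝓝 y] fun _ => 0 := by
    filter_upwards [continuous_abs.continuousAt.eventually (lt_mem_nhds h)] with z hz
    exact plateau.zero_of_le_dist (by simpa [plateau] using hz.le)
  refine ⟨hev.eq_of_nhds, ?_, ?_⟩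
  · rw [hev.deriv_eq]; simp
  · rw [hev.deriv.deriv_eq]; simp

/-- The `k`-th cutoff: it is `1` where `|log s| ≤ κ` and `0` where `|log s| ≥ 2κ`. -/
def cutoff (k : ℕ) : ℝ → ℝ := (Ioi 0).indicator fun s => plateau (Real.log s / cutScale k)

/-- The derivative of `cutoff k`. -/
def cutoffD (k : ℕ) (s : ℝ) : ℝ :=
  deriv plateau (Real.log s / cutScale k) * (s⁻¹ / cutScale k)

/-- The second derivative of `cutoff k`. -/
def cutoffDD (k : ℕ) (s : ℝ) : ℝ :=
  deriv (deriv plateau) (Real.log s / cutScale k) * (s⁻¹ / cutScale k) * (s⁻¹ / cutScale k) +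
    deriv plateau (Real.log s / cutScale k) * (-(s ^ 2)⁻¹ / cutScale k)

section Cutoff

variable (k : ℕ) {s : ℝ}

lemma abs_cutoff_le (s : ℝ) : |cutoff k s| ≤ 1 := by
  by_cases h : 0 < s
  · rw [cutoff, indicator_of_mem (mem_Ioi.2 h), abs_of_nonneg plateau.nonneg]
    exact plateau.le_one
  · rw [cutoff, indicator_of_notMem (by simpa using h)]; simp

lemma hasDerivAt_log_div (hs : 0 < s) :
    HasDerivAt (fun s => Real.log s / cutScale k) (s⁻¹ / cutScale k) s :=
  (Real.hasDerivAt_log hs.ne').div_const _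

lemma cutoff_eventuallyEq (hs : 0 < s) :
    cutoff k =ᶠ[𝓝 s] fun s => plateau (Real.log s / cutScale k) := by
  filter_upwards [lt_mem_nhds hs] with t ht
  exact indicator_of_mem (mem_Ioi.2 ht) _

lemma hasDerivAt_cutoff (hs : 0 < s) : HasDerivAt (cutoff k) (cutoffD k s) s :=
  ((hasDerivAt_plateau _).comp s (hasDerivAt_log_div k hs)).congr_of_eventuallyEq
    (cutoff_eventuallyEq k hs)

lemma hasDerivAt_cutoffD (hs : 0 < s) : HasDerivAt (cutoffD k) (cutoffDD k s) s :=
  ((hasDerivAt_deriv_plateau _).comp s (hasDerivAt_log_div k hs)).mul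
    ((hasDerivAt_inv hs.ne').div_const _)

lemma contDiffOn_cutoff : ContDiffOn ℝ ∞ (cutoff k) (Ioi 0) := by
  have : ContDiffOn ℝ ∞ (fun s => plateau (Real.log s / cutScale k)) (Ioi 0) :=
    contDiff_plateau.comp_contDiffOn
      ((Real.contDiffOn_log.mono fun s hs => ne_of_gt hs).div_const _)
  exact this.congr fun s hs => indicator_of_mem hs _

lemma contDiffOn_cutoffD : ContDiffOn ℝ ∞ (cutoffD k) (Ioi 0) :=
  ((contDiffOn_infty_iff_deriv_of_isOpen isOpen_Ioi).1 (contDiffOn_cutoff k)).2.congr fun _ hs =>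
    (hasDerivAt_cutoff k hs).deriv.symm

lemma continuousOn_cutoffDD : ContinuousOn (cutoffDD k) (Ioi 0) :=
  ((contDiffOn_infty_iff_deriv_of_isOpen isOpen_Ioi).1 (contDiffOn_cutoffD k)).2.continuousOn.congr
    fun _ hs => (hasDerivAt_cutoffD k hs).deriv.symm

lemma cutoff_eq_zero (h : 2 * cutScale k < |Real.log s|) :
    cutoff k s = 0 ∧ cutoffD k s = 0 ∧ cutoffDD k s = 0 := by
  have hκ := cutScale_pos k
  obtain ⟨h1, h2, h3⟩ := plateau_eq_zero (y := Real.log s / cutScale k) (by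
    rwa [abs_div, abs_of_pos hκ, lt_div_iff₀ hκ])
  refine ⟨?_, by rw [cutoffD, h2, zero_mul], by rw [cutoffDD, h2, h3]; ring⟩
  rw [cutoff, indicator_apply, h1, ite_self]

lemma cutoff_eventually_eq_one (hs : 0 < s) : ∀ᶠ k in atTop, cutoff k s = 1 := by
  filter_upwards [eventually_ge_atTop ⌈|Real.log s|⌉₊] with k hk
  have hk' : |Real.log s| ≤ k := (Nat.le_ceil _).trans (by exact_mod_cast hk)
  have h0 : (0 : ℝ) ≤ k := Nat.cast_nonneg k
  rw [cutoff, indicator_of_mem (mem_Ioi.2 hs)]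
  refine plateau.one_of_mem_closedBall ?_
  rw [mem_closedBall_zero_iff, Real.norm_eq_abs, abs_div, abs_of_pos (cutScale_pos k),
    div_le_iff₀ (cutScale_pos k), cutScale]
  simp only [plateau]
  nlinarith

/-- In logarithmic scale each derivative costs `1/s`, and at least one factor `1/κ` is gained
because the transition takes place over a logarithmic length `κ`. -/
lemma exists_bound_cutoff : ∃ M ≥ 0, ∀ (k : ℕ), ∀ s > 0, |cutoffD k s| ≤ M / cutScale k * s⁻¹ ∧
    |cutoffDD k s| ≤ M / cutScale k * (s ^ 2)⁻¹ := by
  obtain ⟨M, hM, h1, h2⟩ := exists_bound_plateau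
  refine ⟨2 * M, by positivity, fun k s hs => ?_⟩
  have hκ := cutScale_pos k
  -- Lets the `1/κ²` in the second derivative be weakened to `1/κ`.
  have hκ1 : 1 ≤ cutScale k := one_le_pow₀ (by simp)
  set y := Real.log s / cutScale k
  have e1 : |cutoffD k s| ≤ M / cutScale k * s⁻¹ := by
    rw [cutoffD, abs_mul, abs_of_pos (by positivity : 0 < s⁻¹ / cutScale k)]
    calc _ ≤ M * (s⁻¹ / cutScale k) := by gcongr; exact h1 _
      _ = _ := by ring
  refine ⟨e1.trans ?_, ?_⟩
  · gcongr; linarith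
  · rw [cutoffDD]
    have e2 : |deriv (deriv plateau) y * (s⁻¹ / cutScale k) * (s⁻¹ / cutScale k)| ≤
        M / cutScale k * (s ^ 2)⁻¹ := by
      rw [mul_assoc, abs_mul,
        abs_of_pos (by positivity : 0 < s⁻¹ / cutScale k * (s⁻¹ / cutScale k))]
      calc _ ≤ M * (s⁻¹ / cutScale k * (s⁻¹ / cutScale k)) := by gcongr; exact h2 _
        _ = M / cutScale k * (s ^ 2)⁻¹ * (1 / cutScale k) := by field_simp
        _ ≤ M / cutScale k * (s ^ 2)⁻¹ * 1 := by
          gcongr; exact (div_le_one hκ).2 hκ1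
        _ = _ := mul_one _
    have e3 : |deriv plateau y * (-(s ^ 2)⁻¹ / cutScale k)| ≤ M / cutScale k * (s ^ 2)⁻¹ := by
      rw [neg_div, mul_neg, abs_neg, abs_mul, abs_of_pos (by positivity : 0 < (s ^ 2)⁻¹ / cutScale k)]
      calc _ ≤ M * ((s ^ 2)⁻¹ / cutScale k) := by gcongr; exact h1 _
        _ = _ := by ring
    calc _ ≤ _ := abs_add_le _ _
      _ ≤ _ := add_le_add e2 e3
      _ = _ := by ring

end Cutoff

/-! ### Radial test functions -/

section RadialTest

variable {k : ℕ} {s : ℝ}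

lemma cutoff_of_lt (h : s < Real.exp (-(2 * cutScale k))) : cutoff k s = 0 := by
  by_cases hs : 0 < s
  · refine (cutoff_eq_zero k (lt_of_not_ge fun h' => ?_)).1
    exact absurd ((mem_window hs).2 h').1 (not_le.2 h)
  · exact indicator_of_notMem (by simpa using hs) _

lemma cutoff_of_gt (h : Real.exp (2 * cutScale k) < s) : cutoff k s = 0 := by
  have hs : 0 < s := (Real.exp_pos _).trans h
  refine (cutoff_eq_zero k (lt_of_not_ge fun h' => ?_)).1
  exact absurd ((mem_window hs).2 h').2 (not_le.2 h)

lemma comp_rho_mem_testFunctionsConst {U : ℝ → ℝ} (hU : ContDiffOn ℝ ∞ U (Ioi 0)) {δ R : ℝ}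
    (hδ : 0 < δ) (h0 : ∀ s, 0 ≤ s → s < δ → U s = U 0) (hR : ∀ s, R < s → U s = 0) :
    (fun p : Space n => U (rho p)) ∈ testFunctionsConst n := by
  have hev : ∀ᶠ p in 𝓝 (0 : Space n), U (rho p) = U 0 :=
    (eventually_rho_lt hδ).mono fun p hp => h0 _ (rho_nonneg p) hp
  refine ⟨contDiff_iff_contDiffAt.2 fun p => ?_, hasCompactSupport_of_rho fun p => hR _, ?_⟩
  · by_cases hp : p = 0
    · subst hp
      exact contDiffAt_const.congr_of_eventuallyEq hev
    · exact (contDiffOn_comp_rho hU).contDiffAt (isOpen_compl_singleton.mem_nhds hp)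
  · exact hev.mono fun p hp => hp.trans hev.self_of_nhds.symm

lemma comp_rho_mem_testFunctions {U : ℝ → ℝ} (hU : ContDiffOn ℝ ∞ U (Ioi 0)) {δ R : ℝ}
    (hδ : 0 < δ) (h0 : ∀ s, s < δ → U s = 0) (hR : ∀ s, R < s → U s = 0) :
    (fun p : Space n => U (rho p)) ∈ testFunctions n := by
  obtain ⟨h1, h2, -⟩ := comp_rho_mem_testFunctionsConst (n := n) hU hδ
    (fun s _ hs => (h0 s hs).trans (h0 0 hδ).symm) hR
  refine ⟨h1, h2, fun p hp hp0 => ?_⟩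
  rw [mem_singleton_iff] at hp0
  subst hp0
  exact (suppOff_of_rho hδ (fun p hp => h0 _ hp) fun p hp => hR _ hp).2 hp

end RadialTest

/-! ### Sharpness -/

/-- `F` is small enough against the weight `t^{n+1+q}` for logarithmic truncation. -/
def LogBounded (n : ℕ) (q : ℝ) (F : ℝ → ℝ) : Prop :=
  ∃ B ≥ 0, ∀ t > 0, t ^ (n + 1) * t ^ q * (F t / t) ^ 2 ≤ B * t⁻¹

/-- An error of size `F/(κt)` has weighted square at most a multiple of `1/(κ²t)`, which is the form
required by `tendsto_integral_cutoff`. -/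
lemma LogBounded.exists_error_bound {q : ℝ} {F : ℝ → ℝ} (h : LogBounded n q F) {e : ℕ → ℝ → ℝ}
    {D : ℝ} (he : ∀ k, ∀ t > 0, |e k t| ≤ D / cutScale k * |F t / t|)
    (h0 : ∀ k, ∀ t > 0, 2 * cutScale k < |Real.log t| → e k t = 0) :
    ∃ C ≥ 0, ∀ k, ∀ t > 0, t ^ (n + 1) * t ^ q * e k t ^ 2 ≤
      C / cutScale k ^ 2 * logWindow k t := by
  obtain ⟨B, hB, hF⟩ := h
  refine ⟨D ^ 2 * B, by positivity, fun k t ht => ?_⟩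
  have hκ := cutScale_pos k
  rcases lt_or_ge (2 * cutScale k) |Real.log t| with hl | hl
  · rw [h0 k t ht hl]
    have := logWindow_nonneg k t
    have : 0 ≤ D ^ 2 * B / cutScale k ^ 2 * logWindow k t := by positivity
    simpa using this
  · rw [logWindow, indicator_of_mem ((mem_window ht).2 hl)]
    have h1 : e k t ^ 2 ≤ (D / cutScale k) ^ 2 * (F t / t) ^ 2 := by
      rw [← sq_abs, ← sq_abs (F t / t), ← mul_pow]
      exact pow_le_pow_left₀ (abs_nonneg _) (he k t ht) 2
    calc t ^ (n + 1) * t ^ q * e k t ^ 2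
        ≤ t ^ (n + 1) * t ^ q * ((D / cutScale k) ^ 2 * (F t / t) ^ 2) := by gcongr
      _ = (D / cutScale k) ^ 2 * (t ^ (n + 1) * t ^ q * (F t / t) ^ 2) := by ring
      _ ≤ (D / cutScale k) ^ 2 * (B * t⁻¹) := mul_le_mul_of_nonneg_left (hF t ht) (sq_nonneg _)
      _ = _ := by rw [div_pow]; ring

/-- Pass to the limit in the inequality for the approximations and divide by the positive third
integral; the common angular mass drops out. -/
lemma IsExtremal.le_of_tendsto (hn : 1 ≤ n) {s r K c : ℝ} {V V' : ℝ → ℝ}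
    (h : IsExtremal n s r K V V')
    (hpos : 0 < ∫ t in Ioi (0 : ℝ), t ^ (n + 1) * (t ^ r * V t ^ 2))
    {Uk Vk Vk' : ℕ → ℝ → ℝ} (hU : ∀ k, ∀ t > 0, HasDerivAt (Uk k) (Vk k t) t)
    (hV : ∀ k, ∀ t > 0, HasDerivAt (Vk k) (Vk' k t) t)
    (hfin : ∀ k, FiniteEnergies s r fun p : Space n => Uk k (rho p))
    (t1 : Tendsto (fun k => ∫ t in Ioi (0 : ℝ),
        t ^ (n + 1) * (Vk' k t + ((n : ℝ) + 1) * (Vk k t / t)) ^ 2) atTop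
      (𝓝 (∫ t in Ioi (0 : ℝ), t ^ (n + 1) * (V' t + ((n : ℝ) + 1) * (V t / t)) ^ 2)))
    (t2 : Tendsto (fun k => ∫ t in Ioi (0 : ℝ), t ^ (n + 1) * (t ^ s * Vk k t ^ 2)) atTop
      (𝓝 (∫ t in Ioi (0 : ℝ), t ^ (n + 1) * (t ^ s * V t ^ 2))))
    (t3 : Tendsto (fun k => ∫ t in Ioi (0 : ℝ), t ^ (n + 1) * (t ^ r * Vk k t ^ 2)) atTop
      (𝓝 (∫ t in Ioi (0 : ℝ), t ^ (n + 1) * (t ^ r * V t ^ 2))))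
    (hc : ∀ k, Uncertainty s r c fun p : Space n => Uk k (rho p)) : c ≤ K := by
  refine le_of_mul_le_mul_right ?_ hpos
  rw [← h.equality]
  refine le_of_tendsto_of_tendsto' (t3.const_mul c) (t1.sqrt.mul t2.sqrt) fun k => ?_
  have hk := hc k
  rw [Uncertainty, lapEnergy_comp_rho hn (hU k) (hV k) (hfin k).1,
    gradEnergy_comp_rho hn (hU k) s (hfin k).2.1, gradEnergy_comp_rho hn (hU k) r (hfin k).2.2,
    sqrt_const_mul_mul_sqrt (angularMass_pos hn).le, ge_iff_le, mul_left_comm] at hk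
  exact le_of_mul_le_mul_left hk (angularMass_pos hn)

/-- The weighted norm of the truncated gradient converges. -/
lemma tendsto_integral_truncated {q : ℝ} {V : ℝ → ℝ} (hVc : ContinuousOn V (Ioi 0))
    (hi : IntegrableOn (fun t => t ^ (n + 1) * (t ^ q * V t ^ 2)) (Ioi 0)) {e : ℕ → ℝ → ℝ}
    (hec : ∀ k, ContinuousOn (e k) (Ioi 0))
    (he : ∃ C ≥ 0, ∀ k, ∀ t > 0, t ^ (n + 1) * t ^ q * e k t ^ 2 ≤
      C / cutScale k ^ 2 * logWindow k t) :
    Tendsto (fun k => ∫ t in Ioi (0 : ℝ), t ^ (n + 1) * (t ^ q * (cutoff k t * V t + e k t) ^ 2))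
      atTop (𝓝 (∫ t in Ioi (0 : ℝ), t ^ (n + 1) * (t ^ q * V t ^ 2))) := by
  obtain ⟨C, hC, he⟩ := he
  simp only [← mul_assoc] at hi ⊢
  refine tendsto_integral_cutoff (w := fun t => t ^ (n + 1) * t ^ q) hC
    (fun t ht => by positivity) ?_ hVc hi abs_cutoff_le (fun t ht => cutoff_eventually_eq_one ht)
    (fun k => (contDiffOn_cutoff k).continuousOn) hec he
  exact (continuousOn_id.pow _).mul (continuousOn_id.rpow_const fun t ht => Or.inl (ne_of_gt ht))

lemma IsExtremal.continuousOn_lap {s r K : ℝ} {V V' : ℝ → ℝ} (h : IsExtremal n s r K V V') :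
    ContinuousOn (fun t => V' t + ((n : ℝ) + 1) * (V t / t)) (Ioi 0) :=
  h.continuousOn_deriv.add (continuousOn_const.mul
    (h.contDiffOn.continuousOn.div continuousOn_id fun _ ht => ne_of_gt ht))

lemma IsExtremal.tendsto_lap {s r K : ℝ} {V V' : ℝ → ℝ} (h : IsExtremal n s r K V V')
    {e : ℕ → ℝ → ℝ} (hec : ∀ k, ContinuousOn (e k) (Ioi 0))
    (he : ∃ C ≥ 0, ∀ k, ∀ t > 0, t ^ (n + 1) * t ^ (0 : ℝ) * e k t ^ 2 ≤
      C / cutScale k ^ 2 * logWindow k t) :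
    Tendsto (fun k => ∫ t in Ioi (0 : ℝ), t ^ (n + 1) *
        (cutoff k t * (V' t + ((n : ℝ) + 1) * (V t / t)) + e k t) ^ 2) atTop
      (𝓝 (∫ t in Ioi (0 : ℝ), t ^ (n + 1) * (V' t + ((n : ℝ) + 1) * (V t / t)) ^ 2)) := by
  have := tendsto_integral_truncated (q := 0) h.continuousOn_lap
    (by simpa only [Real.rpow_zero, one_mul] using h.integrable_lap) hec he
  simpa only [Real.rpow_zero, one_mul] using this

/-- Truncating the extremal function by logarithmic cutoffs. -/
lemma IsExtremal.le_of_testFunctions (hn : 3 ≤ n) {s r K c : ℝ} {U V V' : ℝ → ℝ}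
    (h : IsExtremal n s r K V V') (hU : ∀ t > 0, HasDerivAt U (V t) t)
    (hpos : 0 < ∫ t in Ioi (0 : ℝ), t ^ (n + 1) * (t ^ r * V t ^ 2))
    (bV : LogBounded n 0 V) (bU : LogBounded n 0 fun t => U t / t)
    (bs : LogBounded n s U) (br : LogBounded n r U)
    (hc : ∀ u ∈ testFunctions n, Uncertainty s r c u) : c ≤ K := by
  have hVc := h.contDiffOn.continuousOn
  have hUd := contDiffOn_of_hasDerivAt hU h.contDiffOn
  obtain ⟨M, hM, hcut⟩ := exists_bound_cutoff
  have hmem : ∀ k, (fun p : Space n => cutoff k (rho p) * U (rho p)) ∈ testFunctions n := fun k =>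
    comp_rho_mem_testFunctions (U := fun s => cutoff k s * U s) ((contDiffOn_cutoff k).mul hUd)
      (Real.exp_pos _) (fun s hs => by rw [cutoff_of_lt hs, zero_mul])
      fun s hs => by rw [cutoff_of_gt hs, zero_mul]
  have hDU : ∀ k, ContinuousOn (fun t => cutoffD k t * U t) (Ioi 0) := fun k =>
    (contDiffOn_cutoffD k).continuousOn.mul hUd.continuousOn
  have eD : ∀ k, ∀ t > 0, |cutoffD k t * U t| ≤ M / cutScale k * |U t / t| := fun k t ht => by
    rw [abs_mul, abs_div, abs_of_pos ht]
    calc _ ≤ M / cutScale k * t⁻¹ * |U t| := by gcongr; exact (hcut k t ht).1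
      _ = _ := by ring
  have zD : ∀ k, ∀ t > 0, 2 * cutScale k < |Real.log t| → cutoffD k t * U t = 0 :=
    fun k t _ hl => by rw [(cutoff_eq_zero k hl).2.1, zero_mul]
  -- The radial operator applied to `χU` is `χ(V' + (n+1)V/t)` plus this error, whose two parts are
  -- controlled by `V` and by `U/t`.
  have eL : ∃ C ≥ 0, ∀ k, ∀ t > 0, t ^ (n + 1) * t ^ (0 : ℝ) * (2 * (cutoffD k t * V t) +
      (cutoffDD k t + ((n : ℝ) + 1) * (cutoffD k t / t)) * U t) ^ 2 ≤
      C / cutScale k ^ 2 * logWindow k t := by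
    obtain ⟨C1, hC1, h1⟩ := bV.exists_error_bound (e := fun k t => 2 * (cutoffD k t * V t))
      (D := 2 * M) (fun k t ht => by
        rw [abs_mul, abs_mul, abs_div, abs_of_pos ht, abs_of_pos two_pos]
        calc _ ≤ 2 * (M / cutScale k * t⁻¹ * |V t|) := by gcongr; exact (hcut k t ht).1
          _ = _ := by ring)
      (fun k t _ hl => by rw [(cutoff_eq_zero k hl).2.1]; ring)
    obtain ⟨C2, hC2, h2⟩ := bU.exists_error_bound
      (e := fun k t => (cutoffDD k t + ((n : ℝ) + 1) * (cutoffD k t / t)) * U t)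
      (D := ((n : ℝ) + 2) * M) (fun k t ht => by
        obtain ⟨b1, b2⟩ := hcut k t ht
        rw [abs_mul, div_div, abs_div, abs_of_pos (mul_pos ht ht)]
        have b3 : |cutoffDD k t + ((n : ℝ) + 1) * (cutoffD k t / t)| ≤
            M / cutScale k * (t ^ 2)⁻¹ + ((n : ℝ) + 1) * (M / cutScale k * t⁻¹ / t) := by
          refine (abs_add_le _ _).trans (add_le_add b2 ?_)
          rw [abs_mul, abs_div, abs_of_pos ht, abs_of_pos (by positivity : 0 < (n : ℝ) + 1)]
          gcongr
        calc _ ≤ (M / cutScale k * (t ^ 2)⁻¹ +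
              ((n : ℝ) + 1) * (M / cutScale k * t⁻¹ / t)) * |U t| := by gcongr
          _ = _ := by
            have := cutScale_pos k
            field_simp
            ring)
      (fun k t _ hl => by rw [(cutoff_eq_zero k hl).2.1, (cutoff_eq_zero k hl).2.2]; ring)
    refine ⟨2 * C1 + 2 * C2, by positivity, fun k t ht => ?_⟩
    have hw : 0 ≤ t ^ (n + 1) * t ^ (0 : ℝ) := by positivity
    have h3 := mul_le_mul_of_nonneg_left (add_sq_le (a := 2 * (cutoffD k t * V t))
      (b := (cutoffDD k t + ((n : ℝ) + 1) * (cutoffD k t / t)) * U t)) hw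
    have h1 := h1 k t ht
    have h2 := h2 k t ht
    rw [add_div, add_mul, mul_div_assoc, mul_div_assoc]
    linarith
  have cL : ∀ k, ContinuousOn (fun t => 2 * (cutoffD k t * V t) +
      (cutoffDD k t + ((n : ℝ) + 1) * (cutoffD k t / t)) * U t) (Ioi 0) := fun k =>
    (continuousOn_const.mul ((contDiffOn_cutoffD k).continuousOn.mul hVc)).add
      (((continuousOn_cutoffDD k).add (continuousOn_const.mul
        ((contDiffOn_cutoffD k).continuousOn.div continuousOn_id fun t ht => ne_of_gt ht))).mul
          hUd.continuousOn)
  refine h.le_of_tendsto (by omega) hpos (Uk := fun k t => cutoff k t * U t)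
    (Vk := fun k t => cutoff k t * V t + cutoffD k t * U t)
    (Vk' := fun k t => (cutoffD k t * V t + cutoff k t * V' t) +
      (cutoffDD k t * U t + cutoffD k t * V t)) ?_ ?_ ?_ ?_ ?_ ?_ fun k => hc _ (hmem k)
  · intro k t ht
    exact ((hasDerivAt_cutoff k ht).mul (hU t ht)).congr_deriv (add_comm _ _)
  · intro k t ht
    exact ((hasDerivAt_cutoff k ht).mul (h.hasDerivAt t ht)).add
      ((hasDerivAt_cutoffD k ht).mul (hU t ht))
  · exact fun k => Grushin.finiteEnergies hn (testFunctions_subset (hmem k)) s r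
  · refine (h.tendsto_lap cL eL).congr fun k => integral_congr_ae (ae_of_all _ fun t => ?_)
    simp only
    ring
  · exact tendsto_integral_truncated hVc h.integrable_left hDU (bs.exists_error_bound eD zD)
  · exact tendsto_integral_truncated hVc h.integrable_right hDU (br.exists_error_bound eD zD)

/-- Truncating the gradient of the extremal function by logarithmic cutoffs. -/
lemma IsExtremal.le_of_testFunctionsConst (hn : 3 ≤ n) {s r K c : ℝ} {V V' : ℝ → ℝ}
    (h : IsExtremal n s r K V V')
    (hpos : 0 < ∫ t in Ioi (0 : ℝ), t ^ (n + 1) * (t ^ r * V t ^ 2)) (bV : LogBounded n 0 V)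
    (hc : ∀ u ∈ testFunctionsConst n, Uncertainty s r c u) : c ≤ K := by
  have hVc := h.contDiffOn.continuousOn
  obtain ⟨M, hM, hcut⟩ := exists_bound_cutoff
  have hVd : ∀ k, ContDiffOn ℝ ∞ (fun t => cutoff k t * V t) (Ioi 0) := fun k =>
    (contDiffOn_cutoff k).mul h.contDiffOn
  have hi : ∀ k, IntegrableOn (fun t => cutoff k t * V t) (Ioi 0) := fun k => by
    refine IntegrableOn.of_forall_sdiff_eq_zero
      (((hVd k).continuousOn.mono (window_subset k)).integrableOn_Icc) measurableSet_Ioi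
      fun t ht => ?_
    have : cutoff k t = 0 := by
      by_contra h'
      exact ht.2 ⟨not_lt.1 fun h => h' (cutoff_of_lt h), not_lt.1 fun h => h' (cutoff_of_gt h)⟩
    simp only [this, zero_mul]
  have hU : ∀ k, ∀ t > 0, HasDerivAt (fun s => -∫ t in Ioi s, cutoff k t * V t)
      (cutoff k t * V t) t := fun k t ht =>
    (hasDerivAt_integral_Ioi (hi k) (hVd k).continuousOn ht).neg.congr_deriv (neg_neg _)
  have hmem : ∀ k, (fun p : Space n => -∫ t in Ioi (rho p), cutoff k t * V t) ∈
      testFunctionsConst n := fun k => by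
    refine comp_rho_mem_testFunctionsConst (U := fun s => -∫ t in Ioi s, cutoff k t * V t)
      (contDiffOn_of_hasDerivAt (hU k) (hVd k)) (Real.exp_pos (-(2 * cutScale k)))
      (R := Real.exp (2 * cutScale k)) (fun s hs0 hs => ?_) fun s hs => ?_
    -- The truncated gradient vanishes near 0, so its primitive is constant there, in general with a
    -- nonzero value.
    · rw [setIntegral_eq_of_subset_of_forall_sdiff_eq_zero measurableSet_Ioi
        (Ioi_subset_Ioi hs0) fun t ht => ?_]
      rw [cutoff_of_lt ((not_lt.1 ht.2).trans_lt hs), zero_mul]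
    · rw [setIntegral_eq_zero_of_forall_eq_zero fun t ht => ?_, neg_zero]
      rw [cutoff_of_gt (hs.trans ht), zero_mul]
  refine h.le_of_tendsto (by omega) hpos (Uk := fun k s => -∫ t in Ioi s, cutoff k t * V t)
    (Vk := fun k t => cutoff k t * V t)
    (Vk' := fun k t => cutoffD k t * V t + cutoff k t * V' t) hU ?_ ?_ ?_ ?_ ?_
    fun k => hc _ (hmem k)
  · intro k t ht
    exact (hasDerivAt_cutoff k ht).mul (h.hasDerivAt t ht)
  · exact fun k => Grushin.finiteEnergies hn (hmem k) s r
  · refine (h.tendsto_lap (e := fun k t => cutoffD k t * V t)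
      (fun k => (contDiffOn_cutoffD k).continuousOn.mul hVc)
      (bV.exists_error_bound (D := M) (fun k t ht => ?_) fun k t ht hl => ?_)).congr
      fun k => integral_congr_ae (ae_of_all _ fun t => ?_)
    · rw [abs_mul, abs_div, abs_of_pos ht]
      calc _ ≤ M / cutScale k * t⁻¹ * |V t| := by gcongr; exact (hcut k t ht).1
        _ = _ := by ring
    · rw [(cutoff_eq_zero k hl).2.1, zero_mul]
    · simp only
      ring
  all_goals
    have h0 : ∃ C ≥ (0 : ℝ), ∀ k : ℕ, ∀ t > (0 : ℝ), ∀ q : ℝ, t ^ (n + 1) * t ^ q * (0 : ℝ) ^ 2 ≤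
        C / cutScale k ^ 2 * logWindow k t := ⟨0, le_rfl, fun k t _ q => by simp⟩
    obtain ⟨C, hC, h0⟩ := h0
  · simpa using tendsto_integral_truncated (e := fun _ _ => 0) hVc h.integrable_left
      (fun _ => continuousOn_const) ⟨C, hC, fun k t ht => h0 k t ht s⟩
  · simpa using tendsto_integral_truncated (e := fun _ _ => 0) hVc h.integrable_right
      (fun _ => continuousOn_const) ⟨C, hC, fun k t ht => h0 k t ht r⟩

/-! ### Size of the extremal functions -/

/-- The weight is arranged so that `t^{n+1+q}(F/t)² = (t^{(n+q)/2}F)²/t`. -/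
lemma logBounded_of_bound {q B : ℝ} {F : ℝ → ℝ}
    (h : ∀ t > 0, |t ^ (((n : ℝ) + q) / 2) * F t| ≤ B) : LogBounded n q F := by
  refine ⟨B ^ 2, sq_nonneg B, fun t ht => ?_⟩
  have e : t ^ n * t ^ q = (t ^ (((n : ℝ) + q) / 2)) ^ 2 := by
    rw [← Real.rpow_natCast (t ^ _) 2, ← Real.rpow_mul ht.le, ← Real.rpow_natCast t n,
      ← Real.rpow_add ht]
    congr 1; push_cast; ring
  have h1 : (t ^ (((n : ℝ) + q) / 2) * F t) ^ 2 ≤ B ^ 2 := by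
    rw [← sq_abs]; exact pow_le_pow_left₀ (abs_nonneg _) (h t ht) 2
  calc t ^ (n + 1) * t ^ q * (F t / t) ^ 2 = (t ^ n * t ^ q) * F t ^ 2 * t⁻¹ := by
        field_simp
        ring
    _ = (t ^ (((n : ℝ) + q) / 2) * F t) ^ 2 * t⁻¹ := by rw [e]; ring
    _ ≤ _ := by gcongr

lemma LogBounded.div {F : ℝ → ℝ} (h : LogBounded n (-2) F) : LogBounded n 0 fun t => F t / t := by
  obtain ⟨B, hB, hF⟩ := h
  refine ⟨B, hB, fun t ht => le_of_eq_of_le ?_ (hF t ht)⟩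
  have : t ^ (-2 : ℝ) = (t ^ 2)⁻¹ := by rw [Real.rpow_neg ht.le]; norm_cast
  rw [this, Real.rpow_zero]
  field_simp

lemma LogBounded.neg {q : ℝ} {F : ℝ → ℝ} (h : LogBounded n q F) :
    LogBounded n q fun t => -1 * F t := by
  obtain ⟨B, hB, hF⟩ := h
  refine ⟨B, hB, fun t ht => le_of_eq_of_le ?_ (hF t ht)⟩
  ring

/-- For `n + q ≥ 0` the power `s^{(n+q)/2}` is at most `t^{(n+q)/2}` on `t > s` and moves under the
integral. -/
lemma logBounded_integral_Ioi {q : ℝ} {g : ℝ → ℝ} (hg : ∀ t > 0, 0 ≤ g t) (hq : 0 ≤ (n : ℝ) + q)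
    (hi : IntegrableOn g (Ioi 0))
    (him : IntegrableOn (fun t => t ^ (((n : ℝ) + q) / 2) * g t) (Ioi 0)) :
    LogBounded n q fun s => ∫ t in Ioi s, g t := by
  refine logBounded_of_bound (B := ∫ t in Ioi 0, t ^ (((n : ℝ) + q) / 2) * g t) fun s hs => ?_
  have hsub : Ioi s ⊆ Ioi 0 := Ioi_subset_Ioi hs.le
  have h0 : 0 ≤ ∫ t in Ioi s, g t :=
    setIntegral_nonneg measurableSet_Ioi fun t ht => hg t (hsub ht)
  rw [abs_of_nonneg (by positivity), ← integral_const_mul]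
  refine (setIntegral_mono_on ((hi.mono_set hsub).const_mul _) (him.mono_set hsub)
    measurableSet_Ioi fun t ht => ?_).trans (setIntegral_mono_set him ?_ hsub.eventuallyLE)
  · have : s ≤ t := le_of_lt ht
    have := hg t (hsub ht)
    gcongr
  · refine (ae_restrict_mem measurableSet_Ioi).mono fun t ht => ?_
    have ht : 0 < t := ht
    exact mul_nonneg (by positivity) (hg t ht)

/-! ### Size and integrability of the profiles -/

section Profiles

variable {b β : ℝ}

lemma profileLT_nonneg {t : ℝ} (ht : 0 < t) : 0 ≤ profileLT b β t := by
  unfold profileLT; positivity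

lemma profileGT_nonneg {t : ℝ} (ht : 0 < t) : 0 ≤ profileGT n b β t := by
  unfold profileGT; positivity

lemma rpow_mul_profileLT {t : ℝ} (ht : 0 < t) (m : ℝ) :
    t ^ m * profileLT b β t = t ^ (m + 1) * Real.exp (-(β / (1 - b)) * t ^ (1 - b)) := by
  rw [profileLT, ← mul_assoc, Real.rpow_add_one ht.ne']

lemma rpow_mul_profileGT {t : ℝ} (ht : 0 < t) (m : ℝ) :
    t ^ m * profileGT n b β t =
      t ^ (m + (-(n : ℝ) - 1)) * Real.exp (-(β / (b - 1)) * t ^ (1 - b)) := by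
  rw [profileGT, ← mul_assoc, Real.rpow_add ht]

lemma integrableOn_rpow_mul_profileLT (hb : b < 1) (hβ : 0 < β) {m : ℝ} (hm : 0 ≤ m) :
    IntegrableOn (fun t => t ^ m * profileLT b β t) (Ioi 0) := by
  have h1 : 0 < 1 - b := by linarith
  refine (integrableOn_rpow_mul_exp (γ := β / (1 - b)) (m := m + 1) (by positivity) h1.ne'
    (by positivity)).congr_fun (fun t ht => (rpow_mul_profileLT ht m).symm) measurableSet_Ioi

lemma integrableOn_rpow_mul_profileGT (hb : 1 < b) (hβ : 0 < β) {m : ℝ} (hm : m < n) :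
    IntegrableOn (fun t => t ^ m * profileGT n b β t) (Ioi 0) := by
  have h1 : 0 < b - 1 := by linarith
  refine (integrableOn_rpow_mul_exp (γ := β / (b - 1)) (m := m + (-(n : ℝ) - 1)) (by positivity)
    (by linarith) (div_pos_of_neg_of_neg (by linarith) (by linarith))).congr_fun
    (fun t ht => (rpow_mul_profileGT ht m).symm) measurableSet_Ioi

lemma integrableOn_profileLT (hb : b < 1) (hβ : 0 < β) :
    IntegrableOn (profileLT b β) (Ioi 0) := by
  simpa using integrableOn_rpow_mul_profileLT hb hβ le_rfl

lemma integrableOn_profileGT (hn : 1 ≤ n) (hb : 1 < b) (hβ : 0 < β) :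
    IntegrableOn (profileGT n b β) (Ioi 0) := by
  simpa using integrableOn_rpow_mul_profileGT hb hβ (m := 0) (by exact_mod_cast hn)

lemma logBounded_profileLT (hb : b < 1) (hβ : 0 < β) : LogBounded n 0 (profileLT b β) := by
  have h1 : 0 < 1 - b := by linarith
  obtain ⟨M, hM⟩ := exists_bound_rpow_mul_exp (γ := β / (1 - b)) (m := ((n : ℝ) + 0) / 2 + 1)
    (p := 1 - b) (by positivity) (by positivity) h1.ne'
  refine logBounded_of_bound (B := M) fun t ht => ?_
  rw [abs_of_nonneg (mul_nonneg (by positivity) (profileLT_nonneg ht)), rpow_mul_profileLT ht]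
  exact hM t ht

lemma logBounded_profileGT (hb : 1 < b) (hβ : 0 < β) : LogBounded n 0 (profileGT n b β) := by
  have h1 : 0 < b - 1 := by linarith
  have hn : (0 : ℝ) ≤ n := Nat.cast_nonneg n
  obtain ⟨M, hM⟩ := exists_bound_rpow_mul_exp (γ := β / (b - 1))
    (m := ((n : ℝ) + 0) / 2 + (-(n : ℝ) - 1)) (p := 1 - b) (by positivity)
    -- Both the power `-n/2 - 1` and the exponent `1 - b` are negative, so the exponential tames the
    -- singularity at 0.
    (div_nonneg_of_nonpos (by linarith) (by linarith)) (by linarith)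
  refine logBounded_of_bound (B := M) fun t ht => ?_
  rw [abs_of_nonneg (mul_nonneg (by positivity) (profileGT_nonneg ht)), rpow_mul_profileGT ht]
  exact hM t ht

end Profiles

/-! ### Sharpness of the constants -/

/-- For `b < 1` and `n ≥ 3` the numbers `n-2`, `n-2b` and `n-b-1` are nonnegative, which is what the
truncation of `u` itself requires. -/
lemma sharpOn_of_lt_one (hn : 3 ≤ n) {b : ℝ} (hb : b < 1) :
    SharpOn (testFunctions n) (-2 * b) (-b - 1) ((homDim n + 1 - b) / 2) := by
  have hn' : (3 : ℝ) ≤ n := by exact_mod_cast hn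
  refine ⟨fun u hu => uncertainty_of_one_sub hn (testFunctions_subset hu) b, fun c hc => ?_⟩
  -- The factor `-1` appears because a tail integral has derivative minus its integrand.
  obtain ⟨hE, hpos⟩ := isExtremal_profileLT (n := n) hb one_pos (-1)
  have hlog : ∀ q : ℝ, 0 ≤ (n : ℝ) + q →
      LogBounded n q fun s => ∫ t in Ioi s, profileLT b 1 t := fun q hq =>
    logBounded_integral_Ioi (fun t ht => profileLT_nonneg ht) hq
      (integrableOn_profileLT hb one_pos) (integrableOn_rpow_mul_profileLT hb one_pos (by linarith))
  refine hE.le_of_testFunctions hn (U := fun s => ∫ t in Ioi s, profileLT b 1 t) (fun t ht => ?_)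
    (hpos (by norm_num)) (logBounded_profileLT hb one_pos).neg (hlog _ (by linarith)).div
    (hlog _ (by linarith)) (hlog _ (by linarith)) hc
  exact (hasDerivAt_integral_Ioi (integrableOn_profileLT hb one_pos)
    contDiffOn_profileLT.continuousOn ht).congr_deriv (neg_one_mul _).symm

lemma sharpOn_const_of_one_lt (hn : 3 ≤ n) {b : ℝ} (hb : 1 < b) :
    SharpOn (testFunctionsConst n) (-2 * b) (-b - 1) ((homDim n + b - 1) / 2) := by
  refine ⟨fun u hu => uncertainty_of_sub_one hn hu b, fun c hc => ?_⟩
  obtain ⟨hE, hpos⟩ := isExtremal_profileGT (n := n) hb one_pos (-1)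
  exact hE.le_of_testFunctionsConst hn (hpos (by norm_num)) (logBounded_profileGT hb one_pos).neg hc

/-- The extremal tends to a nonzero constant at the origin. Cutting it off there is harmless when `n
- 2b ≥ 0`, which is the bound on `b`. -/
lemma sharpOn_of_one_lt (hn : 3 ≤ n) {b : ℝ} (hb : 1 < b) (hb' : b ≤ (homDim n - 2) / 2) :
    SharpOn (testFunctions n) (-2 * b) (-b - 1) ((homDim n + b - 1) / 2) := by
  have hn' : (3 : ℝ) ≤ n := by exact_mod_cast hn
  rw [homDim, add_sub_cancel_right] at hb'
  refine ⟨fun u hu => uncertainty_of_sub_one hn (testFunctions_subset hu) b, fun c hc => ?_⟩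
  obtain ⟨hE, hpos⟩ := isExtremal_profileGT (n := n) hb one_pos (-1)
  have hi := integrableOn_profileGT (n := n) (by omega) hb one_pos
  have hlog : ∀ q : ℝ, 0 ≤ (n : ℝ) + q → q < n →
      LogBounded n q fun s => ∫ t in Ioi s, profileGT n b 1 t := fun q hq hq' =>
    logBounded_integral_Ioi (fun t ht => profileGT_nonneg ht) hq hi
      (integrableOn_rpow_mul_profileGT hb one_pos (by linarith))
  refine hE.le_of_testFunctions hn (U := fun s => ∫ t in Ioi s, profileGT n b 1 t)
    (fun t ht => ?_) (hpos (by norm_num)) (logBounded_profileGT hb one_pos).neg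
    (hlog _ (by linarith) (by linarith)).div (hlog _ (by linarith) (by linarith))
    (hlog _ (by linarith) (by linarith)) hc
  exact (hasDerivAt_integral_Ioi hi contDiffOn_profileGT.continuousOn ht).congr_deriv
    (neg_one_mul _).symm

/-! ### Equality cases -/

lemma attainedBy_of_isExtremal (hn : 1 ≤ n) {s r K : ℝ} {U W : ℝ → ℝ → ℝ}
    (hE : ∀ β > 0, ∀ κ, (∃ V', IsExtremal n s r K (fun t => κ * W β t) V') ∧
      (κ ≠ 0 → 0 < ∫ t in Ioi (0 : ℝ), t ^ (n + 1) * (t ^ r * (κ * W β t) ^ 2)))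
    (hU : ∀ β > 0, ∃ μ ≠ 0, ∀ t > 0, HasDerivAt (U β) (μ * W β t) t) :
    AttainedBy s r K fun β (p : Space n) => U β (rho p) := by
  intro α β hβ
  obtain ⟨μ, hμ, hd⟩ := hU β hβ
  obtain ⟨⟨V', h⟩, hpos⟩ := hE β hβ (α * μ)
  have hd' : ∀ t > 0, HasDerivAt (fun s => α * U β s) (α * μ * W β t) t := fun t ht =>
    ((hd t ht).const_mul α).congr_deriv (mul_assoc _ _ _).symm
  have h1 := h.isEqualityCase hn (U := fun s => α * U β s) hd'
  have h2 := h.gradEnergy_pos hn (U := fun s => α * U β s) hd'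
  exact ⟨h1, fun hα => h2 (hpos (mul_ne_zero hα hμ))⟩

lemma attainedBy_of_lt_one (hn : 1 ≤ n) {b : ℝ} (hb : b < 1) :
    AttainedBy (-2 * b) (-b - 1) ((homDim n + 1 - b) / 2) fun β (p : Space n) =>
      ∫ s in Ioi (rho p), s * Real.exp (-β * (s ^ (1 - b) / (1 - b))) := by
  refine attainedBy_of_isExtremal hn (W := profileLT b)
    (U := fun β r => ∫ s in Ioi r, s * Real.exp (-β * (s ^ (1 - b) / (1 - b))))
    (fun β hβ κ => ?_) fun β hβ => ⟨-1, by norm_num, fun t ht => ?_⟩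
  · obtain ⟨h1, h2⟩ := isExtremal_profileLT (n := n) hb hβ κ
    exact ⟨⟨_, h1⟩, h2⟩
  · have e : (fun s : ℝ => s * Real.exp (-β * (s ^ (1 - b) / (1 - b)))) = profileLT b β :=
      funext fun s => by rw [profileLT]; congr 2; ring
    simp only [e]
    exact (hasDerivAt_integral_Ioi (integrableOn_profileLT hb hβ)
      contDiffOn_profileLT.continuousOn ht).congr_deriv (neg_one_mul _).symm

lemma attainedBy_of_one_lt (hn : 1 ≤ n) {b : ℝ} (hb : 1 < b) :
    AttainedBy (-2 * b) (-b - 1) ((homDim n + b - 1) / 2) fun β (p : Space n) =>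
      ∫ s in Ioi (rho p), s ^ (1 - homDim n) * Real.exp (-β * (s ^ (1 - b) / (b - 1))) := by
  refine attainedBy_of_isExtremal hn (W := profileGT n b)
    (U := fun β r => ∫ s in Ioi r, s ^ (1 - homDim n) * Real.exp (-β * (s ^ (1 - b) / (b - 1))))
    (fun β hβ κ => ?_) fun β hβ => ⟨-1, by norm_num, fun t ht => ?_⟩
  · obtain ⟨h1, h2⟩ := isExtremal_profileGT (n := n) hb hβ κ
    exact ⟨⟨_, h1⟩, h2⟩
  · have e : (fun s : ℝ => s ^ (1 - homDim n) * Real.exp (-β * (s ^ (1 - b) / (b - 1)))) =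
        profileGT n b β := funext fun s => by
      rw [profileGT, homDim]; congr 2 <;> ring
    simp only [e]
    exact (hasDerivAt_integral_Ioi (integrableOn_profileGT hn hb hβ)
      contDiffOn_profileGT.continuousOn ht).congr_deriv (neg_one_mul _).symm

lemma attainedBy_heisenberg (hn : 1 ≤ n) :
    AttainedBy 2 0 ((homDim n + 2) / 2) fun β (p : Space n) => Real.exp (-β * rho p ^ 2) := by
  refine attainedBy_of_isExtremal hn (W := fun β => profileLT (-1) (2 * β))
    (U := fun β s => Real.exp (-β * s ^ 2))
    -- The case `b = -1` with parameter `2β`, since `2β/(1-b) = β`.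
    (fun β hβ κ => ?_) fun β hβ => ⟨-(2 * β), by simpa using hβ.ne', fun t _ => ?_⟩
  · have h := isExtremal_profileLT (n := n) (b := -1) (β := 2 * β) (by norm_num) (by positivity) κ
    rw [show (-2 : ℝ) * -1 = 2 by norm_num, show -(-1 : ℝ) - 1 = 0 by norm_num,
      show homDim n + 1 - -1 = homDim n + 2 by ring] at h
    exact ⟨⟨_, h.1⟩, h.2⟩
  · refine (((hasDerivAt_pow 2 t).const_mul (-β)).exp).congr_deriv ?_
    rw [profileLT, show (1 : ℝ) - -1 = 2 by norm_num, Real.rpow_two,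
      mul_div_cancel_left₀ β two_ne_zero]
    ring

lemma attainedBy_hydrogen (hn : 1 ≤ n) :
    AttainedBy 0 (-1) ((homDim n + 1) / 2) fun β (p : Space n) =>
      (1 + β * rho p) * Real.exp (-β * rho p) := by
  refine attainedBy_of_isExtremal hn (W := profileLT 0)
    (U := fun β s => (1 + β * s) * Real.exp (-β * s))
    -- The case `b = 0`, where `((1+βt)e^{-βt})' = -β²te^{-βt}`.
    (fun β hβ κ => ?_) fun β hβ => ⟨-β ^ 2, by simpa using hβ.ne', fun t _ => ?_⟩
  · have h := isExtremal_profileLT (n := n) (b := 0) zero_lt_one hβ κ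
    rw [mul_zero, neg_zero, zero_sub, sub_zero] at h
    exact ⟨⟨_, h.1⟩, h.2⟩
  · refine ((((hasDerivAt_id t).const_mul β).const_add 1).mul
      ((hasDerivAt_id t).const_mul (-β)).exp).congr_deriv ?_
    rw [profileLT, sub_zero, Real.rpow_one, div_one]
    simp only [id]
    ring

end Grushin

end

/-! ### Assembly of the four cases -/

theorem mainTheorem12 (n : ℕ) (Q : ℝ) (hQ : Q = Grushin.homDim n) (hQ5 : 5 ≤ Q) :
    -- (a) Heisenberg
    ((∀ u ∈ Grushin.testFunctions n, Grushin.FiniteEnergies 2 0 u) ∧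
      Grushin.SharpOn (Grushin.testFunctions n) 2 0 ((Q + 2) / 2) ∧
      Grushin.AttainedBy 2 0 ((Q + 2) / 2)
        (fun β (p : Grushin.Space n) => Real.exp (-β * Grushin.rho p ^ 2))) ∧
    -- (b) Hydrogen
    ((∀ u ∈ Grushin.testFunctions n, Grushin.FiniteEnergies 0 (-1) u) ∧
      Grushin.SharpOn (Grushin.testFunctions n) 0 (-1) ((Q + 1) / 2) ∧
      Grushin.AttainedBy 0 (-1) ((Q + 1) / 2)
        (fun β (p : Grushin.Space n) =>
          (1 + β * Grushin.rho p) * Real.exp (-β * Grushin.rho p))) ∧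
    -- (c) weights with b < 1
    (∀ b : ℝ, b < 1 →
      (∀ u ∈ Grushin.testFunctions n, Grushin.FiniteEnergies (-2 * b) (-b - 1) u) ∧
      Grushin.SharpOn (Grushin.testFunctions n) (-2 * b) (-b - 1) ((Q + 1 - b) / 2) ∧
      Grushin.AttainedBy (-2 * b) (-b - 1) ((Q + 1 - b) / 2)
        (fun β (p : Grushin.Space n) =>
          ∫ s in Set.Ioi (Grushin.rho p), s * Real.exp (-β * (s ^ (1 - b) / (1 - b))))) ∧
    -- (d) weights with b > 1
    (∀ b : ℝ, 1 < b →
      (∀ u ∈ Grushin.testFunctions n,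
        Grushin.FiniteEnergies (-2 * b) (-b - 1) u ∧
          Grushin.Uncertainty (-2 * b) (-b - 1) ((Q + b - 1) / 2) u) ∧
      (∀ u ∈ Grushin.testFunctionsConst n, Grushin.FiniteEnergies (-2 * b) (-b - 1) u) ∧
      Grushin.SharpOn (Grushin.testFunctionsConst n) (-2 * b) (-b - 1) ((Q + b - 1) / 2) ∧
      (b ≤ (Q - 2) / 2 →
        Grushin.SharpOn (Grushin.testFunctions n) (-2 * b) (-b - 1) ((Q + b - 1) / 2)) ∧
      Grushin.AttainedBy (-2 * b) (-b - 1) ((Q + b - 1) / 2)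
        (fun β (p : Grushin.Space n) =>
          ∫ s in Set.Ioi (Grushin.rho p),
            s ^ (1 - Q) * Real.exp (-β * (s ^ (1 - b) / (b - 1))))) := by
  subst hQ
  have hn : 3 ≤ n := by
    rw [Grushin.homDim] at hQ5
    have : (3 : ℝ) ≤ n := by linarith
    exact_mod_cast this
  have hn1 : 1 ≤ n := by omega
  have hfin : ∀ s r : ℝ, ∀ u ∈ Grushin.testFunctions n, Grushin.FiniteEnergies s r u :=
    fun s r u hu => Grushin.finiteEnergies hn (Grushin.testFunctions_subset hu) s r
  -- Parts (a) and (b) are part (c) at `b = -1` and `b = 0`; only the exponents need normalizing.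
  have ha := Grushin.sharpOn_of_lt_one hn (b := -1) (by norm_num)
  rw [show (-2 : ℝ) * -1 = 2 by norm_num, show -(-1 : ℝ) - 1 = 0 by norm_num,
    show Grushin.homDim n + 1 - -1 = Grushin.homDim n + 2 by ring] at ha
  have hb := Grushin.sharpOn_of_lt_one hn (b := 0) zero_lt_one
  rw [mul_zero, neg_zero, zero_sub, sub_zero] at hb
  exact ⟨⟨hfin _ _, ha, Grushin.attainedBy_heisenberg hn1⟩,
    ⟨hfin _ _, hb, Grushin.attainedBy_hydrogen hn1⟩,
    fun b hb => ⟨hfin _ _, Grushin.sharpOn_of_lt_one hn hb, Grushin.attainedBy_of_lt_one hn1 hb⟩,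
    fun b hb => ⟨fun u hu => ⟨hfin _ _ u hu,
        Grushin.uncertainty_of_sub_one hn (Grushin.testFunctions_subset hu) b⟩,
      fun u hu => Grushin.finiteEnergies hn hu _ _, Grushin.sharpOn_const_of_one_lt hn hb,
      fun hb' => Grushin.sharpOn_of_one_lt hn hb hb', Grushin.attainedBy_of_one_lt hn1 hb⟩⟩
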